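/- Let $G$ be a finite-dimensional (Hausdorff) Lie group with Lie algebra $\mathfrak g$ and left-invariant Maurer–Cartan form $\Theta$, and let $\Omega G$ be its group of smooth loops $S^1=\mathbb R/2\pi\mathbb Z\to G$ with $\gamma(0)=1$, with Lie algebra $\Omega\mathfrak g$ of smooth loops in $\mathfrak g$ vanishing at $0$. Let $M$ be a smooth finite-dimensional paracompact Hausdorff manifold, $\pi\colon\mathsf Q\to M$ a smooth principal $\Omega G$-bundle, $\mathsf A$ an $\Omega G$-connection on $\mathsf Q$ (an $\Omega\mathfrak g$-valued one-form) and $\Phi\colon\mathsf Q\to L\mathfrak g=C^\infty(S^1,\mathfrak g)$ a Higgs field, i.e. a smooth map with $\Phi(q\gamma)=\mathrm{Ad}(\gamma^{-1})\Phi(q)+\gamma^{-1}\partial\gamma$, where $\partial=\partial/\partial\theta$. Let $k\ge 1$ and let $f\in I^k(\mathfrak g)$ be a symmetric $k$-linear form on $\mathfrak g$ that is invariant under the adjoint action of $G$. Products of $\mathfrak g$-valued forms inside $f(\cdot,\dots,\cdot)$ and $[\cdot,\cdot]$ are wedge products normalised as sums over shuffles, so that $[\alpha,\beta](X,Y)=[\alpha(X),\beta(Y)]-[\alpha(Y),\beta(X)]$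 for one-forms. Put $\mathsf F=d\mathsf A+\tfrac12[\mathsf A,\mathsf A]$ and $\nabla\Phi=d\Phi+[\mathsf A,\Phi]-\partial\mathsf A$. The string form $s_f(\mathsf A,\Phi)\in\Omega^{2k-1}(M)$ is the form whose pullback to $\mathsf Q$ is $k\int_0^{2\pi}f(\nabla\Phi,\mathsf F,\dots,\mathsf F)\,d\theta$. The transgression form on $G$ is $$\tau_f=\Big(-\frac12\Big)^{k-1}\frac{k!\,(k-1)!}{(2k-1)!}\,f\big(\Theta,\underbrace{[\Theta,\Theta],\dots,[\Theta,\Theta]}_{k-1}\big).$$ For $q\in\mathsf Q$ let $g_q\colon\mathbb R\to G$ be the solution of $g_q^{-1}\partial g_q=\Phi(q)$, $g_q(0)=1$, and let $\mathrm{hol}_\Phi\colon M\to G$ be the map with $\mathrm{hol}_\Phi(\pi(q))=g_q(2\pi)$. For $\theta\in[0,2\pi]$ let $\hat A_\theta$ be the $\mathfrak g$-valued one-form on $\mathsf Q$ $$\hat A_\theta=\mathrm{Ad}(g(\theta))\big(\mathsf A(\theta)-g(\theta)^{-1}dg(\theta)\big),$$ where $g(\theta)\colon\mathsf Q\to G$,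 $q\mapsto g_q(\theta)$. The canonical form $\chi=\chi_f(\mathsf A,\Phi)\in\Omega^{2k-2}(M)$ is the form whose pullback to $\mathsf Q$ is $$\sum_{i=0}^{k-2}\frac{k\,(k-1)!}{2^i\,i!\,(k-2-i)!\,(k+i)}\int_0^{2\pi}f\big(\partial_\theta\hat A_\theta,\hat A_\theta,\underbrace{d\hat A_\theta,\dots,d\hat A_\theta}_{k-2-i},\underbrace{[\hat A_\theta,\hat A_\theta],\dots,[\hat A_\theta,\hat A_\theta]}_{i}\big)\,d\theta$$ (so $\chi=0$ for $k=1$). Then the paths $g_q$ exist and are unique, $\mathrm{hol}_\Phi$ is a well-defined smooth map, the two displayed forms on $\mathsf Q$ descend to smooth forms $s_f(\mathsf A,\Phi)$ and $\chi$ on $M$, and $$s_f(\mathsf A,\Phi)=\mathrm{hol}_\Phi^*\tau_f+d\chi .$$ Moreover $\chi$ is natural: for every smooth map $g\colon N\to M$ from a smooth finite-dimensional paracompact Hausdorff manifold $N$, the pullback connection and Higgs field on $g^*\mathsf Q\to N$ satisfy $\chi_f(g^*\mathsf A,g^*\Phi)=g^*\chi_f(\mathsf A,\Phi)$. -/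

import Mathlib

open Set Topology
open scoped ContDiff Manifold

noncomputable section

namespace OmegaG

/-- The Euclidean space `ℝⁿ`. -/
abbrev Euc (n : ℕ) : Type := EuclideanSpace ℝ (Fin n)

/-! ### Products of Lie-algebra-valued alternating forms -/

section Algebra

variable {V : Type*} [AddCommGroup V] [Module ℝ V] [TopologicalSpace V]
variable {L : Type*} [AddCommGroup L] [Module ℝ L] [TopologicalSpace L]
variable {F : Type*} [AddCommGroup F] [Module ℝ F] [TopologicalSpace F]

/-- The multilinear map
`(v_{i,j}) ↦ f (η₁ (v_{1,1}, v_{1,2}, …), η₂ (v_{2,1}, …), …)`, before antisymmetrisation. -/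
def blockComp {k : ℕ} (f : ContinuousMultilinearMap ℝ (fun _ : Fin k => L) F) {p : Fin k → ℕ}
    (η : ∀ i, V [⋀^Fin (p i)]→L[ℝ] L) :
    ContinuousMultilinearMap ℝ (fun _ : (Σ i, Fin (p i)) => V) F where
  toMultilinearMap :=
    f.toMultilinearMap.compMultilinearMap
      (fun i => (η i).toContinuousMultilinearMap.toMultilinearMap)
  cont := f.cont.comp (continuous_pi fun i => (η i).cont.comp
    (continuous_pi fun j => continuous_apply (⟨i, j⟩ : Σ i, Fin (p i))))

theorem blockComp_apply {k : ℕ} (f : ContinuousMultilinearMap ℝ (fun _ : Fin k => L) F)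
    {p : Fin k → ℕ} (η : ∀ i, V [⋀^Fin (p i)]→L[ℝ] L) (v : (Σ i, Fin (p i)) → V) :
    blockComp f η v = f fun i => η i fun j => v ⟨i, j⟩ := rfl

variable [IsTopologicalAddGroup F] [ContinuousConstSMul ℝ F]

/-- `f (η₁, …, η_k) = f (η₁ ∧ ⋯ ∧ η_k)` for a `k`-linear map `f` on `L` and `L`-valued alternating
forms `η_i` of degree `p_i`:
`f (η₁, …, η_k) (X₁, …, X_n) = (∏ p_i !)⁻¹ ∑_σ sign σ • f (η₁ (X_{σ 1}, …), …, η_k (…, X_{σ n}))`,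
`n = p₁ + ⋯ + p_k`. -/
def polyWedge {k : ℕ} (f : ContinuousMultilinearMap ℝ (fun _ : Fin k => L) F) {p : Fin k → ℕ}
    (η : ∀ i, V [⋀^Fin (p i)]→L[ℝ] L) {n : ℕ} (h : ∑ i, p i = n) : V [⋀^Fin n]→L[ℝ] F :=
  (∏ i, ((p i).factorial : ℝ))⁻¹ •
    ContinuousMultilinearMap.alternatization
      ((blockComp f η).domDomCongr (finSigmaFinEquiv.trans (finCongr h)))

theorem polyWedge_apply {k : ℕ} (f : ContinuousMultilinearMap ℝ (fun _ : Fin k => L) F)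
    {p : Fin k → ℕ} (η : ∀ i, V [⋀^Fin (p i)]→L[ℝ] L) {n : ℕ} (h : ∑ i, p i = n) (v : Fin n → V) :
    polyWedge f η h v = (∏ i, ((p i).factorial : ℝ))⁻¹ • ∑ σ : Equiv.Perm (Fin n),
      Equiv.Perm.sign σ •
        f fun i => η i fun j => v (σ (finCongr h (finSigmaFinEquiv ⟨i, j⟩))) := by
  simp only [polyWedge, ContinuousAlternatingMap.smul_apply,
    ContinuousMultilinearMap.alternatization_apply_apply]
  rfl

/-- A linear map regarded as an alternating form of degree one. -/
def oneForm (α : V →L[ℝ] F) : V [⋀^Fin 1]→L[ℝ] F :=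
  ContinuousAlternatingMap.ofSubsingleton ℝ V F 0 α

end Algebra

/-! ### Differential forms on finite-dimensional manifolds -/

section Forms

/-- Real-valued differential `k`-forms on a `d`-dimensional manifold (not yet required to be
smooth, see `DForm.IsSmooth`). -/
abbrev DForm (d : ℕ) (M : Type*) [TopologicalSpace M] [ChartedSpace (Euc d) M] (k : ℕ) : Type _ :=
  ∀ x : M, TangentSpace (𝓡 d) x [⋀^Fin k]→L[ℝ] ℝ

variable {d d' k : ℕ} {M N : Type*} [TopologicalSpace M] [ChartedSpace (Euc d) M]
  [TopologicalSpace N] [ChartedSpace (Euc d') N]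

/-- The expression of a form in the chart at `x`, i.e. its pullback under the inverse chart. -/
def DForm.inChart (η : DForm d M k) (x : M) (y : Euc d) : Euc d [⋀^Fin k]→L[ℝ] ℝ :=
  (η ((extChartAt (𝓡 d) x).symm y)).compContinuousLinearMap
    (mfderiv 𝓘(ℝ, Euc d) (𝓡 d) (extChartAt (𝓡 d) x).symm y)

/-- A form is smooth if its expressions in charts are. -/
def DForm.IsSmooth (η : DForm d M k) : Prop :=
  ∀ x : M, ContDiffOn ℝ ∞ (η.inChart x) (extChartAt (𝓡 d) x).target

/-- The exterior derivative, computed in charts. -/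
def DForm.extDer (η : DForm d M k) : DForm d M (k + 1) := fun x =>
  (extDeriv (η.inChart x) (extChartAt (𝓡 d) x x)).compContinuousLinearMap
    (mfderiv (𝓡 d) 𝓘(ℝ, Euc d) (extChartAt (𝓡 d) x) x)

/-- The pullback of a form under a map. -/
def DForm.pullback (g : N → M) (η : DForm d M k) : DForm d' N k := fun x =>
  (η (g x)).compContinuousLinearMap (mfderiv (𝓡 d') (𝓡 d) g x)

end Forms

/-! ### Lie groups -/

section LieGroups

/-- The Lie algebra of an `e`-dimensional Lie group `G`: the tangent space at the identity, which
for Mathlib is by definition the model space. -/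
abbrev LieAlg (e : ℕ) (_G : Type*) : Type := Euc e

variable {e : ℕ} (G : Type*) [TopologicalSpace G] [ChartedSpace (Euc e) G] [Group G]

/-- The adjoint action of `g` on the Lie algebra: the derivative of `x ↦ g x g⁻¹` at `1`. -/
def Ad (g : G) : LieAlg e G →L[ℝ] LieAlg e G :=
  (mfderiv (𝓡 e) (𝓡 e) (fun x : G => g * x * g⁻¹) 1 : Euc e →L[ℝ] Euc e)

/-- The (left-invariant) Maurer-Cartan form of `G`: `Θ_g` is the derivative of `x ↦ g⁻¹ x`
at `g`. -/
def maurerCartan (g : G) : TangentSpace (𝓡 e) g →L[ℝ] LieAlg e G :=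
  (mfderiv (𝓡 e) (𝓡 e) (fun x : G => g⁻¹ * x) g : Euc e →L[ℝ] Euc e)

/-- The pullback `h⁻¹ dh` of the Maurer-Cartan form under a map `h : ℝⁿ → G`. -/
def mcPullback {n : ℕ} (h : Euc n → G) (y : Euc n) : Euc n →L[ℝ] LieAlg e G :=
  (maurerCartan G (h y)).comp (mfderiv (𝓡 n) (𝓡 e) h y)

/-- The logarithmic derivative `γ⁻¹ ∂γ` of a path in `G`. -/
def logDeriv (γ : ℝ → G) (θ : ℝ) : LieAlg e G :=
  maurerCartan G (γ θ) ((mfderiv 𝓘(ℝ, ℝ) (𝓡 e) γ θ : ℝ →L[ℝ] TangentSpace (𝓡 e) (γ θ)) 1)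

variable [LieGroup (𝓡 e) ∞ G]

instance lieGroup_minSmoothness : LieGroup (𝓡 e) (minSmoothness ℝ 3) G := by
  rw [minSmoothness_of_isRCLikeNormedField]
  infer_instance

/-- The Lie bracket of the Lie algebra of `G`, defined by left-invariant vector fields. -/
def lieBracket (X Y : LieAlg e G) : LieAlg e G :=
  Bracket.bracket (L := GroupLieAlgebra (𝓡 e) G) (M := GroupLieAlgebra (𝓡 e) G) X Y

/-- The Lie bracket as a continuous bilinear map. -/
def bracketCLM : LieAlg e G →L[ℝ] LieAlg e G →L[ℝ] LieAlg e G :=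
  (LinearMap.mk₂ ℝ (lieBracket G)
    (fun X Y Z => add_lie (L := GroupLieAlgebra (𝓡 e) G) (M := GroupLieAlgebra (𝓡 e) G) X Y Z)
    (fun c X Y => smul_lie (L := GroupLieAlgebra (𝓡 e) G) (M := GroupLieAlgebra (𝓡 e) G) c X Y)
    (fun X Y Z => lie_add (L := GroupLieAlgebra (𝓡 e) G) (M := GroupLieAlgebra (𝓡 e) G) X Y Z)
    (fun c X Y =>
      lie_smul (L := GroupLieAlgebra (𝓡 e) G) (M := GroupLieAlgebra (𝓡 e) G) c X Y)
    ).toContinuousBilinearMap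

/-- The Lie bracket as a continuous multilinear map in two variables. -/
def bracketMulti : ContinuousMultilinearMap ℝ (fun _ : Fin 2 => LieAlg e G) (LieAlg e G) where
  toFun v := bracketCLM G (v 0) (v 1)
  map_update_add' v i x y := by fin_cases i <;> simp
  map_update_smul' v i c x := by fin_cases i <;> simp
  cont := by fun_prop

/-- The bracket `[α, β]` of Lie-algebra-valued one-forms,
`[α, β] (X, Y) = [α X, β Y] - [α Y, β X]`. -/
def formBracket {V : Type*} [AddCommGroup V] [Module ℝ V] [TopologicalSpace V]
    (α β : V [⋀^Fin 1]→L[ℝ] LieAlg e G) : V [⋀^Fin 2]→L[ℝ] LieAlg e G :=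
  polyWedge (bracketMulti G) (p := fun _ => 1) ![α, β] (by simp)

/-- `I^k(𝔤)`: symmetric `k`-linear forms on the Lie algebra, invariant under the adjoint action of
`G` (continuity is automatic in finite dimensions). -/
structure InvPoly (e : ℕ) (G : Type*) [TopologicalSpace G] [ChartedSpace (Euc e) G] [Group G]
    (k : ℕ) where
  toMulti : ContinuousMultilinearMap ℝ (fun _ : Fin k => LieAlg e G) ℝ
  symm : ∀ (σ : Equiv.Perm (Fin k)) (v : Fin k → LieAlg e G), toMulti (v ∘ σ) = toMulti v
  invariant : ∀ (g : G) (v : Fin k → LieAlg e G), toMulti (fun i => Ad G g (v i)) = toMulti v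

variable {G}

/-- `f (α, β, …, β)` for a one-form `α` and a two-form `β` repeated `k` times. -/
def InvPoly.oneTwo {V : Type*} [AddCommGroup V] [Module ℝ V] [TopologicalSpace V] {k : ℕ}
    (f : InvPoly e G (k + 1)) (α : V [⋀^Fin 1]→L[ℝ] LieAlg e G)
    (β : V [⋀^Fin 2]→L[ℝ] LieAlg e G) : V [⋀^Fin (2 * k + 1)]→L[ℝ] ℝ :=
  polyWedge f.toMulti (p := Fin.cons 1 fun _ : Fin k => 2)
    (Fin.cons (α := fun i : Fin (k + 1) =>
      V [⋀^Fin ((Fin.cons 1 fun _ : Fin k => 2 : Fin (k + 1) → ℕ) i)]→L[ℝ] LieAlg e G)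
      α fun _ => β)
    (by simp [Fin.sum_univ_succ]; ring)

/-- `f (α, α', β₁, …, β_l)` for one-forms `α`, `α'` and two-forms `β_j`. -/
def InvPoly.oneOneTwo {V : Type*} [AddCommGroup V] [Module ℝ V] [TopologicalSpace V] {l : ℕ}
    (f : InvPoly e G (l + 2)) (α α' : V [⋀^Fin 1]→L[ℝ] LieAlg e G)
    (β : Fin l → V [⋀^Fin 2]→L[ℝ] LieAlg e G) : V [⋀^Fin (2 * (l + 1))]→L[ℝ] ℝ :=
  polyWedge f.toMulti (p := Fin.cons 1 (Fin.cons 1 fun _ : Fin l => 2))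
    (Fin.cons (α := fun i : Fin (l + 2) =>
      V [⋀^Fin ((Fin.cons 1 (Fin.cons 1 fun _ : Fin l => 2) : Fin (l + 2) → ℕ) i)]→L[ℝ]
        LieAlg e G)
      α (Fin.cons (α := fun i : Fin (l + 1) =>
        V [⋀^Fin ((Fin.cons 1 fun _ : Fin l => 2 : Fin (l + 1) → ℕ) i)]→L[ℝ] LieAlg e G)
        α' β))
    (by simp [Fin.sum_univ_succ]; ring)

/-- The transgression form of `f ∈ I^{k+1}(𝔤)` on `G`,
`τ_f = (-1/2)^k (k+1)! k! / (2k+1)! • f (Θ, [Θ,Θ], …, [Θ,Θ])`. -/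
def transgression {k : ℕ} (f : InvPoly e G (k + 1)) : DForm e G (2 * k + 1) := fun g =>
  ((-1 / 2 : ℝ) ^ k * ((k + 1).factorial * k.factorial : ℝ) / ((2 * k + 1).factorial : ℝ)) •
    f.oneTwo (oneForm (maurerCartan G g))
      (formBracket G (oneForm (maurerCartan G g)) (oneForm (maurerCartan G g)))

end LieGroups

/-! ### The based loop group and its principal bundles -/

section LoopBundles

/-- The based loop group `ΩG`: smooth maps from the circle `ℝ / 2πℤ` to `G` (written as periodic
maps on `ℝ`) that send `0` to the identity, with pointwise operations. -/
def LoopGroup (e : ℕ) (G : Type*) [TopologicalSpace G] [ChartedSpace (Euc e) G] [Group G]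
    [LieGroup (𝓡 e) ∞ G] : Subgroup (ℝ → G) where
  carrier := {γ | ContMDiff 𝓘(ℝ, ℝ) (𝓡 e) ∞ γ ∧ Function.Periodic γ (2 * Real.pi) ∧ γ 0 = 1}
  mul_mem' {a b} ha hb := ⟨ha.1.mul hb.1, ha.2.1.mul hb.2.1, by simp [ha.2.2, hb.2.2]⟩
  one_mem' := ⟨contMDiff_const, fun _ => rfl, rfl⟩
  inv_mem' {a} ha := ⟨ha.1.inv, fun t => by simp [ha.2.1 t], by simp [ha.2.2]⟩

variable {e d d' : ℕ} {G : Type*} [TopologicalSpace G] [ChartedSpace (Euc e) G] [Group G]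
  [LieGroup (𝓡 e) ∞ G]

/-- Smoothness of a map `γ` from a subset `V` of a finite-dimensional manifold to the Fréchet
manifold `ΩG`; by the exponential law this means that `(x, θ) ↦ γ(x)(θ)` is smooth. -/
def SmoothLoopsOn (n : ℕ) {X : Type*} [TopologicalSpace X] [ChartedSpace (Euc n) X]
    (V : Set X) (γ : X → LoopGroup e G) : Prop :=
  ContMDiffOn ((𝓡 n).prod 𝓘(ℝ, ℝ)) (𝓡 e) ∞ (fun z : X × ℝ => (γ z.1 : ℝ → G) z.2) (V ×ˢ univ)

/-- A smooth principal `ΩG`-bundle over `M` with total space `Q`: a right action of `ΩG`, simply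
transitive on the fibres of `proj`, together with local sections `sec x` over an open cover
`base x` of `M` (`x ∈ base x`) whose transition functions are smooth maps into `ΩG`. The induced
bijections `base x × ΩG ≃ proj⁻¹ (base x)` are the local trivialisations and define the smooth
structure of `Q`. -/
structure LoopBundle (e d : ℕ) (G M Q : Type*) [TopologicalSpace G] [ChartedSpace (Euc e) G]
    [Group G] [LieGroup (𝓡 e) ∞ G] [TopologicalSpace M] [ChartedSpace (Euc d) M] where
  proj : Q → M
  act : Q → LoopGroup e G → Q
  act_one : ∀ q, act q 1 = q
  act_mul : ∀ q γ γ', act q (γ * γ') = act (act q γ) γ'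
  proj_act : ∀ q γ, proj (act q γ) = proj q
  free : ∀ q γ, act q γ = q → γ = 1
  transitive : ∀ q q', proj q = proj q' → ∃ γ, act q γ = q'
  base : M → Set M
  isOpen_base : ∀ x, IsOpen (base x)
  mem_base : ∀ x, x ∈ base x
  sec : M → M → Q
  proj_sec : ∀ x, ∀ y ∈ base x, proj (sec x y) = y
  smooth_transition : ∀ (x x' : M) (γ : M → LoopGroup e G),
    (∀ y ∈ base x ∩ base x', act (sec x y) (γ y) = sec x' y) →
      SmoothLoopsOn d (base x ∩ base x') γ

variable {M Q : Type*} [TopologicalSpace M] [ChartedSpace (Euc d) M]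

/-- A plot of `Q`: a map from (an open subset `V` of) `ℝⁿ` to the total space that is smooth, i.e.
whose components in the local trivialisations `base x × ΩG` are smooth. -/
structure LoopBundle.IsPlotOn (B : LoopBundle e d G M Q) {n : ℕ} (V : Set (Euc n))
    (p : Euc n → Q) : Prop where
  isOpen : IsOpen V
  smooth_proj : ContMDiffOn (𝓡 n) (𝓡 d) ∞ (fun y => B.proj (p y)) V
  smooth_fibre : ∀ (x : M) (γ : Euc n → LoopGroup e G),
    (∀ y ∈ V ∩ {y | B.proj (p y) ∈ B.base x}, B.act (B.sec x (B.proj (p y))) (γ y) = p y) →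
      SmoothLoopsOn n (V ∩ {y | B.proj (p y) ∈ B.base x}) γ

/-- An `ΩG`-connection on the bundle: a smooth one-form `𝖠` on the total space with values in
`Ω𝔤`, i.e. in smooth periodic `𝔤`-valued functions of `θ` vanishing at `θ = 0`, with
`R_γ^* 𝖠 = Ad(γ⁻¹) 𝖠`, that reproduces the generators of fundamental vector fields. The one-form is
given by its pullbacks `form p θ` to plots `p`, `θ` being the loop variable. (Values of `form` at
points near which `p` is not smooth carry no meaning and are not constrained.)
The field `vertical` says that the pullback of `𝖠` along an orbit map `γ ↦ q γ` is the Maurer-Cartan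
form of `ΩG`; together with `equivariant` this is the usual condition `𝖠(ξ^#) = ξ`. -/
structure LoopConnection (B : LoopBundle e d G M Q) where
  form : ∀ {n : ℕ}, (Euc n → Q) → ℝ → Euc n → Euc n [⋀^Fin 1]→L[ℝ] LieAlg e G
  comp : ∀ {m n : ℕ} (p : Euc n → Q) (V : Set (Euc n)) (p' : Euc m → Q) (W : Set (Euc m))
    (φ : Euc m → Euc n), B.IsPlotOn V p → IsOpen W → ContDiffOn ℝ ∞ φ W → MapsTo φ W V →
    (∀ y ∈ W, p' y = p (φ y)) → ∀ θ, ∀ y ∈ W,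
      form p' θ y = (form p θ (φ y)).compContinuousLinearMap (fderiv ℝ φ y)
  smooth : ∀ {n : ℕ} (p : Euc n → Q) (V : Set (Euc n)), B.IsPlotOn V p →
    ContDiffOn ℝ ∞ (fun z : Euc n × ℝ => form p z.2 z.1) (V ×ˢ univ)
  periodic : ∀ {n : ℕ} (p : Euc n → Q) (V : Set (Euc n)), B.IsPlotOn V p →
    ∀ θ, ∀ y ∈ V, form p (θ + 2 * Real.pi) y = form p θ y
  based : ∀ {n : ℕ} (p : Euc n → Q) (V : Set (Euc n)), B.IsPlotOn V p →
    ∀ y ∈ V, form p 0 y = 0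
  equivariant : ∀ {n : ℕ} (p : Euc n → Q) (V : Set (Euc n)) (γ : LoopGroup e G),
    B.IsPlotOn V p → ∀ θ, ∀ y ∈ V,
      form (fun y => B.act (p y) γ) θ y =
        (Ad G ((γ : ℝ → G) θ)⁻¹).compContinuousAlternatingMap (form p θ y)
  vertical : ∀ {n : ℕ} (q : Q) (V : Set (Euc n)) (γ : Euc n → LoopGroup e G),
    IsOpen V → SmoothLoopsOn n V γ → ∀ θ, ∀ y ∈ V,
      form (fun y => B.act q (γ y)) θ y =
        oneForm (mcPullback G (fun z => (γ z : ℝ → G) θ) y)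

/-- A Higgs field: a smooth map `Φ` from the total space to `L𝔤` (smooth `2π`-periodic functions
`ℝ → 𝔤`) with `Φ(q γ) = Ad(γ⁻¹) Φ(q) + γ⁻¹ ∂γ`. -/
structure HiggsField (B : LoopBundle e d G M Q) where
  toFun : Q → ℝ → LieAlg e G
  periodic : ∀ q, Function.Periodic (toFun q) (2 * Real.pi)
  smooth : ∀ {n : ℕ} (p : Euc n → Q) (V : Set (Euc n)), B.IsPlotOn V p →
    ContDiffOn ℝ ∞ (fun z : Euc n × ℝ => toFun (p z.1) z.2) (V ×ˢ univ)
  twisted : ∀ (q : Q) (γ : LoopGroup e G) (θ : ℝ),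
    toFun (B.act q γ) θ = Ad G ((γ : ℝ → G) θ)⁻¹ (toFun q θ) + logDeriv G (γ : ℝ → G) θ

/-- The form on `M` which, near each point, is the pullback along a local section of a form `η` on
`Q` given on plots. It deserves its name when `η` is basic, see `LoopBundle.IsDescent`. -/
def LoopBundle.descend (B : LoopBundle e d G M Q) {k : ℕ}
    (η : (Euc d → Q) → Euc d → Euc d [⋀^Fin k]→L[ℝ] ℝ) : DForm d M k := fun x =>
  (η (fun y => B.sec x ((extChartAt (𝓡 d) x).symm y)) (extChartAt (𝓡 d) x x)
    ).compContinuousLinearMap (mfderiv (𝓡 d) 𝓘(ℝ, Euc d) (extChartAt (𝓡 d) x) x)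

/-- The form `η` on `Q`, given on plots, is the pullback of the form `σ` on `M`: `η = π^* σ`. -/
def LoopBundle.IsDescent (B : LoopBundle e d G M Q) {k : ℕ}
    (η : ∀ {n : ℕ}, (Euc n → Q) → Euc n → Euc n [⋀^Fin k]→L[ℝ] ℝ) (σ : DForm d M k) : Prop :=
  ∀ {n : ℕ} (p : Euc n → Q) (V : Set (Euc n)), B.IsPlotOn V p → ∀ y ∈ V,
    η p y = (σ (B.proj (p y))).compContinuousLinearMap
      (mfderiv (𝓡 n) (𝓡 d) (fun z => B.proj (p z)) y)

/-! ### String forms -/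

section StringForms

variable {B : LoopBundle e d G M Q}

/-- The curvature `𝖥 = d𝖠 + ½ [𝖠, 𝖠]`. -/
def LoopConnection.curvature (A : LoopConnection B) {n : ℕ} (p : Euc n → Q) (θ : ℝ) (y : Euc n) :
    Euc n [⋀^Fin 2]→L[ℝ] LieAlg e G :=
  extDeriv (A.form p θ) y + (1 / 2 : ℝ) • formBracket G (A.form p θ y) (A.form p θ y)

/-- The covariant derivative `∇Φ = dΦ + [𝖠, Φ] - ∂𝖠` of the Higgs field. -/
def covDeriv (A : LoopConnection B) (Φ : HiggsField B) {n : ℕ} (p : Euc n → Q) (θ : ℝ)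
    (y : Euc n) : Euc n [⋀^Fin 1]→L[ℝ] LieAlg e G :=
  oneForm (fderiv ℝ (fun z => Φ.toFun (p z) θ) y) +
    ((bracketCLM G).flip (Φ.toFun (p y) θ)).compContinuousAlternatingMap (A.form p θ y) -
    deriv (fun t => A.form p t y) θ

/-- The string form of `f ∈ I^{k+1}(𝔤)` on the total space,
`(k+1) ∫_{S¹} f (∇Φ, 𝖥, …, 𝖥) dθ`. -/
def stringFormTotal {k : ℕ} (f : InvPoly e G (k + 1)) (A : LoopConnection B) (Φ : HiggsField B)
    {n : ℕ} (p : Euc n → Q) (y : Euc n) : Euc n [⋀^Fin (2 * k + 1)]→L[ℝ] ℝ :=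
  (k + 1 : ℝ) • ∫ θ in (0 : ℝ)..(2 * Real.pi), f.oneTwo (covDeriv A Φ p θ y) (A.curvature p θ y)

/-- The string form `s_f(𝖠, Φ)` on `M`. -/
def stringForm {k : ℕ} (f : InvPoly e G (k + 1)) (A : LoopConnection B) (Φ : HiggsField B) :
    DForm d M (2 * k + 1) :=
  B.descend (stringFormTotal f A Φ)

/-! ### The Higgs field holonomy -/

/-- `g : ℝ → G` solves `g⁻¹ ∂g = ξ`, `g(0) = 1`. -/
def IsHolonomyPath (ξ : ℝ → LieAlg e G) (g : ℝ → G) : Prop :=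
  ContMDiff 𝓘(ℝ, ℝ) (𝓡 e) ∞ g ∧ g 0 = 1 ∧ ∀ θ, logDeriv G g θ = ξ θ

/-- The holonomy `Q → PG` of a Higgs field: the solution `g` of `g⁻¹ ∂g = Φ(q)`, `g(0) = 1`. -/
def HiggsField.holPath (Φ : HiggsField B) (q : Q) : ℝ → G :=
  Classical.epsilon (IsHolonomyPath (Φ.toFun q))

/-- The induced map `hol_Φ : M → G`, whose value at `x` is the endpoint `g(2π)` of the holonomy path
of any point in the fibre over `x`. -/
def HiggsField.hol (Φ : HiggsField B) (x : M) : G :=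
  Φ.holPath (B.sec x x) (2 * Real.pi)

/-! ### The canonical form -/

/-- The one-forms `â_θ = Ad(g_θ) (𝖠_θ - g_θ⁻¹ dg_θ)`, where `g_θ(q)` is the holonomy path of `q` at
time `θ`. On the bundle `C(Q) = (Q × S¹ × G) / ΩG` with the connection
`A = Ad(h⁻¹) (𝖠 + Φ dθ) + h⁻¹ dh`, the horizontal lift of the circle `{x} × S¹` that starts in
`[q, 0, 1]` is `θ ↦ [q, θ, g_θ(q)⁻¹]`, and `â` is the pullback of `A` along this lift: it has no
`dθ`-component and descends to `M × [0, 2π]`. -/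
def liftedConn (A : LoopConnection B) (Φ : HiggsField B) {n : ℕ} (p : Euc n → Q) (θ : ℝ)
    (y : Euc n) : Euc n [⋀^Fin 1]→L[ℝ] LieAlg e G :=
  (Ad G (Φ.holPath (p y) θ)).compContinuousAlternatingMap
    (A.form p θ y - oneForm (mcPullback G (fun z => Φ.holPath (p z) θ) y))

/-- The canonical form on the total space. For `f ∈ I^K(𝔤)` with `K = l + 2` it is
`∑_{i=0}^{K-2} K (K-1)! / (2^i i! (K-2-i)! (K+i))
  • ∫_0^{2π} f (∂_θ â, â, dâ, …, dâ, [â,â], …, [â,â]) dθ`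
with `dâ` occurring `K-2-i` times and `[â,â]` occurring `i` times; for `K = 1` the sum is empty. -/
def canonicalFormTotal : ∀ {k : ℕ} (_ : InvPoly e G (k + 1)) (_ : LoopConnection B)
    (_ : HiggsField B) {n : ℕ} (_ : Euc n → Q) (_ : Euc n), Euc n [⋀^Fin (2 * k)]→L[ℝ] ℝ
  | 0, _, _, _, _, _, _ => 0
  | l + 1, f, A, Φ, _, p, y =>
    ∑ i ∈ Finset.range (l + 1),
      (((l + 2) * (l + 1).factorial : ℝ) /
        (2 ^ i * i.factorial * (l - i).factorial * (l + 2 + i))) •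
        ∫ θ in (0 : ℝ)..(2 * Real.pi),
          f.oneOneTwo (deriv (fun t => liftedConn A Φ p t y) θ) (liftedConn A Φ p θ y)
            (fun j : Fin l => if (j : ℕ) < l - i then extDeriv (liftedConn A Φ p θ) y
              else formBracket G (liftedConn A Φ p θ y) (liftedConn A Φ p θ y))

/-- The canonical form `χ = χ_f(𝖠, Φ)` on `M`. -/
def canonicalForm {k : ℕ} (f : InvPoly e G (k + 1)) (A : LoopConnection B) (Φ : HiggsField B) :
    DForm d M (2 * k) :=
  B.descend (canonicalFormTotal f A Φ)

end StringForms

/-! ### Pullbacks of bundles, connections and Higgs fields -/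

section Pullback

variable {N : Type*} [TopologicalSpace N] [ChartedSpace (Euc d') N]

/-- The total space of `g^* Q`. -/
abbrev LoopBundle.PullbackSpace (B : LoopBundle e d G M Q) (g : N → M) : Type _ :=
  {z : N × Q // g z.1 = B.proj z.2}

open Classical in
/-- The pullback bundle `g^* Q`. -/
def LoopBundle.pullback (B : LoopBundle e d G M Q) {g : N → M}
    (hg : ContMDiff (𝓡 d') (𝓡 d) ∞ g) : LoopBundle e d' G N (B.PullbackSpace g) where
  proj z := z.1.1
  act z γ := ⟨(z.1.1, B.act z.1.2 γ), by rw [B.proj_act]; exact z.2⟩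
  act_one z := by simp [B.act_one]
  act_mul z γ γ' := by simp [B.act_mul]
  proj_act z γ := rfl
  free z γ h := B.free z.1.2 γ (congrArg (fun w => w.1.2) h)
  transitive z z' h := by
    obtain ⟨γ, hγ⟩ := B.transitive z.1.2 z'.1.2 (by rw [← z.2, ← z'.2, h])
    exact ⟨γ, Subtype.ext (Prod.ext h hγ)⟩
  base x := g ⁻¹' B.base (g x)
  isOpen_base x := (B.isOpen_base _).preimage hg.continuous
  mem_base x := B.mem_base _
  sec x y := if h : g y ∈ B.base (g x) then ⟨(y, B.sec (g x) (g y)), (B.proj_sec _ _ h).symm⟩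
    else ⟨(y, B.sec (g y) (g y)), (B.proj_sec _ _ (B.mem_base _)).symm⟩
  proj_sec x y h := by split_ifs <;> rfl
  smooth_transition x x' γ h := by
    have key : ∀ y : M, ∃ δ : LoopGroup e G, y ∈ B.base (g x) ∩ B.base (g x') →
        B.act (B.sec (g x) y) δ = B.sec (g x') y := by
      intro y
      by_cases hy : y ∈ B.base (g x) ∩ B.base (g x')
      · obtain ⟨δ, hδ⟩ := B.transitive (B.sec (g x) y) (B.sec (g x') y)
          (by rw [B.proj_sec _ _ hy.1, B.proj_sec _ _ hy.2])
        exact ⟨δ, fun _ => hδ⟩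
      · exact ⟨1, fun h => absurd h hy⟩
    choose δ hδ using key
    have hs := B.smooth_transition (g x) (g x') δ hδ
    have hγ : ∀ y ∈ g ⁻¹' B.base (g x) ∩ g ⁻¹' B.base (g x'), γ y = δ (g y) := by
      intro y hy
      have h1 := congrArg (fun w => w.1.2) (h y hy)
      have hy1 : g y ∈ B.base (g x) := hy.1
      have hy2 : g y ∈ B.base (g x') := hy.2
      simp only [hy1, hy2, dif_pos] at h1
      have h2 : B.act (B.sec (g x) (g y)) (γ y * (δ (g y))⁻¹) = B.sec (g x) (g y) := by
        rw [B.act_mul, h1, ← hδ (g y) hy, ← B.act_mul, mul_inv_cancel, B.act_one]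
      exact mul_inv_eq_one.mp (B.free _ _ h2)
    have hmap : ContMDiff ((𝓡 d').prod 𝓘(ℝ, ℝ)) ((𝓡 d).prod 𝓘(ℝ, ℝ)) ∞
        (fun z : N × ℝ => (g z.1, z.2)) :=
      (hg.comp contMDiff_fst).prodMk contMDiff_snd
    refine (ContMDiffOn.comp hs hmap.contMDiffOn ?_).congr ?_
    · intro z hz
      exact ⟨hz.1, mem_univ _⟩
    · intro z hz
      simp [hγ z.1 hz.1]

variable {B : LoopBundle e d G M Q} {g : N → M} {hg : ContMDiff (𝓡 d') (𝓡 d) ∞ g}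

/-- The canonical map `g^* Q → Q` is smooth. -/
theorem LoopBundle.IsPlotOn.of_pullback {n : ℕ} {V : Set (Euc n)}
    {p : Euc n → B.PullbackSpace g} (hp : (B.pullback hg).IsPlotOn V p) :
    B.IsPlotOn V (fun y => (p y).1.2) := by
  have hproj : ∀ y, B.proj (p y).1.2 = g (p y).1.1 := fun y => (p y).2.symm
  have hsm : ContMDiffOn (𝓡 n) (𝓡 d) ∞ (fun y => B.proj (p y).1.2) V := by
    simp only [hproj]
    exact hg.comp_contMDiffOn hp.smooth_proj
  refine ⟨hp.isOpen, hsm, ?_⟩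
  intro x γ h
  rintro ⟨y₀, θ₀⟩ ⟨hy₀, -⟩
  obtain ⟨ν, hν⟩ : ∃ ν : N, ν = (p y₀).1.1 := ⟨_, rfl⟩
  have k1 : ∀ y, ∃ γ₁ : LoopGroup e G, g (p y).1.1 ∈ B.base (g ν) →
      B.act (B.sec (g ν) (g (p y).1.1)) γ₁ = (p y).1.2 := by
    intro y
    by_cases hy : g (p y).1.1 ∈ B.base (g ν)
    · obtain ⟨γ₁, h₁⟩ := B.transitive (B.sec (g ν) (g (p y).1.1)) (p y).1.2
        (by rw [B.proj_sec _ _ hy, hproj])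
      exact ⟨γ₁, fun _ => h₁⟩
    · exact ⟨1, fun h => absurd h hy⟩
  choose γ₁ hγ₁ using k1
  have k2 : ∀ y : M, ∃ δ : LoopGroup e G, y ∈ B.base x ∩ B.base (g ν) →
      B.act (B.sec x y) δ = B.sec (g ν) y := by
    intro y
    by_cases hy : y ∈ B.base x ∩ B.base (g ν)
    · obtain ⟨δ, hδ⟩ := B.transitive (B.sec x y) (B.sec (g ν) y)
        (by rw [B.proj_sec _ _ hy.1, B.proj_sec _ _ hy.2])
      exact ⟨δ, fun _ => hδ⟩
    · exact ⟨1, fun h => absurd h hy⟩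
  choose δ hδ using k2
  have s1 := hp.smooth_fibre ν γ₁ (by
    rintro y ⟨-, hy⟩
    have hy' : g (p y).1.1 ∈ B.base (g ν) := hy
    refine Subtype.ext (Prod.ext
      (((B.pullback hg).proj_act _ (γ₁ y)).trans ((B.pullback hg).proj_sec _ _ hy)) ?_)
    simp only [LoopBundle.pullback, hy', dif_pos]
    exact hγ₁ y hy')
  have s2 := B.smooth_transition x (g ν) δ hδ
  set W : Set (Euc n) := V ∩ (fun y => B.proj (p y).1.2) ⁻¹' (B.base x ∩ B.base (g ν)) with hW
  have hWo : IsOpen W :=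
    hsm.continuousOn.isOpen_inter_preimage hp.isOpen
      ((B.isOpen_base x).inter (B.isOpen_base (g ν)))
  have hy₀W : y₀ ∈ W := by
    refine ⟨hy₀.1, hy₀.2, ?_⟩
    change B.proj (p y₀).1.2 ∈ _
    rw [hproj, ← hν]
    exact B.mem_base _
  have hγ : ∀ y ∈ W, γ y = δ (B.proj (p y).1.2) * γ₁ y := by
    intro y hy
    have hb : B.proj (p y).1.2 ∈ B.base x ∩ B.base (g ν) := hy.2
    have e1 := h y ⟨hy.1, hb.1⟩
    have e2 : B.act (B.sec x (B.proj (p y).1.2)) (δ (B.proj (p y).1.2) * γ₁ y) = (p y).1.2 := by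
      rw [B.act_mul, hδ _ hb]
      have := hγ₁ y (by rw [← hproj y]; exact hb.2)
      rwa [← hproj y] at this
    have e3 : B.act (B.sec x (B.proj (p y).1.2))
        (γ y * (δ (B.proj (p y).1.2) * γ₁ y)⁻¹) = B.sec x (B.proj (p y).1.2) := by
      rw [B.act_mul, e1]
      conv_lhs => rw [← e2]
      conv_lhs =>
        rw [← B.act_mul]
      simp only [e2, mul_inv_cancel, B.act_one]
    exact mul_inv_eq_one.mp (B.free _ _ e3)
  have hmap : ContMDiffOn ((𝓡 n).prod 𝓘(ℝ, ℝ)) ((𝓡 d).prod 𝓘(ℝ, ℝ)) ∞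
      (fun z : Euc n × ℝ => (B.proj (p z.1).1.2, z.2)) (W ×ˢ univ) :=
    (hsm.comp contMDiff_fst.contMDiffOn (fun z hz => hz.1.1)).prodMk contMDiff_snd.contMDiffOn
  have t2 := ContMDiffOn.comp s2 hmap (fun z hz => ⟨hz.1.2, mem_univ _⟩)
  have t1 := ContMDiffOn.mono s1 (t := W ×ˢ univ) (by
    rintro z ⟨hz, -⟩
    refine ⟨⟨hz.1, ?_⟩, mem_univ _⟩
    change g (p z.1).1.1 ∈ B.base (g ν)
    rw [← hproj z.1]
    exact hz.2.2)
  have t := (t2.mul t1).congr (f₁ := fun z : Euc n × ℝ => (γ z.1 : ℝ → G) z.2) (by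
    intro z hz
    simp [hγ z.1 hz.1])
  exact ((t (y₀, θ₀) ⟨hy₀W, mem_univ _⟩).contMDiffAt
    ((hWo.prod isOpen_univ).mem_nhds ⟨hy₀W, mem_univ _⟩)).contMDiffWithinAt

/-- The pullback of a connection to `g^* Q`. -/
def LoopConnection.pullback (A : LoopConnection B) (hg : ContMDiff (𝓡 d') (𝓡 d) ∞ g) :
    LoopConnection (B.pullback hg) where
  form p := A.form fun y => (p y).1.2
  comp p V p' W φ hp hW hφ hm hpp θ y hy :=
    A.comp _ V _ W φ hp.of_pullback hW hφ hm (fun y hy => by rw [hpp y hy]) θ y hy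
  smooth p V hp := A.smooth _ V hp.of_pullback
  periodic p V hp := A.periodic _ V hp.of_pullback
  based p V hp := A.based _ V hp.of_pullback
  equivariant p V γ hp := A.equivariant _ V γ hp.of_pullback
  vertical q V γ hV hγ := A.vertical q.1.2 V γ hV hγ

/-- The pullback of a Higgs field to `g^* Q`. -/
def HiggsField.pullback (Φ : HiggsField B) (hg : ContMDiff (𝓡 d') (𝓡 d) ∞ g) :
    HiggsField (B.pullback hg) where
  toFun q := Φ.toFun q.1.2
  periodic q := Φ.periodic q.1.2
  smooth _ V hp := Φ.smooth _ V hp.of_pullback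
  twisted q γ θ := Φ.twisted q.1.2 γ θ

end Pullback

end LoopBundles

end OmegaG

end

open OmegaG

/-!
# The string form is the holonomy pullback of the transgression form, up to an exact form

**Holonomy.** The equation `g⁻¹ ∂g = ξ`, `g 0 = 1` is solved in the chart at the identity by
`exists_smooth_solution`, which obtains solutions depending smoothly on parameters from the implicit
function theorem applied to the integral equation in `C([0, 1], ℝᵉ)`. Solutions of equal logarithmic
derivative differ by a left translation, so that local solutions continue to all times
(`exists_isHolonomyPath`) and inherit smoothness in parameters (`contMDiffOn_of_isHolonomyPath`).

**Gauge transformation.** By the Maurer-Cartan equation (`maurerCartan_equation`) the family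
`a_θ = Ad(g_θ) (A_θ - g_θ⁻¹ dg_θ)` satisfies `∂_θ a = -Ad(g) ∇Φ` and has curvature `Ad(g) F`
(`deriv_gaugeFamily`, `scaledCurv_gaugeFamily`). Invariance of `f` under `Ad` gives
`s_f = -k ∫ f(∂_θ a, F_a, …, F_a) dθ` (`stringFormTotal_eq`), with `F_a` the curvature of `a`.

**Transgression.** Put `F_s = s da + s²/2 [a, a]`, the curvature of `s a`. The Bianchi identity and
the infinitesimal invariance of `f` yield
`(k - 1) s d f(∂_θ a, a, F_s, …, F_s) = ∂_θ f(a, F_s, …, F_s) - ∂_s (s f(∂_θ a, F_s, …, F_s))`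
(`InvPoly.exists_hasDerivAt_oneTwo`). The underlying identity is one between antisymmetrisations of
functions of `2k - 1` vectors (`InvPoly.altTriple_derivative`). Integrating over
`(θ, s) ∈ [0, 2π] × [0, 1]` by the divergence theorem, and expanding `F_s` binomially to recognise
the canonical form, one finds that `dχ` is the difference of the Chern-Simons forms
`k ∫ f(a, F_s, …, F_s) ds` of the ends minus `k ∫ f(∂_θ a, F_a, …, F_a) dθ`
(`InvPoly.extDeriv_canonicalOfFamily`). At `θ = 0` the form `a` vanishes. At `θ = 2π`, where the
connection form vanishes, it is the flat form `-dh h⁻¹` with `h = g_{2π}`, whose Chern-Simons form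
is `-h^* τ_f` by a Beta integral (`InvPoly.integral_oneTwo_scaledCurv_of_flat`). This is the
identity on the total space, `stringFormTotal_eq_transgression_add`.

**Descent.** Forms on the total space are given by their pullbacks to plots. For `p = s(φ) γ` the
connection form and `g⁻¹ dg` change in the same way, so the forms `a` of `p` are the pullbacks of
those of `s` along `φ` (`LoopConnection.form_gauge`, `liftedConn_gauge`). Hence the string form and
the canonical form are basic, and descend to smooth forms (`LoopBundle.IsBasic.isDescent`,
`LoopBundle.IsBasic.isSmooth_descend`). Naturality is the descent of the canonical form evaluated on
local sections of the pullback bundle (`canonicalForm_pullback`).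
-/

noncomputable section

namespace OmegaG

/-! ### Superposition operators on spaces of continuous functions -/

section Superposition

variable {K : Type*} [TopologicalSpace K] [CompactSpace K]

/-- The operator `C(K, E →L F) → (C(K, E) →L C(K, F))` of pointwise application. -/
noncomputable def pointwiseApply (K : Type*) [TopologicalSpace K] [CompactSpace K]
    (E F : Type*) [NormedAddCommGroup E] [NormedSpace ℝ E]
    [NormedAddCommGroup F] [NormedSpace ℝ F] :
    C(K, E →L[ℝ] F) →L[ℝ] C(K, E) →L[ℝ] C(K, F) :=
  LinearMap.mkContinuous₂
    (LinearMap.mk₂ ℝ (fun (A : C(K, E →L[ℝ] F)) (u : C(K, E)) =>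
        (⟨fun t => A t (u t), by fun_prop⟩ : C(K, F)))
      (fun _ _ _ => by ext; simp) (fun _ _ _ => by ext; simp)
      (fun _ _ _ => by ext; simp) (fun _ _ _ => by ext; simp)) 1
    (fun A u => by
      rw [one_mul]
      refine (ContinuousMap.norm_le _ (by positivity)).2 fun t => ?_
      exact ((A t).le_opNorm _).trans
        (mul_le_mul (A.norm_coe_le_norm t) (u.norm_coe_le_norm t) (norm_nonneg _)
          (norm_nonneg A)))

@[simp]
theorem pointwiseApply_apply {E F : Type*} [NormedAddCommGroup E] [NormedSpace ℝ E]
    [NormedAddCommGroup F] [NormedSpace ℝ F] (A : C(K, E →L[ℝ] F)) (u : C(K, E)) (t : K) :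
    pointwiseApply K E F A u t = A t (u t) := rfl

/-- The superposition operator `u ↦ Z ∘ u` is differentiable in the supremum norm: by the mean value
inequality the remainder at `t` is controlled by the oscillation of `DZ` along the segment from
`u t` to `v t`, and `u ↦ DZ ∘ u` is continuous. -/
theorem hasFDerivAt_postcomp {E F : Type*} [NormedAddCommGroup E] [NormedSpace ℝ E]
    [NormedAddCommGroup F] [NormedSpace ℝ F] {Z : E → F} (hZ : ContDiff ℝ 1 Z) (u : C(K, E)) :
    HasFDerivAt (fun u : C(K, E) => (⟨Z, hZ.continuous⟩ : C(E, F)).comp u)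
      (pointwiseApply K E F
        ((⟨fderiv ℝ Z, hZ.continuous_fderiv one_ne_zero⟩ : C(E, E →L[ℝ] F)).comp u)) u := by
  rw [hasFDerivAt_iff_isLittleO, Asymptotics.isLittleO_iff]
  intro ε hε
  have hc : Continuous fun w : C(K, E) =>
      (⟨fderiv ℝ Z, hZ.continuous_fderiv one_ne_zero⟩ : C(E, E →L[ℝ] F)).comp w :=
    ContinuousMap.continuous_postcomp _
  obtain ⟨δ, hδ, hball⟩ := (Metric.continuousAt_iff (α := C(K, E))
    (β := C(K, E →L[ℝ] F)) (a := u)).1 hc.continuousAt ε hε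
  filter_upwards [Metric.ball_mem_nhds u hδ] with v hv
  refine (ContinuousMap.norm_le _ (by positivity)).2 fun t => ?_
  -- every point of the segment is a value at `t` of a function in the `δ`-ball about `u`
  have hbound : ∀ x ∈ segment ℝ (u t) (v t), ‖fderiv ℝ Z x - fderiv ℝ Z (u t)‖ ≤ ε := by
    intro x hx
    rw [segment_eq_image'] at hx
    obtain ⟨s, hs, rfl⟩ := hx
    have hw : dist (u + s • (v - u)) u < δ := by
      rw [dist_eq_norm, add_sub_cancel_left, norm_smul, Real.norm_of_nonneg hs.1]
      rw [Metric.mem_ball, dist_eq_norm] at hv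
      exact (mul_le_of_le_one_left (norm_nonneg _) hs.2).trans_lt hv
    have := (ContinuousMap.dist_apply_le_dist t).trans (hball hw).le
    rw [dist_eq_norm] at this
    simpa using this
  have key := (convex_segment (𝕜 := ℝ) (u t) (v t)).norm_image_sub_le_of_norm_hasFDerivWithin_le'
    (f := Z) (f' := fderiv ℝ Z) (φ := fderiv ℝ Z (u t))
    (fun x _ => ((hZ.differentiable one_ne_zero) x).hasFDerivAt.hasFDerivWithinAt) hbound
    (left_mem_segment ℝ _ _) (right_mem_segment ℝ _ _)
  refine le_trans (le_of_eq ?_) (key.trans ?_)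
  · simp
  · gcongr
    exact (v - u).norm_coe_le_norm t

/-- The superposition operator `u ↦ Z ∘ u` on `C(K, E)` is as smooth as `Z`: its derivative is
built from the superposition operator of the derivative of `Z`. -/
theorem contDiff_postcomp_nat {n : ℕ} : ∀ {E F : Type} [NormedAddCommGroup E] [NormedSpace ℝ E]
    [NormedAddCommGroup F] [NormedSpace ℝ F] {Z : E → F} (hZ : ContDiff ℝ n Z),
    ContDiff ℝ n (fun u : C(K, E) => (⟨Z, hZ.continuous⟩ : C(E, F)).comp u) := by
  induction n with
  | zero =>
    intro E F _ _ _ _ Z hZ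
    exact contDiff_zero.2 (ContinuousMap.continuous_postcomp _)
  | succ n ih =>
    intro E F _ _ _ _ Z hZ
    have hZ1 : ContDiff ℝ 1 Z := hZ.of_le (by exact_mod_cast Nat.le_add_left 1 n)
    have hZ' : ContDiff ℝ n (fderiv ℝ Z) := hZ.fderiv_right (by norm_cast)
    push_cast
    rw [contDiff_succ_iff_hasFDerivAt]
    exact ⟨_, (pointwiseApply K E F).contDiff.comp (ih hZ'), hasFDerivAt_postcomp hZ1⟩

theorem contDiff_postcomp {E F : Type} [NormedAddCommGroup E] [NormedSpace ℝ E]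
    [NormedAddCommGroup F] [NormedSpace ℝ F] {Z : E → F} (hZ : ContDiff ℝ ∞ Z) :
    ContDiff ℝ ∞ (fun u : C(K, E) => (⟨Z, hZ.continuous⟩ : C(E, F)).comp u) :=
  contDiff_infty.2 fun n => contDiff_postcomp_nat (contDiff_infty.1 hZ n)

end Superposition

/-! ### Smooth dependence of solutions of ordinary differential equations on parameters -/

section ParametricODE

variable {P E : Type} [NormedAddCommGroup P] [NormedSpace ℝ P]
  [NormedAddCommGroup E] [NormedSpace ℝ E]

/-- The primitive `s ↦ ∫_0^s u` of a continuous function on `[0, 1]`, as a bounded operator. -/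
noncomputable def primitiveCLM (E : Type*) [NormedAddCommGroup E] [NormedSpace ℝ E] :
    C(unitInterval, E) →L[ℝ] C(unitInterval, E) :=
  LinearMap.mkContinuous
    { toFun := fun u => ⟨fun s => ∫ τ in (0 : ℝ)..s, IccExtend zero_le_one u τ, by
        have h : Continuous (IccExtend (zero_le_one (α := ℝ)) u) := u.continuous.Icc_extend'
        exact (intervalIntegral.continuous_primitive (fun a b => h.intervalIntegrable a b) 0).comp
          continuous_subtype_val⟩
      map_add' := fun u v => by
        have h : ∀ u : C(unitInterval, E), Continuous (IccExtend (zero_le_one (α := ℝ)) u) :=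
          fun u => u.continuous.Icc_extend'
        ext s
        exact intervalIntegral.integral_add ((h u).intervalIntegrable _ _)
          ((h v).intervalIntegrable _ _)
      map_smul' := fun c u => by
        ext s
        exact intervalIntegral.integral_smul c _ } 1
    (fun u => by
      rw [one_mul]
      refine (ContinuousMap.norm_le _ (norm_nonneg _)).2 fun s => ?_
      refine (intervalIntegral.norm_integral_le_of_norm_le_const
        (C := ‖u‖) fun x _ => u.norm_coe_le_norm _).trans ?_
      rw [sub_zero, abs_of_nonneg s.2.1]
      exact mul_le_of_le_one_right (norm_nonneg _) s.2.2)

/-- A (globally smooth) time-dependent vector field `X` with parameters has near every initial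
time `θ₀` a solution with initial value `c` at `θ₀` that depends smoothly on time and parameters.
After rescaling time, the integral equation on `[0, 1]` is
`u = c + ε ∫ X (y, θ₀ + ε σ, u σ) dσ`, and the implicit function theorem in `C([0, 1], E)` applies
at `ε = 0`, where the derivative in `u` is the identity. -/
theorem exists_smooth_solution [CompleteSpace P] [CompleteSpace E]
    {X : P × ℝ × E → E} (hX : ContDiff ℝ ∞ X) (y₀ : P) (θ₀ : ℝ) (c : E) :
    ∃ u : P × ℝ → E, (∀ᶠ z in 𝓝 (y₀, θ₀), ContDiffAt ℝ ∞ u z) ∧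
      (∀ᶠ y in 𝓝 y₀, u (y, θ₀) = c) ∧
      ∀ᶠ z in 𝓝 (y₀, θ₀), HasDerivAt (fun t => u (z.1, t)) (X (z.1, z.2, u z)) z.2 := by
  -- the path `σ ↦ (y, θ₀ + ε σ, u σ)`
  let idc : C(unitInterval, ℝ) := ⟨fun s => (s : ℝ), continuous_subtype_val⟩
  let ι : (P × ℝ) × C(unitInterval, E) → C(unitInterval, P × ℝ × E) := fun w =>
    ⟨fun s => (w.1.1, θ₀ + w.1.2 * s, w.2 s), by fun_prop⟩
  have hι : ContDiff ℝ ∞ ι := by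
    let L : (P × ℝ) × C(unitInterval, E) →ₗ[ℝ] C(unitInterval, P × ℝ × E) :=
      { toFun := fun w => ⟨fun s => (w.1.1, w.1.2 * s, w.2 s), by fun_prop⟩
        map_add' := fun a b => by ext s <;> simp [add_mul]
        map_smul' := fun a b => by ext s <;> simp [mul_assoc] }
    let L' := L.mkContinuous 1 (fun w => by
      rw [one_mul]
      refine (ContinuousMap.norm_le _ (norm_nonneg _)).2 fun s => ?_
      change ‖(w.1.1, w.1.2 * (s : ℝ), w.2 s)‖ ≤ _
      have h1 : ‖w.1‖ ≤ ‖w‖ := norm_fst_le w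
      have h2 : ‖w.2‖ ≤ ‖w‖ := norm_snd_le w
      refine max_le ((norm_fst_le w.1).trans h1) (max_le ?_ ((w.2.norm_coe_le_norm s).trans h2))
      rw [norm_mul]
      refine (mul_le_of_le_one_right (norm_nonneg _) ?_).trans ((norm_snd_le w.1).trans h1)
      rw [Real.norm_of_nonneg s.2.1]; exact s.2.2)
    have : ι = fun w => ContinuousMap.const unitInterval ((0 : P), θ₀, (0 : E)) + L' w := by
      funext w; ext s
      · exact (zero_add _).symm
      · rfl
      · exact (zero_add _).symm
    rw [this]
    exact contDiff_const.add L'.contDiff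
  -- the solutions are the zeros of `Ψ w = u - c - ε ∫ X (y, θ₀ + ε σ, u σ) dσ`
  let N : C(unitInterval, P × ℝ × E) → C(unitInterval, E) := fun u =>
    (⟨X, hX.continuous⟩ : C(P × ℝ × E, E)).comp u
  have hN : ContDiff ℝ ∞ N := contDiff_postcomp hX
  let cc : C(unitInterval, E) := ContinuousMap.const unitInterval c
  let Ψ : (P × ℝ) × C(unitInterval, E) → C(unitInterval, E) := fun w =>
    w.2 - cc - w.1.2 • primitiveCLM E (N (ι w))
  have hΨ : ContDiff ℝ ∞ Ψ :=
    (contDiff_snd.sub contDiff_const).sub ((contDiff_snd.comp contDiff_fst).smul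
      ((primitiveCLM E).contDiff.comp (hN.comp hι)))
  let w₀ : (P × ℝ) × C(unitInterval, E) := ((y₀, 0), cc)
  have hΨ0 : Ψ w₀ = 0 := by simp [Ψ, w₀]
  -- at `ε = 0` the map `u ↦ Ψ` is the translation `u ↦ u - c`
  have hinv : (fderiv ℝ Ψ w₀ ∘L .inr ℝ (P × ℝ) C(unitInterval, E)) =
      ContinuousLinearMap.id ℝ _ := by
    have h1 : HasFDerivAt (fun u : C(unitInterval, E) => Ψ ((y₀, 0), u))
        (fderiv ℝ Ψ w₀ ∘L .inr ℝ (P × ℝ) C(unitInterval, E)) cc :=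
      HasFDerivAt.comp (g := Ψ) cc ((hΨ.differentiable (by simp)) w₀).hasFDerivAt
        (hasFDerivAt_prodMk_right (y₀, (0 : ℝ)) cc)
    have h2 : HasFDerivAt (fun u : C(unitInterval, E) => Ψ ((y₀, 0), u))
        (ContinuousLinearMap.id ℝ _) cc := by
      have : (fun u : C(unitInterval, E) => Ψ ((y₀, 0), u)) = fun u => u - cc := by
        funext u; simp [Ψ]
      rw [this]
      exact (hasFDerivAt_id cc).sub_const cc
    exact h1.unique h2
  have hinv' : (fderiv ℝ Ψ w₀ ∘L .inr ℝ (P × ℝ) C(unitInterval, E)).IsInvertible := by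
    rw [hinv]; exact ContinuousLinearMap.isInvertible_equiv (f := ContinuousLinearEquiv.refl ℝ _)
  have cdf : ContDiffAt ℝ ∞ Ψ w₀ := hΨ.contDiffAt
  let φ := cdf.implicitFunction (by simp) hinv'
  have hφ : ContDiffAt ℝ ∞ φ (y₀, 0) := cdf.contDiffAt_implicitFunction (by simp) hinv'
  have hφ0 : φ (y₀, 0) = cc := cdf.implicitFunction_apply_self (by simp) hinv'
  have hφeq : ∀ᶠ z in 𝓝 (y₀, (0 : ℝ)), Ψ (z, φ z) = 0 := by
    have := cdf.eventually_apply_implicitFunction (by simp) hinv'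
    rw [hΨ0] at this; exact this
  have hφuniq : ∀ᶠ w in 𝓝 w₀, Ψ w = 0 → φ w.1 = w.2 := by
    have := cdf.eventually_apply_eq_iff_implicitFunction (by simp) hinv'
    rw [hΨ0] at this
    exact this.mono fun w hw => hw.1
  -- near `(y₀, 0)`, `φ` agrees with the implicit functions obtained at nearby points
  have hφ' : ∀ᶠ z in 𝓝 (y₀, (0 : ℝ)), ContDiffAt ℝ ∞ φ z := by
    have hlim : Filter.Tendsto (fun z => (z, φ z)) (𝓝 (y₀, (0 : ℝ))) (𝓝 w₀) := by
      have := continuousAt_id.prodMk hφ.continuousAt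
      simpa only [ContinuousAt, id, hφ0] using this
    have hopen : ∀ᶠ w in 𝓝 w₀,
        (fderiv ℝ Ψ w ∘L .inr ℝ (P × ℝ) C(unitInterval, E)).IsInvertible := by
      have hc : ContinuousAt (fun w => fderiv ℝ Ψ w ∘L .inr ℝ (P × ℝ) C(unitInterval, E)) w₀ :=
        ((hΨ.continuous_fderiv (by simp)).clm_comp continuous_const).continuousAt
      obtain ⟨e₀, he₀⟩ := hinv'
      have hn := ContinuousLinearEquiv.nhds e₀
      rw [he₀] at hn
      exact (hc.eventually hn).mono fun w hw => hw
    filter_upwards [hlim.eventually hφuniq.eventually_nhds, hlim.eventually hopen, hφeq]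
      with z hz1 hz2 hz3
    have cdz : ContDiffAt ℝ ∞ Ψ (z, φ z) := hΨ.contDiffAt
    have hψ := cdz.contDiffAt_implicitFunction (by simp) hz2
    have hψ0 : cdz.implicitFunction (by simp) hz2 z = φ z :=
      cdz.implicitFunction_apply_self (by simp) hz2
    have hψeq := cdz.eventually_apply_implicitFunction (by simp) hz2
    refine hψ.congr_of_eventuallyEq ?_
    have hlim' : Filter.Tendsto (fun z' => (z', cdz.implicitFunction (by simp) hz2 z')) (𝓝 z)
        (𝓝 (z, φ z)) := by
      have := continuousAt_id.prodMk hψ.continuousAt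
      simpa only [ContinuousAt, id, hψ0] using this
    filter_upwards [hlim'.eventually hz1, hψeq] with z' h1 h2
    exact h1 (h2.trans hz3)
  let ev : C(unitInterval, E) →L[ℝ] E := ContinuousMap.evalCLM ℝ (1 : unitInterval)
  let v : P × ℝ → E := fun z => ev (φ z)
  have hv : ContDiffAt ℝ ∞ v (y₀, 0) := ev.contDiff.contDiffAt.comp _ hφ
  -- rescaling and uniqueness: `φ (y, ε) s = v (y, ε s)` near the base point
  obtain ⟨r, hr, hU⟩ := Metric.eventually_nhds_iff.1 hφuniq
  have hnear : ∀ᶠ z in 𝓝 (y₀, (0 : ℝ)), dist z (y₀, (0 : ℝ)) < r ∧ dist (φ z) cc < r ∧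
      Ψ (z, φ z) = 0 := by
    refine (Metric.eventually_nhds_iff.2 ⟨r, hr, fun _ h => h⟩).and (Filter.Eventually.and ?_ hφeq)
    have := hφ.continuousAt
    rw [ContinuousAt, hφ0] at this
    exact Metric.tendsto_nhds.1 this r hr
  have hint : ∀ z : P × ℝ, Ψ (z, φ z) = 0 → ∀ s : unitInterval, φ z s = c + z.2 • ∫ τ in (0 : ℝ)..s,
      X (z.1, θ₀ + z.2 * projIcc 0 1 zero_le_one τ, φ z (projIcc 0 1 zero_le_one τ)) := by
    intro z hz s
    have := congrArg (fun u : C(unitInterval, E) => u s) hz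
    simp only [Ψ, ContinuousMap.sub_apply, ContinuousMap.smul_apply, ContinuousMap.zero_apply,
      sub_eq_zero] at this
    exact sub_eq_iff_eq_add'.1 this
  have hscale : ∀ᶠ z in 𝓝 (y₀, (0 : ℝ)), ∀ s : unitInterval, φ z s = v (z.1, z.2 * s) := by
    filter_upwards [hnear] with z ⟨hz1, hz2, hz3⟩ s
    let sm : C(unitInterval, unitInterval) := ⟨fun τ => s * τ, by fun_prop⟩
    let w : C(unitInterval, E) := (φ z).comp sm
    have hw : Ψ ((z.1, z.2 * s), w) = 0 := by
      ext τ
      have h1 := hint z hz3 (s * τ)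
      have h2 : ∫ σ in (0 : ℝ)..((s * τ : unitInterval) : ℝ),
          X (z.1, θ₀ + z.2 * projIcc 0 1 zero_le_one σ, φ z (projIcc 0 1 zero_le_one σ)) =
          (s : ℝ) • ∫ σ in (0 : ℝ)..τ, X (z.1, θ₀ + z.2 * projIcc (0 : ℝ) 1 zero_le_one (s * σ),
            φ z (projIcc 0 1 zero_le_one (s * σ))) := by
        rw [intervalIntegral.smul_integral_comp_mul_left (fun σ =>
          X (z.1, θ₀ + z.2 * projIcc (0 : ℝ) 1 zero_le_one σ, φ z (projIcc 0 1 zero_le_one σ)))]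
        simp
      have h3 : ∫ σ in (0 : ℝ)..τ, X (z.1, θ₀ + z.2 * projIcc (0 : ℝ) 1 zero_le_one (s * σ),
            φ z (projIcc 0 1 zero_le_one (s * σ))) =
          ∫ σ in (0 : ℝ)..τ, X (z.1, θ₀ + (z.2 * s) * projIcc (0 : ℝ) 1 zero_le_one σ,
            w (projIcc 0 1 zero_le_one σ)) := by
        refine intervalIntegral.integral_congr fun σ hσ => ?_
        rw [uIcc_of_le τ.2.1] at hσ
        have hσ1 : σ ∈ Icc (0 : ℝ) 1 := ⟨hσ.1, hσ.2.trans τ.2.2⟩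
        have hσ2 : (s : ℝ) * σ ∈ Icc (0 : ℝ) 1 :=
          ⟨mul_nonneg s.2.1 hσ1.1, mul_le_one₀ s.2.2 hσ1.1 hσ1.2⟩
        have e1 : sm ⟨σ, hσ1⟩ = ⟨(s : ℝ) * σ, hσ2⟩ := rfl
        simp only [projIcc_of_mem _ hσ1, projIcc_of_mem _ hσ2]
        change _ = X (z.1, _, φ z (sm ⟨σ, hσ1⟩))
        rw [e1, mul_assoc]
      have h4 : Ψ ((z.1, z.2 * s), w) τ = w τ - c - (z.2 * s) • ∫ σ in (0 : ℝ)..τ,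
          X (z.1, θ₀ + (z.2 * s) * projIcc (0 : ℝ) 1 zero_le_one σ,
            w (projIcc 0 1 zero_le_one σ)) := rfl
      rw [h4, ← h3, mul_smul, ← h2]
      change φ z (s * τ) - c - _ = 0
      rw [h1]; abel_nf
    have hd : dist ((z.1, z.2 * (s : ℝ)), w) w₀ < r := by
      rw [Prod.dist_eq, Prod.dist_eq] at *
      refine max_lt (max_lt ((le_max_left _ _).trans_lt hz1) ?_) ?_
      · refine lt_of_le_of_lt ?_ ((le_max_right _ _).trans_lt hz1)
        simp only [w₀, dist_zero_right, norm_mul]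
        exact mul_le_of_le_one_right (norm_nonneg _) (by
          rw [Real.norm_of_nonneg s.2.1]; exact s.2.2)
      · refine lt_of_le_of_lt ((ContinuousMap.dist_le dist_nonneg).2 fun τ => ?_) hz2
        exact ContinuousMap.dist_apply_le_dist (f := φ z) (g := cc) (sm τ)
    have := hU hd hw
    change _ = ev (φ _)
    have h5 : φ (z.1, z.2 * s) = w := this
    rw [h5]
    change φ z s = φ z (s * 1)
    rw [mul_one]
  -- the integral equation for `v`
  obtain ⟨ρ, hρ, hball⟩ := Metric.eventually_nhds_iff.1 (hscale.and (hnear.and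
    (((hv.of_le (m := 1) (by simp)).eventually (by simp)).mono fun z h => h.continuousAt)))
  have hmem : ∀ z : P × ℝ, dist z (y₀, (0 : ℝ)) < ρ → ∀ t ∈ uIcc 0 z.2,
      dist (z.1, t) (y₀, (0 : ℝ)) < ρ := by
    intro z hz t ht
    rw [Prod.dist_eq] at *
    refine max_lt ((le_max_left _ _).trans_lt hz) (lt_of_le_of_lt ?_
      ((le_max_right _ _).trans_lt hz))
    simp only [Real.dist_eq, sub_zero]
    simpa using abs_sub_left_of_mem_uIcc ht
  have hvint : ∀ z : P × ℝ, dist z (y₀, (0 : ℝ)) < ρ →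
      v z = c + ∫ τ in (0 : ℝ)..z.2, X (z.1, θ₀ + τ, v (z.1, τ)) := by
    intro z hz
    have h1 := hint z (hball hz).2.1.2.2 1
    have h2 : ∫ τ in (0 : ℝ)..((1 : unitInterval) : ℝ),
      X (z.1, θ₀ + z.2 * projIcc 0 1 zero_le_one τ, φ z (projIcc 0 1 zero_le_one τ)) =
        ∫ τ in (0 : ℝ)..1, X (z.1, θ₀ + z.2 * τ, v (z.1, z.2 * τ)) := by
      refine intervalIntegral.integral_congr fun σ hσ => ?_
      replace hσ : σ ∈ Icc (0 : ℝ) 1 := by simpa using hσ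
      simp only [projIcc_of_mem _ hσ]
      rw [(hball hz).1]
    rw [h2, intervalIntegral.smul_integral_comp_mul_left (fun τ => X (z.1, θ₀ + τ, v (z.1, τ))),
      mul_zero, mul_one] at h1
    exact h1
  -- differentiation of the integral equation in its upper limit
  have hvder : ∀ z : P × ℝ, dist z (y₀, (0 : ℝ)) < ρ →
      HasDerivAt (fun t => v (z.1, t)) (X (z.1, θ₀ + z.2, v z)) z.2 := by
    intro z hz
    have hcont : ∀ t, dist (z.1, t) (y₀, (0 : ℝ)) < ρ →
        ContinuousAt (fun t => X (z.1, θ₀ + t, v (z.1, t))) t := by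
      intro t ht
      have h1 : ContinuousAt (fun t => v (z.1, t)) t :=
        ContinuousAt.comp (g := v) (hball ht).2.2 (by fun_prop)
      exact ContinuousAt.comp (g := X) hX.continuous.continuousAt
        (continuousAt_const.prodMk ((continuousAt_const.add continuousAt_id).prodMk h1))
    have hopen : ∀ᶠ t in 𝓝 z.2, dist (z.1, t) (y₀, (0 : ℝ)) < ρ := by
      have : Continuous fun t : ℝ => dist (z.1, t) (y₀, (0 : ℝ)) := by fun_prop
      exact this.continuousAt.eventually (gt_mem_nhds hz)
    have hder : HasDerivAt (fun t => ∫ τ in (0 : ℝ)..t, X (z.1, θ₀ + τ, v (z.1, τ)))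
        (X (z.1, θ₀ + z.2, v z)) z.2 := by
      refine intervalIntegral.integral_hasDerivAt_right ?_ ?_ (hcont z.2 hz)
      · refine ContinuousOn.intervalIntegrable fun t ht => ?_
        exact (hcont t (hmem z hz t ht)).continuousWithinAt
      · have ho : IsOpen {t : ℝ | dist (z.1, t) (y₀, (0 : ℝ)) < ρ} :=
          isOpen_lt (by fun_prop) continuous_const
        exact ContinuousOn.stronglyMeasurableAtFilter ho
          (fun t ht => (hcont t ht).continuousWithinAt) z.2 hz
    refine (hder.const_add c).congr_of_eventuallyEq ?_
    filter_upwards [hopen] with t ht using hvint (z.1, t) ht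
  refine ⟨fun z => v (z.1, z.2 - θ₀), ?_, ?_, ?_⟩
  · have : Filter.Tendsto (fun z : P × ℝ => (z.1, z.2 - θ₀)) (𝓝 (y₀, θ₀)) (𝓝 (y₀, 0)) :=
      (by fun_prop : Continuous fun z : P × ℝ => (z.1, z.2 - θ₀)).tendsto' _ _ (by simp)
    filter_upwards [this.eventually hφ'] with z hz
    exact ContDiffAt.comp (g := v) z (ev.contDiff.contDiffAt.comp _ hz) (by fun_prop)
  · have : Filter.Tendsto (fun y : P => (y, (0 : ℝ))) (𝓝 y₀) (𝓝 (y₀, 0)) :=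
      (by fun_prop : Continuous fun y : P => (y, (0 : ℝ))).tendsto' _ _ rfl
    filter_upwards [this.eventually (Metric.eventually_nhds_iff.2 ⟨ρ, hρ, fun _ h => h⟩)] with y hy
    simpa using hvint (y, 0) hy
  · have : Filter.Tendsto (fun z : P × ℝ => (z.1, z.2 - θ₀)) (𝓝 (y₀, θ₀)) (𝓝 (y₀, 0)) :=
      (by fun_prop : Continuous fun z : P × ℝ => (z.1, z.2 - θ₀)).tendsto' _ _ (by simp)
    filter_upwards [this.eventually (Metric.eventually_nhds_iff.2 ⟨ρ, hρ, fun _ h => h⟩)] with z hz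
    have h := hvder _ hz
    simp only [add_sub_cancel] at h
    exact HasDerivAt.comp_sub_const z.2 θ₀ h

end ParametricODE

/-! ### Integrals depending on parameters -/

section ParametricIntegral

variable {E : Type} [NormedAddCommGroup E] [NormedSpace ℝ E]

theorem hasFDerivAt_fst_of_contDiffOn {F : Type*} [NormedAddCommGroup F] [NormedSpace ℝ F]
    {V : Set E} (hV : IsOpen V) {g : E × ℝ → F} (hg : ContDiffOn ℝ ∞ g (V ×ˢ univ)) {y : E}
    (hy : y ∈ V) (t : ℝ) :
    HasFDerivAt (fun y => g (y, t)) ((fderiv ℝ g (y, t)).comp (.inl ℝ E ℝ)) y := by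
  have h : ContDiffAt ℝ ∞ g (y, t) := hg.contDiffAt
    ((hV.prod isOpen_univ).mem_nhds ⟨hy, mem_univ _⟩)
  exact HasFDerivAt.comp (g := g) y (h.differentiableAt (by simp)).hasFDerivAt
    (hasFDerivAt_prodMk_left y t)

theorem contDiffOn_partial_fderiv {F : Type*} [NormedAddCommGroup F] [NormedSpace ℝ F]
    {V : Set E} (hV : IsOpen V) {g : E × ℝ → F} (hg : ContDiffOn ℝ ∞ g (V ×ˢ univ)) :
    ContDiffOn ℝ ∞ (fun z : E × ℝ => (fderiv ℝ g z).comp (.inl ℝ E ℝ)) (V ×ˢ univ) :=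
  (hg.fderiv_of_isOpen (hV.prod isOpen_univ) (by simp)).clm_comp contDiffOn_const

theorem continuous_slice_of_contDiffOn {F : Type*} [NormedAddCommGroup F] [NormedSpace ℝ F]
    {V : Set E} {g : E × ℝ → F} (hg : ContDiffOn ℝ ∞ g (V ×ˢ univ)) {y : E} (hy : y ∈ V) :
    Continuous fun t => g (y, t) :=
  hg.continuousOn.comp_continuous (by fun_prop) fun t => ⟨hy, mem_univ _⟩

variable [FiniteDimensional ℝ E]

/-- Differentiation under the integral sign; the derivative of the integrand is bounded on the
compact set `closedBall y r × [a, b]`. -/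
theorem hasFDerivAt_integral_of_contDiffOn {F : Type*} [NormedAddCommGroup F] [NormedSpace ℝ F]
    {V : Set E} (hV : IsOpen V) {g : E × ℝ → F} (hg : ContDiffOn ℝ ∞ g (V ×ˢ univ))
    (a b : ℝ) {y : E} (hy : y ∈ V) :
    HasFDerivAt (fun y => ∫ t in a..b, g (y, t))
      (∫ t in a..b, (fderiv ℝ g (y, t)).comp (.inl ℝ E ℝ)) y := by
  obtain ⟨r, hr, hrV⟩ := Metric.nhds_basis_closedBall.mem_iff.1 (hV.mem_nhds hy)
  have hg' := contDiffOn_partial_fderiv hV hg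
  have hK : IsCompact (Metric.closedBall y r ×ˢ uIcc a b) :=
    (isCompact_closedBall y r).prod isCompact_uIcc
  obtain ⟨C, hC⟩ := hK.exists_bound_of_continuousOn
    (hg'.continuousOn.mono (prod_mono hrV (subset_univ _)))
  refine intervalIntegral.hasFDerivAt_integral_of_dominated_of_fderiv_le (bound := fun _ => C)
    (F := fun y t => g (y, t))
    (F' := fun y t => (fderiv ℝ g (y, t)).comp (.inl ℝ E ℝ))
    (Metric.closedBall_mem_nhds y hr) ?_ ?_ ?_ ?_ ?_ ?_
  · filter_upwards [hV.mem_nhds hy] with x hx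
    exact (continuous_slice_of_contDiffOn hg hx).aestronglyMeasurable
  · exact (continuous_slice_of_contDiffOn hg hy).intervalIntegrable _ _
  · exact (continuous_slice_of_contDiffOn hg' hy).aestronglyMeasurable
  · exact Filter.Eventually.of_forall fun t ht x hx => hC (x, t) ⟨hx, uIoc_subset_uIcc ht⟩
  · exact intervalIntegrable_const
  · exact Filter.Eventually.of_forall fun t _ x hx =>
      hasFDerivAt_fst_of_contDiffOn hV hg (hrV hx) t

/-- Differentiability of order `n`, by induction on `n` for all integrands at once: the derivative
of the integral is the integral of a smooth integrand with values in another space. -/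
theorem contDiffOn_integral_nat {V : Set E} (hV : IsOpen V) (a b : ℝ) (n : ℕ) :
    ∀ {F : Type} [NormedAddCommGroup F] [NormedSpace ℝ F] {g : E × ℝ → F}
      (_ : ContDiffOn ℝ ∞ g (V ×ˢ univ)), ContDiffOn ℝ n (fun y => ∫ t in a..b, g (y, t)) V := by
  induction n with
  | zero =>
    intro F _ _ g hg
    exact contDiffOn_zero.2 fun y hy =>
      (hasFDerivAt_integral_of_contDiffOn hV hg a b hy).continuousAt.continuousWithinAt
  | succ n ih =>
    intro F _ _ g hg
    push_cast
    rw [contDiffOn_succ_iff_fderiv_of_isOpen hV]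
    refine ⟨fun y hy => (hasFDerivAt_integral_of_contDiffOn hV hg a b
      hy).differentiableAt.differentiableWithinAt, by simp, ?_⟩
    exact (ih (contDiffOn_partial_fderiv hV hg)).congr fun y hy =>
      (hasFDerivAt_integral_of_contDiffOn hV hg a b hy).fderiv

/-- The integral of a smooth function over a parameter interval is smooth. -/
theorem contDiffOn_integral {F : Type} [NormedAddCommGroup F] [NormedSpace ℝ F] {V : Set E}
    (hV : IsOpen V) {g : E × ℝ → F} (hg : ContDiffOn ℝ ∞ g (V ×ˢ univ)) (a b : ℝ) :
    ContDiffOn ℝ ∞ (fun y => ∫ t in a..b, g (y, t)) V :=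
  contDiffOn_infty.2 fun n => contDiffOn_integral_nat hV a b n hg

end ParametricIntegral

/-! ### Alternating forms depending smoothly on a point -/

section EvaluationSmooth

/-- Continuous alternating maps on a finite-dimensional space are determined, linearly and
continuously, by finitely many of their values. -/
theorem exists_continuousAlternatingMap_coordinates (V F : Type*) [NormedAddCommGroup V]
    [NormedSpace ℝ V] [FiniteDimensional ℝ V] [NormedAddCommGroup F] [NormedSpace ℝ F]
    [FiniteDimensional ℝ F] (n : ℕ) :
    ∃ (ι : Type) (_ : Fintype ι) (w : ι → Fin n → V) (R : (ι → F) →L[ℝ] V [⋀^Fin n]→L[ℝ] F),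
      ∀ η : V [⋀^Fin n]→L[ℝ] F, R (fun i => η (w i)) = η := by
  let b := Module.finBasis ℝ V
  let ev : (V [⋀^Fin n]→L[ℝ] F) →ₗ[ℝ] ((Fin n → Fin (Module.finrank ℝ V)) → F) :=
    { toFun := fun η i => η fun j => b (i j)
      map_add' := fun _ _ => rfl
      map_smul' := fun _ _ => rfl }
  have hinj : LinearMap.ker ev = ⊥ := by
    rw [LinearMap.ker_eq_bot]
    intro η η' h
    have : η.toMultilinearMap = η'.toMultilinearMap :=
      Module.Basis.ext_multilinear (fun _ => b) fun i => congrFun h i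
    ext v
    exact congrArg (fun m : MultilinearMap ℝ (fun _ : Fin n => V) F => m v) this
  obtain ⟨R, hR⟩ := ev.exists_leftInverse_of_injective hinj
  exact ⟨Fin n → Fin (Module.finrank ℝ V), inferInstance, fun i j => b (i j),
    R.toContinuousLinearMap, fun η => LinearMap.congr_fun hR η⟩

variable {X V F : Type*} [NormedAddCommGroup X] [NormedSpace ℝ X] [NormedAddCommGroup V]
  [NormedSpace ℝ V] [FiniteDimensional ℝ V] [NormedAddCommGroup F] [NormedSpace ℝ F]
  [FiniteDimensional ℝ F] {n : ℕ} {m : WithTop ℕ∞}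

theorem contDiffWithinAt_continuousAlternatingMap_iff {f : X → V [⋀^Fin n]→L[ℝ] F} {s : Set X}
    {x : X} : ContDiffWithinAt ℝ m f s x ↔ ∀ v, ContDiffWithinAt ℝ m (fun x => f x v) s x := by
  constructor
  · intro h v
    exact (ContinuousAlternatingMap.apply ℝ V F v).contDiff.contDiffAt.comp_contDiffWithinAt x h
  · intro h
    obtain ⟨ι, _, w, R, hR⟩ := exists_continuousAlternatingMap_coordinates V F n
    have : f = fun x => R (fun i => f x (w i)) := funext fun x => (hR (f x)).symm
    rw [this]
    exact R.contDiff.contDiffAt.comp_contDiffWithinAt x (contDiffWithinAt_pi.2 fun i => h (w i))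

theorem contDiffOn_continuousAlternatingMap_iff {f : X → V [⋀^Fin n]→L[ℝ] F} {s : Set X} :
    ContDiffOn ℝ m f s ↔ ∀ v, ContDiffOn ℝ m (fun x => f x v) s :=
  ⟨fun h v x hx => contDiffWithinAt_continuousAlternatingMap_iff.1 (h x hx) v,
    fun h x hx => contDiffWithinAt_continuousAlternatingMap_iff.2 fun v => h v x hx⟩

end EvaluationSmooth

/-! ### Calculus on a Lie group -/

section LieCalculus

variable {e : ℕ} {G : Type*} [TopologicalSpace G] [ChartedSpace (Euc e) G] [Group G]
  {E : Type*} [NormedAddCommGroup E] [NormedSpace ℝ E]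
  {E' : Type*} [NormedAddCommGroup E'] [NormedSpace ℝ E']

variable (e) in
/-- The pullback `h⁻¹ dh` of the Maurer-Cartan form under a map `h` from a normed space to `G`. -/
def mc (h : E → G) (y : E) : E →L[ℝ] LieAlg e G :=
  (maurerCartan G (h y)).comp (mfderiv 𝓘(ℝ, E) (𝓡 e) h y)

theorem mcPullback_eq_mc {n : ℕ} (h : Euc n → G) (y : Euc n) : mcPullback G h y = mc e h y := rfl

theorem logDeriv_eq_mc (γ : ℝ → G) (θ : ℝ) : logDeriv G γ θ = mc e γ θ 1 := rfl

variable (e G) in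
/-- The chart of `G` at the identity. -/
def chartOne : G → Euc e := extChartAt (𝓡 e) (1 : G)

variable (e G) in
/-- The inverse of the chart of `G` at the identity. -/
def chartOneSymm : Euc e → G := (extChartAt (𝓡 e) (1 : G)).symm

@[simp] theorem chartOneSymm_chartOne_one : chartOneSymm e G (chartOne e G 1) = 1 :=
  extChartAt_to_inv _

theorem eventually_chartOneSymm_chartOne :
    ∀ᶠ g in 𝓝 (1 : G), chartOneSymm e G (chartOne e G g) = g := by
  filter_upwards [extChartAt_source_mem_nhds (I := 𝓡 e) (1 : G)] with g hg
  exact (extChartAt (𝓡 e) (1 : G)).left_inv hg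

theorem eventually_chartOne_chartOneSymm :
    ∀ᶠ x in 𝓝 (chartOne e G 1), chartOne e G (chartOneSymm e G x) = x := by
  filter_upwards [extChartAt_target_mem_nhds (I := 𝓡 e) (1 : G)] with g hg
  exact (extChartAt (𝓡 e) (1 : G)).right_inv hg

/-- For a map with `k y = 1` the manifold derivative at `y` is by definition the derivative of `k`
read in the chart at the identity. -/
theorem mfderiv_eq_fderiv_chartOne {k : E → G} {y : E} (hk : MDifferentiableAt 𝓘(ℝ, E) (𝓡 e) k y)
    (h1 : k y = 1) :
    (mfderiv 𝓘(ℝ, E) (𝓡 e) k y : E →L[ℝ] Euc e) = fderiv ℝ (fun z => chartOne e G (k z)) y := by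
  refine (show _ = fderivWithin ℝ (writtenInExtChartAt 𝓘(ℝ, E) (𝓡 e) y k) (range 𝓘(ℝ, E))
    (extChartAt 𝓘(ℝ, E) y y) from if_pos hk).trans ?_
  simp only [writtenInExtChartAt, h1, modelWithCornersSelf_coe, range_id, fderivWithin_univ,
    extChartAt_model_space_eq_id, PartialEquiv.refl_symm, PartialEquiv.refl_coe]
  rfl

theorem contMDiffAt_chartOne : ContMDiffAt (𝓡 e) 𝓘(ℝ, Euc e) ∞ (chartOne e G) 1 :=
  contMDiffAt_extChartAt

theorem mc_congr {h h' : E → G} {y : E} (H : h =ᶠ[𝓝 y] h') :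
    (mc e h y : E →L[ℝ] LieAlg e G) = mc e h' y := by
  have h0 : h y = h' y := H.eq_of_nhds
  unfold mc
  have h1 : (mfderiv 𝓘(ℝ, E) (𝓡 e) h y : E →L[ℝ] Euc e) = mfderiv 𝓘(ℝ, E) (𝓡 e) h' y :=
    H.mfderiv_eq
  have h2 : (maurerCartan G (h y) : Euc e →L[ℝ] Euc e) = maurerCartan G (h' y) := by rw [h0]
  exact congrArg₂ (fun (a : Euc e →L[ℝ] Euc e) (b : E →L[ℝ] Euc e) => a.comp b) h2 h1

theorem mc_comp_of_mdifferentiableAt {h : E' → G} {u : E → E'} {y : E}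
    (hh : MDifferentiableAt 𝓘(ℝ, E') (𝓡 e) h (u y))
    (hu : DifferentiableAt ℝ u y) :
    (mc e (fun z => h (u z)) y : E →L[ℝ] LieAlg e G) = (mc e h (u y)).comp (fderiv ℝ u y) := by
  have h1 : (mfderiv 𝓘(ℝ, E) (𝓡 e) (h ∘ u) y : E →L[ℝ] Euc e) =
      (mfderiv 𝓘(ℝ, E') (𝓡 e) h (u y) : E' →L[ℝ] Euc e).comp (fderiv ℝ u y) := by
    have := mfderiv_comp (I := 𝓘(ℝ, E)) (I' := 𝓘(ℝ, E')) (I'' := 𝓡 e) y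
      hh hu.mdifferentiableAt
    rw [mfderiv_eq_fderiv] at this
    exact this
  exact congrArg (fun b : E →L[ℝ] Euc e =>
    (maurerCartan G (h (u y)) : Euc e →L[ℝ] Euc e).comp b) h1

theorem mc_comp {h : E' → G} {u : E → E'} {y : E} (hh : ContMDiffAt 𝓘(ℝ, E') (𝓡 e) ∞ h (u y))
    (hu : DifferentiableAt ℝ u y) :
    (mc e (fun z => h (u z)) y : E →L[ℝ] LieAlg e G) = (mc e h (u y)).comp (fderiv ℝ u y) :=
  mc_comp_of_mdifferentiableAt (hh.mdifferentiableAt (by simp)) hu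

theorem contDiffAt_chartOne_comp {k : E → G} {y : E} (hk : ContMDiffAt 𝓘(ℝ, E) (𝓡 e) ∞ k y)
    (h1 : k y = 1) : ContDiffAt ℝ ∞ (fun z => chartOne e G (k z)) y := by
  have h := contMDiffAt_chartOne (e := e) (G := G)
  rw [← h1] at h
  exact (h.comp y hk).contDiffAt

/-- The left-invariant vector field of `X`, read in the chart at the identity. -/
def invariantFieldChart (G : Type*) [TopologicalSpace G] [ChartedSpace (Euc e) G] [Group G]
    (X : LieAlg e G) : Euc e → Euc e :=
  VectorField.mpullbackWithin 𝓘(ℝ, Euc e) (𝓡 e) (extChartAt (𝓡 e) (1 : G)).symm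
    (mulInvariantVectorField (I := 𝓡 e) (G := G) X) (range (𝓡 e))

theorem lieBracket_eq_fderiv (X Y : LieAlg e G) :
    lieBracket G X Y =
      fderiv ℝ (invariantFieldChart G Y) (chartOne e G 1)
          (invariantFieldChart G X (chartOne e G 1)) -
        fderiv ℝ (invariantFieldChart G X) (chartOne e G 1)
          (invariantFieldChart G Y (chartOne e G 1)) := by
  have h1 : (mfderiv (𝓡 e) 𝓘(ℝ, Euc e) (extChartAt (𝓡 e) (1 : G)) 1 : Euc e →L[ℝ] Euc e) =
      ContinuousLinearMap.id ℝ (Euc e) := by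
    refine (show _ = fderivWithin ℝ (writtenInExtChartAt (𝓡 e) 𝓘(ℝ, Euc e) (1 : G)
      (extChartAt (𝓡 e) (1 : G))) (range (𝓡 e)) (extChartAt (𝓡 e) (1 : G) 1) from
        if_pos (contMDiffAt_chartOne.mdifferentiableAt (by simp))).trans ?_
    simp only [writtenInExtChartAt, modelWithCornersSelf_coe, range_id, fderivWithin_univ,
      extChartAt_model_space_eq_id, PartialEquiv.refl_coe, Function.id_comp]
    have : (extChartAt (𝓡 e) (1 : G) ∘ (extChartAt (𝓡 e) (1 : G)).symm)
        =ᶠ[𝓝 (chartOne e G 1)] id := eventually_chartOne_chartOneSymm (e := e) (G := G)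
    exact this.fderiv_eq.trans fderiv_id
  have h2 : lieBracket G X Y =
      (mfderiv (𝓡 e) 𝓘(ℝ, Euc e) (extChartAt (𝓡 e) (1 : G)) 1 : Euc e →L[ℝ] Euc e).inverse
      (VectorField.lieBracketWithin (E := Euc e) ℝ (invariantFieldChart G X)
        (invariantFieldChart G Y)
        ((extChartAt (𝓡 e) (1 : G)).symm ⁻¹' univ ∩ range (𝓡 e)) (chartOne e G 1)) := rfl
  have h3 : ∀ L : Euc e →L[ℝ] Euc e, L = ContinuousLinearMap.id ℝ (Euc e) →
      ∀ w, L.inverse w = w := by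
    rintro _ rfl w
    simp
  refine h2.trans ((h3 _ h1 _).trans ?_)
  simp [VectorField.lieBracketWithin]

variable [LieGroup (𝓡 e) ∞ G]

theorem contMDiffAt_chartOneSymm :
    ContMDiffAt 𝓘(ℝ, Euc e) (𝓡 e) ∞ (chartOneSymm e G) (chartOne e G 1) :=
  (contMDiffOn_extChartAt_symm (1 : G)).contMDiffAt (extChartAt_target_mem_nhds (1 : G))

theorem contMDiffAt_mul_left' (g : G) (x : G) : ContMDiffAt (𝓡 e) (𝓡 e) ∞ (fun x : G => g * x) x :=
  contMDiff_mul_left.contMDiffAt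

theorem ContMDiffAt.const_mul' {h : E → G} {y : E} (hh : ContMDiffAt 𝓘(ℝ, E) (𝓡 e) ∞ h y) (g : G) :
    ContMDiffAt 𝓘(ℝ, E) (𝓡 e) ∞ (fun z => g * h z) y :=
  contMDiffAt_const.mul hh

theorem mc_eq_mfderiv {h : E → G} {y : E} (hh : MDifferentiableAt 𝓘(ℝ, E) (𝓡 e) h y) :
    mc e h y = (mfderiv 𝓘(ℝ, E) (𝓡 e) (fun z => (h y)⁻¹ * h z) y : E →L[ℝ] Euc e) :=
  (mfderiv_comp (I := 𝓘(ℝ, E)) (I' := 𝓡 e) (I'' := 𝓡 e) (g := fun x : G => (h y)⁻¹ * x) y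
    ((contMDiffAt_mul_left' _ _).mdifferentiableAt (by simp)) hh).symm

/-- The form `h⁻¹ dh` is the ordinary derivative at `z = y` of `z ↦ h(y)⁻¹ h(z)`, read in the chart
at the identity. -/
theorem mc_eq_fderiv_of_mdifferentiableAt {h : E → G} {y : E}
    (hh : MDifferentiableAt 𝓘(ℝ, E) (𝓡 e) h y) :
    mc e h y = fderiv ℝ (fun z => chartOne e G ((h y)⁻¹ * h z)) y := by
  rw [mc_eq_mfderiv hh]
  exact mfderiv_eq_fderiv_chartOne (MDifferentiableAt.comp (I' := 𝓡 e) y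
    (g := fun x : G => (h y)⁻¹ * x)
    ((contMDiffAt_mul_left' _ _).mdifferentiableAt (by simp)) hh) (by simp)

theorem mc_eq_fderiv {h : E → G} {y : E} (hh : ContMDiffAt 𝓘(ℝ, E) (𝓡 e) ∞ h y) :
    mc e h y = fderiv ℝ (fun z => chartOne e G ((h y)⁻¹ * h z)) y :=
  mc_eq_fderiv_of_mdifferentiableAt (hh.mdifferentiableAt (by simp))

theorem mc_const_mul_of_mdifferentiableAt {h : E → G} {y : E}
    (hh : MDifferentiableAt 𝓘(ℝ, E) (𝓡 e) h y) (g : G) :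
    mc e (fun z => g * h z) y = mc e h y := by
  have h1 : MDifferentiableAt 𝓘(ℝ, E) (𝓡 e) (fun z => g * h z) y :=
    MDifferentiableAt.comp (I' := 𝓡 e) y (g := fun x : G => g * x)
      ((contMDiffAt_mul_left' _ _).mdifferentiableAt (by simp)) hh
  rw [mc_eq_fderiv_of_mdifferentiableAt hh, mc_eq_fderiv_of_mdifferentiableAt h1]
  congr 1
  funext z
  congr 1
  group

theorem mc_const_mul {h : E → G} {y : E} (hh : ContMDiffAt 𝓘(ℝ, E) (𝓡 e) ∞ h y) (g : G) :
    mc e (fun z => g * h z) y = mc e h y :=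
  mc_const_mul_of_mdifferentiableAt (hh.mdifferentiableAt (by simp)) g

@[simp] theorem mc_const (g : G) (y : E) :
    (mc e (fun _ => g) y : E →L[ℝ] LieAlg e G) = 0 := by
  rw [mc_eq_fderiv contMDiffAt_const]
  simp

/-- The form `h⁻¹ dh` of a smooth map is smooth: it is the derivative in `z` at `z = y` of a jointly
smooth function of `(y, z)`. -/
theorem contDiffAt_mc {h : E → G} {y : E} (hh : ContMDiffAt 𝓘(ℝ, E) (𝓡 e) ∞ h y) :
    ContDiffAt ℝ ∞ (mc e h) y := by
  have hev : ∀ᶠ z in 𝓝 y, MDifferentiableAt 𝓘(ℝ, E) (𝓡 e) h z :=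
    ((contMDiffAt_iff_contMDiffAt_nhds (n := 1) (by simp)).1 (hh.of_le (by simp))).mono
      fun z hz => hz.mdifferentiableAt one_ne_zero
  have hF : ContDiffAt ℝ ∞ (fun q : E × E => chartOne e G ((h q.1)⁻¹ * h q.2)) (y, y) := by
    refine contDiffAt_chartOne_comp (k := fun q : E × E => (h q.1)⁻¹ * h q.2) ?_ (by simp)
    have h1 : ContMDiffAt 𝓘(ℝ, E × E) (𝓡 e) ∞ (fun q : E × E => h q.1) (y, y) :=
      ContMDiffAt.comp (g := h) (y, y) hh contDiff_fst.contDiffAt.contMDiffAt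
    have h2 : ContMDiffAt 𝓘(ℝ, E × E) (𝓡 e) ∞ (fun q : E × E => h q.2) (y, y) :=
      ContMDiffAt.comp (g := h) (y, y) hh contDiff_snd.contDiffAt.contMDiffAt
    exact h1.inv.mul h2
  have := ContDiffAt.fderiv (n := ∞) (m := ∞) (f := fun x z => chartOne e G ((h x)⁻¹ * h z))
    (g := id) (x₀ := y) hF contDiffAt_id (by simp)
  refine this.congr_of_eventuallyEq ?_
  filter_upwards [hev] with z hz using mc_eq_fderiv_of_mdifferentiableAt hz

theorem Ad_eq_fderiv (g : G) :
    Ad G g = fderiv ℝ (fun x => chartOne e G (g * chartOneSymm e G x * g⁻¹)) (chartOne e G 1) := by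
  have hk : MDifferentiableAt (𝓡 e) (𝓡 e) (fun x : G => g * x * g⁻¹) 1 := by
    have : ContMDiffAt (𝓡 e) (𝓡 e) ∞ (fun x : G => g * x * g⁻¹) 1 :=
      (contMDiffAt_mul_left' g 1).mul contMDiffAt_const
    exact this.mdifferentiableAt (by simp)
  refine (show _ = fderivWithin ℝ (writtenInExtChartAt (𝓡 e) (𝓡 e) 1 fun x : G => g * x * g⁻¹)
    (range (𝓡 e)) (extChartAt (𝓡 e) (1 : G) 1) from if_pos hk).trans ?_
  simp only [writtenInExtChartAt, modelWithCornersSelf_coe, range_id, fderivWithin_univ]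
  have : extChartAt (𝓡 e) (g * 1 * g⁻¹) = extChartAt (𝓡 e) (1 : G) := by simp
  rw [this]
  rfl

/-- The product rule `(hk)⁻¹ d(hk) = Ad(k⁻¹) (h⁻¹ dh) + k⁻¹ dk`. -/
theorem mc_mul {h k : E → G} {y : E} (hh : ContMDiffAt 𝓘(ℝ, E) (𝓡 e) ∞ h y)
    (hk : ContMDiffAt 𝓘(ℝ, E) (𝓡 e) ∞ k y) :
    mc e (fun z => h z * k z) y = (Ad G (k y)⁻¹).comp (mc e h y) + mc e k y := by
  -- `F (z, z)` is `(h(y) k(y))⁻¹ h(z) k(z)` in the chart, and its two partial derivatives at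
  -- `(y, y)` are the two summands
  set F : E × E → Euc e := fun q =>
    chartOne e G ((k y)⁻¹ * ((h y)⁻¹ * h q.1) * ((k y)⁻¹)⁻¹ * ((k y)⁻¹ * k q.2)) with hF
  have hFs : ContDiffAt ℝ ∞ F (y, y) := by
    refine contDiffAt_chartOne_comp (k := fun q : E × E =>
      (k y)⁻¹ * ((h y)⁻¹ * h q.1) * ((k y)⁻¹)⁻¹ * ((k y)⁻¹ * k q.2)) ?_ (by simp)
    have h1 : ContMDiffAt 𝓘(ℝ, E × E) (𝓡 e) ∞ (fun q : E × E => h q.1) (y, y) :=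
      ContMDiffAt.comp (g := h) (y, y) hh contDiff_fst.contDiffAt.contMDiffAt
    have h2 : ContMDiffAt 𝓘(ℝ, E × E) (𝓡 e) ∞ (fun q : E × E => k q.2) (y, y) :=
      ContMDiffAt.comp (g := k) (y, y) hk contDiff_snd.contDiffAt.contMDiffAt
    exact ((contMDiffAt_const.mul (contMDiffAt_const.mul h1)).mul contMDiffAt_const).mul
      (contMDiffAt_const.mul h2)
  have hFd := (hFs.differentiableAt (by simp)).hasFDerivAt
  have e1 : mc e (fun z => h z * k z) y = (fderiv ℝ F (y, y)).comp
      ((ContinuousLinearMap.id ℝ E).prod (ContinuousLinearMap.id ℝ E)) := by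
    refine (mc_eq_fderiv (hh.mul hk)).trans ?_
    have : HasFDerivAt (fun z => F (z, z)) _ y :=
      HasFDerivAt.comp (g := F) y hFd ((hasFDerivAt_id y).prodMk (hasFDerivAt_id y))
    rw [← this.fderiv]
    congr 1
    funext z
    simp only [hF, Pi.mul_apply]
    congr 1
    group
  have e2 : (Ad G (k y)⁻¹).comp (mc e h y) = (fderiv ℝ F (y, y)).comp (.inl ℝ E E) := by
    have h1 : HasFDerivAt (fun z => F (z, y)) _ y :=
      HasFDerivAt.comp (g := F) y hFd (hasFDerivAt_prodMk_left y y)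
    rw [← h1.fderiv, Ad_eq_fderiv, mc_eq_fderiv hh]
    set c : Euc e → Euc e := fun x =>
      chartOne e G ((k y)⁻¹ * chartOneSymm e G x * ((k y)⁻¹)⁻¹) with hc
    have hcs : ContDiffAt ℝ ∞ c (chartOne e G 1) := by
      refine contDiffAt_chartOne_comp (k := fun x =>
        (k y)⁻¹ * chartOneSymm e G x * ((k y)⁻¹)⁻¹) ?_ (by simp)
      exact (contMDiffAt_const.mul contMDiffAt_chartOneSymm).mul contMDiffAt_const
    have ha : ContDiffAt ℝ ∞ (fun z => chartOne e G ((h y)⁻¹ * h z)) y :=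
      contDiffAt_chartOne_comp (ContMDiffAt.const_mul' hh _) (by simp)
    have ha1 : chartOne e G ((h y)⁻¹ * h y) = chartOne e G 1 := by simp
    have hev : (fun z => F (z, y)) =ᶠ[𝓝 y] fun z => c (chartOne e G ((h y)⁻¹ * h z)) := by
      have hcont : Filter.Tendsto (fun z => (h y)⁻¹ * h z) (𝓝 y) (𝓝 1) := by
        have := (ContMDiffAt.const_mul' hh (h y)⁻¹).continuousAt
        simpa [ContinuousAt] using this
      filter_upwards [hcont.eventually (eventually_chartOneSymm_chartOne (e := e))] with z hz
      simp only [hF, hc, hz]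
      simp
    rw [hev.fderiv_eq, ← ha1]
    rw [← ha1] at hcs
    exact (fderiv_comp y (hcs.differentiableAt (by simp)) (ha.differentiableAt (by simp))).symm
  have e3 : mc e k y = (fderiv ℝ F (y, y)).comp (.inr ℝ E E) := by
    have h1 : HasFDerivAt (fun z => F (y, z)) _ y :=
      HasFDerivAt.comp (g := F) y hFd (hasFDerivAt_prodMk_right y y)
    rw [← h1.fderiv, mc_eq_fderiv hk]
    congr 1
    funext z
    simp [hF]
  rw [e1, e2, e3]
  ext1 v
  simp [← map_add]

/-! ### The Maurer-Cartan equation -/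

theorem contMDiffAt_chartOneSymm_of_mem {x : Euc e}
    (hx : x ∈ (extChartAt (𝓡 e) (1 : G)).target) :
    ContMDiffAt 𝓘(ℝ, Euc e) (𝓡 e) ∞ (chartOneSymm e G) x :=
  (contMDiffOn_extChartAt_symm (1 : G)).contMDiffAt
    ((isOpen_extChartAt_target (I := 𝓡 e) (1 : G)).mem_nhds hx)

theorem mc_chartOneSymm_one :
    mc e (chartOneSymm e G) (chartOne e G 1) = ContinuousLinearMap.id ℝ (Euc e) := by
  rw [mc_eq_fderiv contMDiffAt_chartOneSymm]
  have : (fun z => chartOne e G ((chartOneSymm e G (chartOne e G 1))⁻¹ * chartOneSymm e G z))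
      =ᶠ[𝓝 (chartOne e G 1)] id := by
    filter_upwards [eventually_chartOne_chartOneSymm (e := e) (G := G)] with x hx
    simpa using hx
  rw [this.fderiv_eq, fderiv_id]

/-- The Maurer-Cartan form takes the value `X` on the left-invariant vector field of `X`. -/
theorem maurerCartan_mulInvariantVectorField (X : LieAlg e G) (g : G) :
    maurerCartan G g (mulInvariantVectorField (I := 𝓡 e) (G := G) X g) = X := by
  have h := mfderiv_comp_apply_of_eq (I := 𝓡 e) (I' := 𝓡 e) (I'' := 𝓡 e) (f := fun x : G => g * x)
    (g := fun x : G => g⁻¹ * x) (x := 1) (y := g)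
    ((contMDiffAt_mul_left' _ _).mdifferentiableAt (by simp))
    ((contMDiffAt_mul_left' _ _).mdifferentiableAt (by simp)) (mul_one g) X
  refine h.symm.trans ?_
  have : ((fun x : G => g⁻¹ * x) ∘ fun x : G => g * x) = id := by
    funext x; simp
  have h2 : (mfderiv (𝓡 e) (𝓡 e) ((fun x : G => g⁻¹ * x) ∘ fun x : G => g * x) 1 :
      Euc e →L[ℝ] Euc e) = ContinuousLinearMap.id ℝ (Euc e) := by
    rw [this]; exact mfderiv_id
  exact congrArg (fun L : Euc e →L[ℝ] Euc e => L X) h2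

theorem mc_invariantFieldChart (X : LieAlg e G) {x : Euc e}
    (hx : x ∈ (extChartAt (𝓡 e) (1 : G)).target) :
    mc e (chartOneSymm e G) x (invariantFieldChart G X x) = X := by
  have hi := isInvertible_mfderivWithin_extChartAt_symm (I := 𝓡 e) hx
  have h1 : (mfderiv 𝓘(ℝ, Euc e) (𝓡 e) (chartOneSymm e G) x : Euc e →L[ℝ] Euc e) =
      mfderivWithin 𝓘(ℝ, Euc e) (𝓡 e) (extChartAt (𝓡 e) (1 : G)).symm (range (𝓡 e)) x := by
    have : range (𝓡 e) = univ := by simp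
    rw [this, mfderivWithin_univ]
    rfl
  have h2 : (mfderiv 𝓘(ℝ, Euc e) (𝓡 e) (chartOneSymm e G) x : Euc e →L[ℝ] Euc e)
      (invariantFieldChart G X x) =
      mulInvariantVectorField (I := 𝓡 e) (G := G) X (chartOneSymm e G x) := by
    rw [h1]
    exact hi.self_apply_inverse _
  have h3 := maurerCartan_mulInvariantVectorField X (chartOneSymm e G x)
  exact (congrArg (fun v : Euc e =>
    (maurerCartan G (chartOneSymm e G x) : Euc e →L[ℝ] Euc e) v) h2).trans h3

theorem differentiableAt_invariantFieldChart (X : LieAlg e G) :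
    DifferentiableAt ℝ (invariantFieldChart G X) (chartOne e G 1) := by
  have h := (mdifferentiableAt_mulInvariantVectorField (I := 𝓡 e) (G := G) X
    (g := 1)).mdifferentiableWithinAt (s := univ)
  exact h.differentiableWithinAt_mpullbackWithin_vectorField.differentiableAt (by simp)

/-- The Maurer-Cartan equation at the identity, in the chart: differentiate the constant function
`Θ(X^L) = X` in the direction `v`, for left-invariant fields `X^L`. -/
theorem fderiv_mc_chartOneSymm (X Y : LieAlg e G) :
    fderiv ℝ (mc e (chartOneSymm e G)) (chartOne e G 1) X Y -
      fderiv ℝ (mc e (chartOneSymm e G)) (chartOne e G 1) Y X = - lieBracket G X Y := by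
  set c := chartOne e G 1
  have hmem : c ∈ (extChartAt (𝓡 e) (1 : G)).target := mem_extChartAt_target (1 : G)
  have hX : ∀ X : LieAlg e G, invariantFieldChart G X c = X := fun X => by
    have := mc_invariantFieldChart X hmem
    rwa [mc_chartOneSymm_one] at this
  have key : ∀ X v : LieAlg e G, fderiv ℝ (mc e (chartOneSymm e G)) c v X +
      fderiv ℝ (invariantFieldChart G X) c v = 0 := by
    intro X v
    have h1 : HasFDerivAt (fun x => mc e (chartOneSymm e G) x (invariantFieldChart G X x)) _ c :=
      (((contDiffAt_mc contMDiffAt_chartOneSymm).differentiableAt (by simp)).hasFDerivAt).clm_apply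
        (differentiableAt_invariantFieldChart X).hasFDerivAt
    have h2 : (fun x => mc e (chartOneSymm e G) x (invariantFieldChart G X x)) =ᶠ[𝓝 c]
        fun _ => X := by
      filter_upwards [extChartAt_target_mem_nhds (I := 𝓡 e) (1 : G)] with x hx
      exact mc_invariantFieldChart X hx
    have h3 := h1.unique ((hasFDerivAt_const X c).congr_of_eventuallyEq h2)
    have h4 := congrArg (fun L : Euc e →L[ℝ] Euc e => L v) h3
    have h5 : mc e (chartOneSymm e G) c (fderiv ℝ (invariantFieldChart G X) c v) +
      fderiv ℝ (mc e (chartOneSymm e G)) c v (invariantFieldChart G X c) = 0 := h4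
    rw [mc_chartOneSymm_one, hX] at h5
    rw [add_comm]
    exact h5
  rw [lieBracket_eq_fderiv, hX, hX, eq_neg_of_add_eq_zero_left (key Y X),
    eq_neg_of_add_eq_zero_left (key X Y)]
  abel

/-- The Maurer-Cartan equation `dω + ½ [ω, ω] = 0` for `ω = h⁻¹ dh`, evaluated on two vectors. -/
theorem maurerCartan_equation {h : E → G} {y : E} (hh : ContMDiffAt 𝓘(ℝ, E) (𝓡 e) ∞ h y)
    (v w : E) :
    fderiv ℝ (mc e h) y v w - fderiv ℝ (mc e h) y w v =
      - lieBracket G (mc e h y v) (mc e h y w) := by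
  set c := chartOne e G 1 with hc
  set u : E → Euc e := fun z => chartOne e G ((h y)⁻¹ * h z) with hu
  have huy : u y = c := by simp [hu, hc]
  have hus : ContDiffAt ℝ ∞ u y :=
    contDiffAt_chartOne_comp (ContMDiffAt.const_mul' hh _) (by simp)
  -- near `y`, `h(y)⁻¹ h` is the inverse chart `b` composed with `u`, so that
  -- `h⁻¹ dh = u^* (b⁻¹ db)`
  have hev : ∀ᶠ z in 𝓝 y, mc e h z = (mc e (chartOneSymm e G) (u z)).comp (fderiv ℝ u z) := by
    have h1 : ∀ᶠ z in 𝓝 y, chartOneSymm e G (u z) = (h y)⁻¹ * h z := by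
      have hcont : Filter.Tendsto (fun z => (h y)⁻¹ * h z) (𝓝 y) (𝓝 1) := by
        have := (ContMDiffAt.const_mul' hh (h y)⁻¹).continuousAt
        simpa [ContinuousAt] using this
      exact hcont.eventually (eventually_chartOneSymm_chartOne (e := e))
    have h2 : ∀ᶠ z in 𝓝 y, MDifferentiableAt 𝓘(ℝ, E) (𝓡 e) h z :=
      ((contMDiffAt_iff_contMDiffAt_nhds (n := 1) (by simp)).1 (hh.of_le (by simp))).mono
        fun z hz => hz.mdifferentiableAt one_ne_zero
    have h3 : ∀ᶠ z in 𝓝 y, DifferentiableAt ℝ u z :=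
      ((hus.of_le (m := 1) (by simp)).eventually (by simp)).mono
        fun z hz => hz.differentiableAt one_ne_zero
    have h4 : ∀ᶠ z in 𝓝 y, u z ∈ (extChartAt (𝓡 e) (1 : G)).target := by
      have := hus.continuousAt
      rw [ContinuousAt, huy] at this
      exact this.eventually (extChartAt_target_mem_nhds (I := 𝓡 e) (1 : G))
    filter_upwards [h1.eventually_nhds, h2, h3, h4] with z hz1 hz2 hz3 hz4
    rw [← mc_comp (contMDiffAt_chartOneSymm_of_mem hz4) hz3]
    have : mc e (fun z => chartOneSymm e G (u z)) z = mc e (fun z => (h y)⁻¹ * h z) z :=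
      mc_congr hz1
    rw [this, mc_const_mul_of_mdifferentiableAt hz2]
  have hΘ : HasFDerivAt (mc e (chartOneSymm e G)) (fderiv ℝ (mc e (chartOneSymm e G)) c) (u y) := by
    rw [huy]
    exact ((contDiffAt_mc contMDiffAt_chartOneSymm).differentiableAt (by simp)).hasFDerivAt
  have hud := (hus.differentiableAt (by simp)).hasFDerivAt
  have hu2 : HasFDerivAt (fderiv ℝ u) (fderiv ℝ (fderiv ℝ u) y) y :=
    ((hus.fderiv_right (m := ∞) (by simp)).differentiableAt (by simp)).hasFDerivAt
  have hsymm : ∀ v w, fderiv ℝ (fderiv ℝ u) y v w = fderiv ℝ (fderiv ℝ u) y w v := fun v w =>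
    (hus.isSymmSndFDerivAt (by
      rw [minSmoothness_of_isRCLikeNormedField]; exact ENat.LEInfty.out)) v w
  have hω : HasFDerivAt (fun z => (mc e (chartOneSymm e G) (u z)).comp (fderiv ℝ u z)) _ y :=
    (HasFDerivAt.comp (g := mc e (chartOneSymm e G)) y hΘ hud).clm_comp hu2
  have hfd : ∀ v w, fderiv ℝ (mc e h) y v w = fderiv ℝ (mc e (chartOneSymm e G)) c
      (fderiv ℝ u y v) (fderiv ℝ u y w) + fderiv ℝ (fderiv ℝ u) y v w := by
    intro v w
    have h1 := (hω.congr_of_eventuallyEq hev).fderiv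
    rw [h1]
    simp only [Function.comp_apply, huy]
    rw [show mc e (chartOneSymm e G) c = _ from mc_chartOneSymm_one]
    simp [add_comm]
  have hmc : ∀ v, mc e h y v = fderiv ℝ u y v := by
    intro v
    rw [hev.self_of_nhds, huy, mc_chartOneSymm_one]
    rfl
  rw [hfd, hfd, hmc, hmc, hsymm w v, add_sub_add_right_eq_sub]
  exact fderiv_mc_chartOneSymm _ _

end LieCalculus

/-! ### The adjoint action -/

section AdjointAction

variable {e : ℕ} {G : Type*} [TopologicalSpace G] [ChartedSpace (Euc e) G] [Group G]
  [LieGroup (𝓡 e) ∞ G] {E : Type*} [NormedAddCommGroup E] [NormedSpace ℝ E]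

/-- `Ad g` as the Maurer-Cartan form of `x ↦ b(x) g⁻¹` at the identity, `b` the inverse chart; this
makes the product rule and the Maurer-Cartan equation available for `Ad`. -/
theorem Ad_eq_mc (g : G) :
    Ad G g = mc e (fun x => chartOneSymm e G x * g⁻¹) (chartOne e G 1) := by
  rw [mc_mul contMDiffAt_chartOneSymm contMDiffAt_const, mc_chartOneSymm_one, mc_const, inv_inv,
    add_zero]
  rfl

@[simp] theorem Ad_one : Ad G (1 : G) = ContinuousLinearMap.id ℝ (Euc e) := by
  rw [Ad_eq_mc]
  simpa using mc_chartOneSymm_one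

theorem Ad_mul (g h : G) : Ad (e := e) G (g * h) = (Ad G g).comp (Ad G h) := by
  rw [Ad_eq_mc (g * h), Ad_eq_mc h]
  have h1 := mc_mul (e := e) (h := fun x => chartOneSymm e G x * h⁻¹) (k := fun _ => g⁻¹)
    (y := chartOne e G 1) (contMDiffAt_chartOneSymm.mul contMDiffAt_const) contMDiffAt_const
  rw [mc_const, inv_inv, add_zero] at h1
  rw [← h1]
  congr 1
  funext x
  group

@[simp] theorem Ad_inv_Ad (g : G) (X : LieAlg e G) : Ad G g⁻¹ (Ad G g X) = X := by
  have := congrArg (fun L : Euc e →L[ℝ] Euc e => L X) (Ad_mul (e := e) g⁻¹ g)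
  rw [inv_mul_cancel, Ad_one] at this
  exact this.symm

@[simp] theorem Ad_Ad_inv (g : G) (X : LieAlg e G) : Ad G g (Ad G g⁻¹ X) = X := by
  have := Ad_inv_Ad (e := e) g⁻¹ X
  rwa [inv_inv] at this

theorem mc_inv {h : E → G} {y : E} (hh : ContMDiffAt 𝓘(ℝ, E) (𝓡 e) ∞ h y) :
    mc e (fun z => (h z)⁻¹) y = -(Ad G (h y)).comp (mc e h y) := by
  have h1 := mc_mul hh hh.inv
  have h2 : mc e (fun z => h z * (h z)⁻¹) y = 0 := by
    have : (fun z => h z * (h z)⁻¹) = fun _ => 1 := by funext z; simp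
    rw [this, mc_const]
  rw [h2] at h1
  rw [inv_inv] at h1
  exact (neg_eq_of_add_eq_zero_right h1.symm).symm

/-- The two-parameter map `(y, x) ↦ b(x) h(y)⁻¹`, with `b` the inverse chart at the identity, whose
Maurer-Cartan form restricts to `Ad (h y)` in the second variable. -/
theorem Ad_eq_mc_prod {h : E → G} {y : E} (hh : MDifferentiableAt 𝓘(ℝ, E) (𝓡 e) h y) :
    Ad G (h y) = (mc e (fun q : E × Euc e => chartOneSymm e G q.2 * (h q.1)⁻¹)
      (y, chartOne e G 1)).comp (.inr ℝ E (Euc e)) := by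
  rw [Ad_eq_mc]
  have h2 : MDifferentiableAt 𝓘(ℝ, E × Euc e) (𝓡 e)
      (fun q : E × Euc e => chartOneSymm e G q.2 * (h q.1)⁻¹) (y, chartOne e G 1) := by
    have h3 : ContMDiff ((𝓡 e).prod (𝓡 e)) (𝓡 e) ∞ fun p : G × G => p.1 * p.2⁻¹ :=
      contMDiff_fst.mul contMDiff_snd.inv
    have h4 : MDifferentiableAt 𝓘(ℝ, E × Euc e) (𝓡 e) (fun q : E × Euc e => h q.1)
        (y, chartOne e G 1) :=
      MDifferentiableAt.comp (I' := 𝓘(ℝ, E)) (g := h) (y, chartOne e G 1) hh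
        differentiableAt_fst.mdifferentiableAt
    have h5 : MDifferentiableAt 𝓘(ℝ, E × Euc e) (𝓡 e)
        (fun q : E × Euc e => chartOneSymm e G q.2) (y, chartOne e G 1) :=
      MDifferentiableAt.comp (I' := 𝓘(ℝ, Euc e)) (g := chartOneSymm e G) (y, chartOne e G 1)
        (contMDiffAt_chartOneSymm.mdifferentiableAt (by simp))
        differentiableAt_snd.mdifferentiableAt
    exact MDifferentiableAt.comp (I' := (𝓡 e).prod (𝓡 e)) (g := fun p : G × G => p.1 * p.2⁻¹)
      (f := fun q : E × Euc e => (chartOneSymm e G q.2, h q.1))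
      (y, chartOne e G 1) (h3.mdifferentiableAt (by simp)) (h5.prodMk h4)
  have h1 := mc_comp_of_mdifferentiableAt (u := fun x : Euc e => (y, x)) (y := chartOne e G 1) h2
    (by fun_prop)
  rw [(hasFDerivAt_prodMk_right y (chartOne e G 1)).fderiv] at h1
  exact h1

theorem contMDiffAt_prod_family {h : E → G} {y : E} (hh : ContMDiffAt 𝓘(ℝ, E) (𝓡 e) ∞ h y) :
    ContMDiffAt 𝓘(ℝ, E × Euc e) (𝓡 e) ∞
      (fun q : E × Euc e => chartOneSymm e G q.2 * (h q.1)⁻¹) (y, chartOne e G 1) := by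
  have h1 : ContMDiffAt 𝓘(ℝ, E × Euc e) (𝓡 e) ∞ (fun q : E × Euc e => h q.1)
      (y, chartOne e G 1) :=
    ContMDiffAt.comp (g := h) (y, chartOne e G 1) hh contDiff_fst.contDiffAt.contMDiffAt
  have h2 : ContMDiffAt 𝓘(ℝ, E × Euc e) (𝓡 e) ∞ (fun q : E × Euc e => chartOneSymm e G q.2)
      (y, chartOne e G 1) :=
    ContMDiffAt.comp (g := chartOneSymm e G) (y, chartOne e G 1) contMDiffAt_chartOneSymm
      contDiff_snd.contDiffAt.contMDiffAt
  exact h2.mul h1.inv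

theorem eventually_mdifferentiableAt {h : E → G} {y : E}
    (hh : ContMDiffAt 𝓘(ℝ, E) (𝓡 e) ∞ h y) :
    ∀ᶠ z in 𝓝 y, MDifferentiableAt 𝓘(ℝ, E) (𝓡 e) h z :=
  ((contMDiffAt_iff_contMDiffAt_nhds (n := 1) (by simp)).1 (hh.of_le (by simp))).mono
    fun _ hz => hz.mdifferentiableAt one_ne_zero

theorem Ad_comp_eventuallyEq_mc {h : E → G} {y : E} (hh : ContMDiffAt 𝓘(ℝ, E) (𝓡 e) ∞ h y) :
    (fun z => Ad (e := e) G (h z)) =ᶠ[𝓝 y] fun z =>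
      (mc e (fun q : E × Euc e => chartOneSymm e G q.2 * (h q.1)⁻¹)
        (z, chartOne e G 1)).comp (.inr ℝ E (Euc e)) := by
  filter_upwards [eventually_mdifferentiableAt hh] with z hz using Ad_eq_mc_prod hz

theorem contDiffAt_Ad {h : E → G} {y : E} (hh : ContMDiffAt 𝓘(ℝ, E) (𝓡 e) ∞ h y) :
    ContDiffAt ℝ ∞ (fun z => Ad (e := e) G (h z)) y := by
  refine ContDiffAt.congr_of_eventuallyEq ?_ (Ad_comp_eventuallyEq_mc hh)
  exact (ContDiffAt.comp (g := mc e (fun q : E × Euc e => chartOneSymm e G q.2 * (h q.1)⁻¹)) y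
    (contDiffAt_mc (contMDiffAt_prod_family hh)) (by fun_prop)).clm_comp contDiffAt_const

/-- `Ad g` is a Lie algebra homomorphism: compare the Maurer-Cartan equations of `b` and `b g⁻¹`,
whose Maurer-Cartan forms are related by `Ad g`. -/
theorem Ad_lieBracket (g : G) (X Y : LieAlg e G) :
    Ad G g (lieBracket G X Y) = lieBracket G (Ad G g X) (Ad G g Y) := by
  set c := chartOne e G 1 with hc
  have hb : ContMDiffAt 𝓘(ℝ, Euc e) (𝓡 e) ∞ (chartOneSymm e G) c := contMDiffAt_chartOneSymm
  have hbg : ContMDiffAt 𝓘(ℝ, Euc e) (𝓡 e) ∞ (fun x => chartOneSymm e G x * g⁻¹) c :=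
    hb.mul contMDiffAt_const
  have hev : mc e (fun x => chartOneSymm e G x * g⁻¹) =ᶠ[𝓝 c]
      fun z => (Ad G g).comp (mc e (chartOneSymm e G) z) := by
    filter_upwards [extChartAt_target_mem_nhds (I := 𝓡 e) (1 : G)] with z hz
    have := mc_mul (contMDiffAt_chartOneSymm_of_mem hz)
      (contMDiffAt_const (c := g⁻¹) (I := 𝓘(ℝ, Euc e)) (I' := 𝓡 e) (n := ∞))
    rw [mc_const, inv_inv, add_zero] at this
    exact this
  have hd := ((contDiffAt_mc hb).differentiableAt (by simp)).hasFDerivAt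
  have hfd : ∀ v w, fderiv ℝ (mc e (fun x => chartOneSymm e G x * g⁻¹)) c v w =
      Ad G g (fderiv ℝ (mc e (chartOneSymm e G)) c v w) := by
    intro v w
    rw [(((hasFDerivAt_const (Ad (e := e) G g) c).clm_comp hd).congr_of_eventuallyEq hev).fderiv]
    simp
  have h1 := maurerCartan_equation hbg X Y
  have h2 := maurerCartan_equation hb X Y
  rw [hfd, hfd, ← map_sub, h2, hev.self_of_nhds, mc_chartOneSymm_one, map_neg, neg_inj] at h1
  simp only [mc_chartOneSymm_one, hc] at h1
  exact h1

/-- The derivative of `Ad ∘ h` is `Ad(h) ∘ ad(h⁻¹ dh)`: the Maurer-Cartan equation of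
`(y, x) ↦ b(x) h(y)⁻¹`. -/
theorem fderiv_Ad {h : E → G} {y : E} (hh : ContMDiffAt 𝓘(ℝ, E) (𝓡 e) ∞ h y) (v : E)
    (X : LieAlg e G) :
    fderiv ℝ (fun z => Ad (e := e) G (h z)) y v X = Ad G (h y) (lieBracket G (mc e h y v) X) := by
  set c := chartOne e G 1 with hc
  set H : E × Euc e → G := fun q => chartOneSymm e G q.2 * (h q.1)⁻¹ with hH
  have hHs : ContMDiffAt 𝓘(ℝ, E × Euc e) (𝓡 e) ∞ H (y, c) := contMDiffAt_prod_family hh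
  have hd : HasFDerivAt (mc e H) (fderiv ℝ (mc e H) (y, c)) (y, c) :=
    ((contDiffAt_mc hHs).differentiableAt (by simp)).hasFDerivAt
  have h1 : fderiv ℝ (fun z => Ad (e := e) G (h z)) y v X =
      fderiv ℝ (mc e H) (y, c) (v, 0) (0, X) := by
    have h2 : HasFDerivAt (fun z => (mc e H (z, c)).comp (.inr ℝ E (Euc e))) _ y :=
      (HasFDerivAt.comp (g := mc e H) y hd (hasFDerivAt_prodMk_left y c)).clm_comp
        (hasFDerivAt_const _ y)
    rw [(h2.congr_of_eventuallyEq (Ad_comp_eventuallyEq_mc hh)).fderiv]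
    simp
  -- in the first variable `H (·, x)` is a left translate of `h⁻¹`, whatever `x` is
  have h3 : ∀ᶠ x in 𝓝 c, ∀ v, mc e H (y, x) (v, 0) = mc e (fun z => (h z)⁻¹) y v := by
    have h4 : Filter.Tendsto (fun x : Euc e => (y, x)) (𝓝 c) (𝓝 (y, c)) :=
      (by fun_prop : Continuous fun x : Euc e => (y, x)).tendsto' _ _ rfl
    filter_upwards [h4.eventually (eventually_mdifferentiableAt hHs)] with x hx v
    have h5 := mc_comp_of_mdifferentiableAt (u := fun z : E => (z, x)) (y := y) hx (by fun_prop)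
    rw [(hasFDerivAt_prodMk_left y x).fderiv] at h5
    have h6 : mc e (fun z => H (z, x)) y = mc e (fun z => (h z)⁻¹) y := mc_const_mul hh.inv _
    have h7 : mc e (fun z => (h z)⁻¹) y = (mc e H (y, x)).comp (.inl ℝ E (Euc e)) :=
      h6.symm.trans h5
    rw [h7]
    simp
  have h8 : fderiv ℝ (mc e H) (y, c) (0, X) (v, 0) = 0 := by
    have h9 : HasFDerivAt (fun x => mc e H (y, x) (v, 0)) _ c :=
      (HasFDerivAt.comp (g := mc e H) c hd (hasFDerivAt_prodMk_right y c)).clm_apply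
        (hasFDerivAt_const _ c)
    have h10 := h9.unique ((hasFDerivAt_const (mc e (fun z => (h z)⁻¹) y v) c).congr_of_eventuallyEq
      (h3.mono fun x hx => hx v))
    have h11 := congrArg (fun L : Euc e →L[ℝ] Euc e => L X) h10
    simpa using h11
  have h12 := maurerCartan_equation hHs (v, 0) (0, X)
  have h13 : mc e H (y, c) (0, X) = Ad G (h y) X := by
    have := Ad_eq_mc_prod (hh.mdifferentiableAt (by simp))
    rw [this]
    simp [hH, hc]
  have h14 : mc e H (y, c) (v, 0) = -Ad G (h y) (mc e h y v) := by
    rw [h3.self_of_nhds, mc_inv hh]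
    rfl
  rw [h8, sub_zero] at h12
  rw [h1, h12, h13, h14, Ad_lieBracket]
  change -(bracketCLM G (-_)) _ = bracketCLM G _ _
  rw [map_neg]
  simp

theorem hasFDerivAt_Ad {h : E → G} {y : E} (hh : ContMDiffAt 𝓘(ℝ, E) (𝓡 e) ∞ h y) :
    HasFDerivAt (fun z => Ad (e := e) G (h z))
      ((ContinuousLinearMap.compL ℝ (Euc e) (Euc e) (Euc e) (Ad G (h y))).comp
        ((bracketCLM G).comp (mc e h y))) y := by
  have h1 := ((contDiffAt_Ad hh).differentiableAt (by simp)).hasFDerivAt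
  refine h1.congr_fderiv ?_
  ext1 v
  ext1 X
  exact fderiv_Ad hh v X

/-- Infinitesimal form of the invariance of `f` under the adjoint action. -/
theorem InvPoly.sum_update_lieBracket {k : ℕ} (f : InvPoly e G k) (X : LieAlg e G)
    (v : Fin k → LieAlg e G) :
    ∑ i, f.toMulti (Function.update v i (lieBracket G X (v i))) = 0 := by
  have hb : ContMDiffAt 𝓘(ℝ, Euc e) (𝓡 e) ∞ (chartOneSymm e G) (chartOne e G 1) :=
    contMDiffAt_chartOneSymm
  have h1 : ∀ i, HasFDerivAt (fun x => Ad G (chartOneSymm e G x) (v i))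
      (((bracketCLM G).flip (v i))) (chartOne e G 1) := by
    intro i
    have h2 := (hasFDerivAt_Ad hb).clm_apply (hasFDerivAt_const (v i) (chartOne e G 1))
    refine h2.congr_fderiv ?_
    ext1 X
    simp [mc_chartOneSymm_one]
  have h3 := HasFDerivAt.multilinear_comp f.toMulti h1
  have h4 : (fun x => f.toMulti fun i => Ad G (chartOneSymm e G x) (v i)) =
      fun _ => f.toMulti v := by
    funext x
    exact f.invariant _ v
  rw [h4] at h3
  have h5 := h3.unique (hasFDerivAt_const _ _)
  have h6 := congrArg (fun L : Euc e →L[ℝ] ℝ => L X) h5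
  simp [ContinuousMultilinearMap.toContinuousLinearMap] at h6
  exact h6

end AdjointAction

/-! ### Paths with prescribed logarithmic derivative -/

section LogarithmicDerivative

variable {e : ℕ} {G : Type*} [TopologicalSpace G] [ChartedSpace (Euc e) G]
  {E : Type} [NormedAddCommGroup E] [NormedSpace ℝ E]

theorem ContMDiffAt.slice {g : E × ℝ → G} {y : E} {t : ℝ}
    (hg : ContMDiffAt 𝓘(ℝ, E × ℝ) (𝓡 e) ∞ g (y, t)) :
    ContMDiffAt 𝓘(ℝ, ℝ) (𝓡 e) ∞ (fun t => g (y, t)) t :=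
  ContMDiffAt.comp (g := g) (f := fun t : ℝ => (y, t)) t hg
    (contDiff_prodMk_right y).contDiffAt.contMDiffAt

theorem ContMDiffAt.slice_left {g : E × ℝ → G} {y : E} {t : ℝ}
    (hg : ContMDiffAt 𝓘(ℝ, E × ℝ) (𝓡 e) ∞ g (y, t)) :
    ContMDiffAt 𝓘(ℝ, E) (𝓡 e) ∞ (fun y => g (y, t)) y :=
  ContMDiffAt.comp (g := g) (f := fun y : E => (y, t)) y hg
    (contDiff_prodMk_left t).contDiffAt.contMDiffAt

variable [Group G]

/-- The family of paths `g (y, ·)` is smooth and has logarithmic derivative `ξ (y, ·)` at `z`. -/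
def HasLogDerivAt (ξ : E × ℝ → Euc e) (g : E × ℝ → G) (z : E × ℝ) : Prop :=
  ContMDiffAt 𝓘(ℝ, E × ℝ) (𝓡 e) ∞ g z ∧ mc e (fun t => g (z.1, t)) z.2 1 = ξ z

theorem HasLogDerivAt.congr {ξ : E × ℝ → Euc e} {g g' : E × ℝ → G} {z : E × ℝ}
    (h : HasLogDerivAt ξ g z) (hg : g' =ᶠ[𝓝 z] g) : HasLogDerivAt ξ g' z := by
  refine ⟨h.1.congr_of_eventuallyEq hg, ?_⟩
  rw [← h.2]
  have h1 : Filter.Tendsto (fun t => (z.1, t)) (𝓝 z.2) (𝓝 z) :=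
    (by fun_prop : Continuous fun t : ℝ => (z.1, t)).tendsto' _ _ rfl
  exact congrArg (fun L : ℝ →L[ℝ] Euc e => L 1) (mc_congr (h1.eventually hg))

variable [LieGroup (𝓡 e) ∞ G]

theorem eventually_isInvertible_mc_chartOneSymm :
    ∀ᶠ x in 𝓝 (chartOne e G 1), (mc e (chartOneSymm e G) x).IsInvertible := by
  have hc : ContinuousAt (mc e (chartOneSymm e G)) (chartOne e G 1) :=
    (contDiffAt_mc contMDiffAt_chartOneSymm).continuousAt
  have hn := ContinuousLinearEquiv.nhds (ContinuousLinearEquiv.refl ℝ (Euc e))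
  have h1 : mc e (chartOneSymm e G) (chartOne e G 1) =
      (ContinuousLinearEquiv.refl ℝ (Euc e) : Euc e →L[ℝ] Euc e) := mc_chartOneSymm_one
  rw [ContinuousAt, h1] at hc
  exact (hc.eventually hn).mono fun x hx => hx

/-- A path with vanishing logarithmic derivative is locally constant. -/
theorem eventually_eq_of_mc_eq_zero {k : ℝ → G} {t₀ : ℝ}
    (hk : ContMDiffAt 𝓘(ℝ, ℝ) (𝓡 e) ∞ k t₀) (h0 : ∀ᶠ t in 𝓝 t₀, mc e k t 1 = 0) :
    ∀ᶠ t in 𝓝 t₀, k t₀ = k t := by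
  set u : ℝ → Euc e := fun t => chartOne e G ((k t₀)⁻¹ * k t) with hu
  have hus : ContDiffAt ℝ ∞ u t₀ :=
    contDiffAt_chartOne_comp (ContMDiffAt.const_mul' hk _) (by simp)
  have hu0 : u t₀ = chartOne e G 1 := by simp [hu]
  have hlim : Filter.Tendsto (fun t => (k t₀)⁻¹ * k t) (𝓝 t₀) (𝓝 1) := by
    have := (ContMDiffAt.const_mul' hk (k t₀)⁻¹).continuousAt
    simpa [ContinuousAt] using this
  have hulim : Filter.Tendsto u (𝓝 t₀) (𝓝 (chartOne e G 1)) := by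
    have := hus.continuousAt
    rwa [ContinuousAt, hu0] at this
  have h1 : ∀ᶠ t in 𝓝 t₀, chartOneSymm e G (u t) = (k t₀)⁻¹ * k t :=
    hlim.eventually (eventually_chartOneSymm_chartOne (e := e))
  have h3 : ∀ᶠ t in 𝓝 t₀, DifferentiableAt ℝ u t :=
    ((hus.of_le (m := 1) (by simp)).eventually (by simp)).mono
      fun z hz => hz.differentiableAt one_ne_zero
  have hder : ∀ᶠ t in 𝓝 t₀, DifferentiableAt ℝ u t ∧ deriv u t = 0 ∧
      chartOneSymm e G (u t) = (k t₀)⁻¹ * k t := by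
    filter_upwards [h1.eventually_nhds, eventually_mdifferentiableAt hk, h3, h0,
      hulim.eventually (extChartAt_target_mem_nhds (I := 𝓡 e) (1 : G)),
      hulim.eventually eventually_isInvertible_mc_chartOneSymm] with t ht1 ht2 ht3 ht4 ht5 ht6
    refine ⟨ht3, ?_, ht1.self_of_nhds⟩
    have e1 : mc e (fun t => chartOneSymm e G (u t)) t = mc e k t := by
      rw [← mc_const_mul_of_mdifferentiableAt ht2 (k t₀)⁻¹]
      exact mc_congr ht1
    rw [mc_comp (contMDiffAt_chartOneSymm_of_mem ht5) ht3] at e1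
    have e2 := congrArg (fun L : ℝ →L[ℝ] Euc e => L 1) e1
    have e3 : mc e (chartOneSymm e G) (u t) (deriv u t) = mc e k t 1 := e2
    rw [ht4] at e3
    -- the Maurer-Cartan form of the inverse chart is invertible, so that `u` has derivative zero
    obtain ⟨f, hf⟩ := ht6
    rw [← hf] at e3
    exact f.map_eq_zero_iff.1 e3
  obtain ⟨r, hr, hball⟩ := Metric.eventually_nhds_iff_ball.1 hder
  filter_upwards [Metric.ball_mem_nhds t₀ hr] with t ht
  have e1 : u t = u t₀ := Metric.isOpen_ball.is_const_of_deriv_eq_zero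
    (convex_ball t₀ r).isPreconnected (fun x hx => (hball x hx).1.differentiableWithinAt)
    (fun x hx => (hball x hx).2.1) ht (Metric.mem_ball_self hr)
  have e2 := (hball t ht).2.2
  rw [e1, hu0, chartOneSymm_chartOne_one] at e2
  exact (inv_mul_eq_one.1 e2.symm)

/-- Two paths with the same logarithmic derivative differ by a left translation. -/
theorem mul_inv_eq_mul_inv_of_mc_eq {I : Set ℝ} (hI : IsOpen I) (hIc : IsPreconnected I)
    {h k : ℝ → G} (hh : ∀ t ∈ I, ContMDiffAt 𝓘(ℝ, ℝ) (𝓡 e) ∞ h t)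
    (hk : ∀ t ∈ I, ContMDiffAt 𝓘(ℝ, ℝ) (𝓡 e) ∞ k t) (hhk : ∀ t ∈ I, mc e h t 1 = mc e k t 1)
    {s t : ℝ} (hs : s ∈ I) (ht : t ∈ I) : h s * (k s)⁻¹ = h t * (k t)⁻¹ := by
  refine hIc.induction₂ (fun s t => h s * (k s)⁻¹ = h t * (k t)⁻¹) (fun t₀ ht₀ => ?_)
    (fun _ _ _ _ _ _ h1 h2 => h1.trans h2) (fun _ _ _ _ h1 => h1.symm) hs ht
  refine mem_nhdsWithin_of_mem_nhds (eventually_eq_of_mc_eq_zero (e := e)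
    (k := fun t => h t * (k t)⁻¹) ((hh t₀ ht₀).mul (hk t₀ ht₀).inv) ?_)
  filter_upwards [hI.mem_nhds ht₀] with t ht
  have h1 := mc_mul (hh t ht) (hk t ht).inv
  have h2 := congrArg (fun L : ℝ →L[ℝ] Euc e => L 1) h1
  refine h2.trans ?_
  change Ad G ((k t)⁻¹)⁻¹ (mc e h t 1) + mc e (fun z => (k z)⁻¹) t 1 = 0
  rw [mc_inv (hk t ht), hhk t ht, inv_inv]
  exact add_neg_cancel _

theorem HasLogDerivAt.mul_left {ξ : E × ℝ → Euc e} {g : E × ℝ → G} {z : E × ℝ} {a : E → G}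
    (h : HasLogDerivAt ξ g z) (ha : ContMDiffAt 𝓘(ℝ, E) (𝓡 e) ∞ a z.1) :
    HasLogDerivAt ξ (fun w => a w.1 * g w) z := by
  refine ⟨ContMDiffAt.mul (ContMDiffAt.comp (g := a) (f := fun w : E × ℝ => w.1) z ha
    contDiff_fst.contDiffAt.contMDiffAt) h.1, ?_⟩
  rw [← h.2]
  exact congrArg (fun L : ℝ →L[ℝ] Euc e => L 1) (mc_const_mul (ContMDiffAt.slice h.1) _)

/-- Local solvability of `g⁻¹ ∂g = ξ`, with smooth dependence on parameters. In the chart at the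
identity this is an ordinary differential equation, made globally defined by a cut-off. -/
theorem exists_eventually_hasLogDerivAt [FiniteDimensional ℝ E] {V : Set E} (hV : IsOpen V)
    {ξ : E × ℝ → Euc e}
    (hξ : ContDiffOn ℝ ∞ ξ (V ×ˢ univ)) {y₀ : E} (hy₀ : y₀ ∈ V) (θ₀ : ℝ) :
    ∃ g : E × ℝ → G, ∀ᶠ z in 𝓝 (y₀, θ₀), HasLogDerivAt ξ g z := by
  have : CompleteSpace E := FiniteDimensional.complete ℝ E
  set c := chartOne e G 1 with hc
  -- in the chart the equation reads `∂u = Θ(u)⁻¹ ξ`, with `Θ` the Maurer-Cartan form of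
  -- the inverse chart
  obtain ⟨O, hO, hOo, hcO⟩ := eventually_nhds_iff.1 (Filter.Eventually.and
    (show ∀ᶠ x in 𝓝 c, x ∈ (extChartAt (𝓡 e) (1 : G)).target from
      extChartAt_target_mem_nhds (I := 𝓡 e) (1 : G))
    (eventually_isInvertible_mc_chartOneSymm (e := e) (G := G)))
  set Y : E × ℝ × Euc e → Euc e := fun w =>
    (mc e (chartOneSymm e G) w.2.2).inverse (ξ (w.1, w.2.1)) with hY
  set D : Set (E × ℝ × Euc e) := V ×ˢ univ ×ˢ O with hD
  have hDo : IsOpen D := hV.prod (isOpen_univ.prod hOo)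
  have hYs : ContDiffOn ℝ ∞ Y D := by
    intro w hw
    have h1 : ContDiffAt ℝ ∞ (fun w : E × ℝ × Euc e => ξ (w.1, w.2.1)) w :=
      ContDiffAt.comp (g := ξ) w
        ((hξ (w.1, w.2.1) ⟨hw.1, mem_univ _⟩).contDiffAt
          ((hV.prod isOpen_univ).mem_nhds ⟨hw.1, mem_univ _⟩)) (by fun_prop)
    have h2 : ContDiffAt ℝ ∞ (mc e (chartOneSymm e G)) w.2.2 :=
      contDiffAt_mc (contMDiffAt_chartOneSymm_of_mem (hO _ hw.2.2).1)
    obtain ⟨L, hL⟩ := (hO _ hw.2.2).2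
    have h3 : ContDiffAt ℝ ∞ ContinuousLinearMap.inverse (mc e (chartOneSymm e G) w.2.2) := by
      rw [← hL]; exact contDiffAt_map_inverse L
    have h4 : ContDiffAt ℝ ∞ (fun w : E × ℝ × Euc e => (mc e (chartOneSymm e G) w.2.2).inverse) w :=
      ContDiffAt.comp (g := ContinuousLinearMap.inverse) w h3
        (ContDiffAt.comp (g := mc e (chartOneSymm e G)) w h2 (by fun_prop))
    exact (h4.clm_apply h1).contDiffWithinAt
  have hw₀ : (y₀, θ₀, c) ∈ D := ⟨hy₀, mem_univ _, hcO⟩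
  obtain ⟨r, hr, hrD⟩ := Metric.nhds_basis_closedBall.mem_iff.1 (hDo.mem_nhds hw₀)
  let χ : ContDiffBump (y₀, θ₀, c) := ⟨r / 2, r, by positivity, by linarith⟩
  -- the cut-off field is smooth everywhere, the support of `χ` being contained in `D`
  have hX : ContDiff ℝ ∞ fun w => χ w • Y w := by
    rw [contDiff_iff_contDiffAt]
    intro w
    by_cases hw : w ∈ D
    · exact χ.contDiff.contDiffAt.smul ((hYs w hw).contDiffAt (hDo.mem_nhds hw))
    · have h1 : ∀ᶠ x in 𝓝 w, χ x • Y x = 0 := by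
        have : (Metric.closedBall (y₀, θ₀, c) r)ᶜ ∈ 𝓝 w :=
          Metric.isClosed_closedBall.isOpen_compl.mem_nhds fun h => hw (hrD h)
        filter_upwards [this] with x hx
        rw [χ.zero_of_le_dist (by
          simp only [mem_compl_iff, Metric.mem_closedBall, not_le] at hx
          exact hx.le), zero_smul]
      exact contDiffAt_const.congr_of_eventuallyEq h1
  obtain ⟨u, hu1, hu2, hu3⟩ := exists_smooth_solution hX y₀ θ₀ c
  have hu0 : u (y₀, θ₀) = c := hu2.self_of_nhds
  have hlim : Filter.Tendsto (fun z : E × ℝ => (z.1, z.2, u z)) (𝓝 (y₀, θ₀)) (𝓝 (y₀, θ₀, c)) := by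
    have h1 := hu1.self_of_nhds.continuousAt
    rw [ContinuousAt, hu0] at h1
    have h2 : Filter.Tendsto (fun z : E × ℝ => z.1) (𝓝 (y₀, θ₀)) (𝓝 y₀) :=
      continuous_fst.tendsto' _ _ rfl
    have h3 : Filter.Tendsto (fun z : E × ℝ => z.2) (𝓝 (y₀, θ₀)) (𝓝 θ₀) :=
      continuous_snd.tendsto' _ _ rfl
    exact h2.prodMk_nhds (h3.prodMk_nhds h1)
  refine ⟨fun z => chartOneSymm e G (u z), ?_⟩
  filter_upwards [hu1, hu3, hlim.eventually (hDo.mem_nhds hw₀),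
    hlim.eventually χ.eventuallyEq_one] with z hz1 hz2 hz3 hz4
  have hmem := (hO _ hz3.2.2).1
  have hs := contMDiffAt_chartOneSymm_of_mem hmem
  refine ⟨ContMDiffAt.comp (g := chartOneSymm e G) z hs hz1.contMDiffAt, ?_⟩
  have h1 := mc_comp (u := fun t => u (z.1, t)) (y := z.2) hs hz2.differentiableAt
  refine (congrArg (fun L : ℝ →L[ℝ] Euc e => L 1) h1).trans ?_
  change mc e (chartOneSymm e G) (u z) (deriv (fun t => u (z.1, t)) z.2) = ξ z
  rw [hz2.deriv]
  have hz5 : χ (z.1, z.2, u z) = 1 := hz4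
  simp only [hz5, one_smul, hY]
  obtain ⟨L, hL⟩ := (hO _ hz3.2.2).2
  have hL' : mc e (chartOneSymm e G) (u z) = L := hL.symm
  rw [hL']
  simp

/-- Solvability of `g⁻¹ ∂g = ξ` on arbitrarily large intervals near a given parameter: local
solutions are continued by left translations. -/
theorem exists_hasLogDerivAt_of_interval [FiniteDimensional ℝ E] {V : Set E} (hV : IsOpen V)
    {ξ : E × ℝ → Euc e} (hξ : ContDiffOn ℝ ∞ ξ (V ×ˢ univ)) {y₀ : E} (hy₀ : y₀ ∈ V) (a b : ℝ) :
    ∃ I : Set ℝ, (IsOpen I ∧ I.OrdConnected ∧ a ∈ I ∧ b ∈ I) ∧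
      ∃ g : E × ℝ → G, ∀ᶠ y in 𝓝 y₀, ∀ θ ∈ I, HasLogDerivAt ξ g (y, θ) := by
  refine isPreconnected_univ.induction₂ (s := univ) (fun a b : ℝ => ∃ I : Set ℝ,
    (IsOpen I ∧ I.OrdConnected ∧ a ∈ I ∧ b ∈ I) ∧
      ∃ g : E × ℝ → G, ∀ᶠ y in 𝓝 y₀, ∀ θ ∈ I, HasLogDerivAt ξ g (y, θ))
    ?_ ?_ ?_ (mem_univ a) (mem_univ b)
  · intro θ₀ _
    obtain ⟨g, hg⟩ := exists_eventually_hasLogDerivAt (G := G) hV hξ hy₀ θ₀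
    rw [nhds_prod_eq] at hg
    obtain ⟨p, hp, q, hq, hpq⟩ := Filter.eventually_prod_iff.1 hg
    obtain ⟨ε, hε, hεq⟩ := Metric.eventually_nhds_iff_ball.1 hq
    rw [nhdsWithin_univ]
    filter_upwards [Metric.ball_mem_nhds θ₀ hε] with t ht
    exact ⟨Metric.ball θ₀ ε, ⟨Metric.isOpen_ball, (convex_ball θ₀ ε).ordConnected,
      Metric.mem_ball_self hε, ht⟩, g, hp.mono fun y hy θ hθ => hpq hy (hεq θ hθ)⟩
  · rintro a b c - - - ⟨I, ⟨hI1, hI2, ha, hb⟩, g, hg⟩ ⟨J, ⟨hJ1, hJ2, hb', hc⟩, h, hh⟩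
    refine ⟨I ∪ J, ⟨hI1.union hJ1, ?_, Or.inl ha, Or.inr hc⟩, ?_⟩
    · exact (hI2.isPreconnected.union b hb hb' hJ2.isPreconnected).ordConnected
    classical
    -- the continuation of `g` over `J`: the left translate of `h` that agrees with `g` at `b`
    set k : E × ℝ → G := fun w => g (w.1, b) * (h (w.1, b))⁻¹ * h w with hk
    refine ⟨fun w => if w.2 ∈ I then g w else k w, ?_⟩
    have hkk : ∀ᶠ y in 𝓝 y₀, (∀ θ ∈ J, HasLogDerivAt ξ k (y, θ)) ∧
        ∀ θ ∈ I ∩ J, g (y, θ) = k (y, θ) := by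
      filter_upwards [hg, hh] with y hgy hhy
      have h1 : ∀ θ ∈ J, HasLogDerivAt ξ k (y, θ) := fun θ hθ =>
        (hhy θ hθ).mul_left (a := fun y => g (y, b) * (h (y, b))⁻¹)
          ((ContMDiffAt.slice_left (hgy b hb).1).mul (ContMDiffAt.slice_left (hhy b hb').1).inv)
      refine ⟨h1, fun θ hθ => ?_⟩
      have h2 := mul_inv_eq_mul_inv_of_mc_eq (e := e) (hI1.inter hJ1)
        (hI2.inter hJ2).isPreconnected
        (h := fun t => g (y, t)) (k := fun t => k (y, t))
        (fun t ht => ContMDiffAt.slice (hgy t ht.1).1) (fun t ht => ContMDiffAt.slice (h1 t ht.2).1)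
        (fun t ht => (hgy t ht.1).2.trans (h1 t ht.2).2.symm) hθ ⟨hb, hb'⟩
      simp only [hk] at h2 ⊢
      rw [inv_mul_cancel_right, mul_inv_cancel] at h2
      exact mul_inv_eq_one.1 h2
    filter_upwards [hg, hkk.eventually_nhds] with y hgy hky θ hθ
    by_cases hθI : θ ∈ I
    · refine (hgy θ hθI).congr ?_
      have : ∀ᶠ w : E × ℝ in 𝓝 (y, θ), w.2 ∈ I :=
        continuous_snd.continuousAt.eventually (hI1.mem_nhds hθI)
      filter_upwards [this] with w hw
      simp [hw]
    · have hθJ : θ ∈ J := hθ.resolve_left hθI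
      refine (hky.self_of_nhds.1 θ hθJ).congr ?_
      have h1 : ∀ᶠ w : E × ℝ in 𝓝 (y, θ), w.2 ∈ J :=
        continuous_snd.continuousAt.eventually (hJ1.mem_nhds hθJ)
      have h2 : Filter.Tendsto (fun w : E × ℝ => w.1) (𝓝 (y, θ)) (𝓝 y) :=
        continuous_fst.tendsto' _ _ rfl
      filter_upwards [h1, h2.eventually hky] with w hw1 hw2
      by_cases hw : w.2 ∈ I
      · simpa [hw] using hw2.2 w.2 ⟨hw, hw1⟩
      · simp [hw]
  · rintro a b - - ⟨I, ⟨hI1, hI2, ha, hb⟩, g, hg⟩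
    exact ⟨I, ⟨hI1, hI2, hb, ha⟩, g, hg⟩

theorem IsHolonomyPath.unique {ξ : ℝ → LieAlg e G} {g h : ℝ → G} (hg : IsHolonomyPath ξ g)
    (hh : IsHolonomyPath ξ h) : g = h := by
  funext t
  have := mul_inv_eq_mul_inv_of_mc_eq (e := e) isOpen_univ isPreconnected_univ
    (fun t _ => hg.1 t) (fun t _ => hh.1 t)
    (fun t _ => (hg.2.2 t).trans (hh.2.2 t).symm) (mem_univ t) (mem_univ 0)
  rw [hg.2.1, hh.2.1, inv_one, mul_one] at this
  exact mul_inv_eq_one.1 this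

/-- Global solvability of `g⁻¹ ∂g = ξ`, `g 0 = 1`: the solutions on the intervals `(-T, T)`
agree. -/
theorem exists_isHolonomyPath {ξ : ℝ → LieAlg e G} (hξ : ContDiff ℝ ∞ ξ) :
    ∃ g, IsHolonomyPath ξ g := by
  -- without parameters, i.e. with parameter space `ℝ⁰`
  have hex : ∀ T : ℝ, ∃ g : ℝ → G, g 0 = 1 ∧ ∀ t ∈ Ioo (-T) T,
      ContMDiffAt 𝓘(ℝ, ℝ) (𝓡 e) ∞ g t ∧ mc e g t 1 = ξ t := by
    intro T
    obtain ⟨I, ⟨-, hI, ha, hb⟩, g, hg⟩ := exists_hasLogDerivAt_of_interval (G := G)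
      (E := Euc 0) isOpen_univ (ξ := fun z => ξ z.2) (hξ.comp contDiff_snd).contDiffOn
      (mem_univ 0) (-T) T
    refine ⟨fun t => (g (0, 0))⁻¹ * g (0, t), by simp, fun t ht => ?_⟩
    have h1 := hg.self_of_nhds t (hI.out ha hb ⟨ht.1.le, ht.2.le⟩)
    have h2 := ContMDiffAt.slice h1.1
    refine ⟨ContMDiffAt.const_mul' h2 _, ?_⟩
    rw [mc_const_mul h2]
    exact h1.2
  choose g hg0 hg using hex
  have hagree : ∀ S T : ℝ, ∀ t ∈ Ioo (-S) S ∩ Ioo (-T) T, g S t = g T t := by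
    intro S T t ht
    have h0 : (0 : ℝ) ∈ Ioo (-S) S ∩ Ioo (-T) T := by
      obtain ⟨⟨h1, h2⟩, h3, h4⟩ := ht
      refine ⟨⟨?_, ?_⟩, ?_, ?_⟩ <;> linarith
    have := mul_inv_eq_mul_inv_of_mc_eq (e := e) (isOpen_Ioo.inter isOpen_Ioo)
      (ordConnected_Ioo.inter ordConnected_Ioo).isPreconnected
      (fun t ht => (hg S t ht.1).1) (fun t ht => (hg T t ht.2).1)
      (fun t ht => (hg S t ht.1).2.trans (hg T t ht.2).2.symm) ht h0
    rw [hg0, hg0, inv_one, mul_one] at this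
    exact mul_inv_eq_one.1 this
  have hmem : ∀ t : ℝ, t ∈ Ioo (-(|t| + 1)) (|t| + 1) := fun t => by
    constructor <;> [have := neg_abs_le t; have := le_abs_self t] <;> linarith
  have hloc : ∀ t, (fun s => g (|s| + 1) s) =ᶠ[𝓝 t] g (|t| + 1) := by
    intro t
    filter_upwards [isOpen_Ioo.mem_nhds (hmem t)] with s hs using hagree _ _ s ⟨hmem s, hs⟩
  refine ⟨fun t => g (|t| + 1) t, fun t => ?_, hg0 _, fun t => ?_⟩
  · exact (hg _ t (hmem t)).1.congr_of_eventuallyEq (hloc t)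
  · rw [logDeriv_eq_mc, ← (hg _ t (hmem t)).2]
    exact congrArg (fun L : ℝ →L[ℝ] Euc e => L 1) (mc_congr (hloc t))

/-- The solutions of `g⁻¹ ∂g = ξ (y, ·)`, `g 0 = 1`, depend smoothly on the parameter `y`. -/
theorem contMDiffOn_of_isHolonomyPath [FiniteDimensional ℝ E] {V : Set E} (hV : IsOpen V)
    {ξ : E × ℝ → LieAlg e G} (hξ : ContDiffOn ℝ ∞ ξ (V ×ˢ univ)) {g : E → ℝ → G}
    (hg : ∀ y ∈ V, IsHolonomyPath (fun t => ξ (y, t)) (g y)) :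
    ContMDiffOn 𝓘(ℝ, E × ℝ) (𝓡 e) ∞ (fun z : E × ℝ => g z.1 z.2) (V ×ˢ univ) := by
  rintro ⟨y₀, θ₀⟩ ⟨hy₀, -⟩
  have hy₀' : y₀ ∈ V := hy₀
  obtain ⟨I, ⟨hIo, hI, ha, hb⟩, k, hk⟩ := exists_hasLogDerivAt_of_interval (G := G)
    hV hξ hy₀' 0 θ₀
  have hb' : θ₀ ∈ I := hb
  have h1 : ContMDiffAt 𝓘(ℝ, E × ℝ) (𝓡 e) ∞ (fun w : E × ℝ => (k (w.1, 0))⁻¹ * k w) (y₀, θ₀) :=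
    ((hk.self_of_nhds θ₀ hb').mul_left (a := fun y => (k (y, 0))⁻¹)
      (ContMDiffAt.slice_left (hk.self_of_nhds 0 ha).1).inv).1
  refine (h1.congr_of_eventuallyEq ?_).contMDiffWithinAt
  have h2 : Filter.Tendsto (fun w : E × ℝ => w.1) (𝓝 (y₀, θ₀)) (𝓝 y₀) :=
    continuous_fst.tendsto' _ _ rfl
  have h3 : ∀ᶠ w : E × ℝ in 𝓝 (y₀, θ₀), w.2 ∈ I :=
    continuous_snd.continuousAt.eventually (hIo.mem_nhds hb')
  filter_upwards [h2.eventually (hk.and (hV.mem_nhds hy₀')), h3] with w hw1 hw2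
  -- the given solutions are the left translates of `k` with value `1` at `0`
  have h4 := mul_inv_eq_mul_inv_of_mc_eq (e := e) hIo hI.isPreconnected
    (h := g w.1) (k := fun t => k (w.1, t)) (fun t _ => (hg w.1 hw1.2).1 t)
    (fun t ht => ContMDiffAt.slice (hw1.1 t ht).1)
    (fun t ht => ((hg w.1 hw1.2).2.2 t).trans (hw1.1 t ht).2.symm) hw2 ha
  rw [(hg w.1 hw1.2).2.1, one_mul] at h4
  rw [← h4]
  simp

end LogarithmicDerivative

/-! ### Antisymmetrisation -/

section AltSum

variable {V : Type*} {N : ℕ}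

/-- The antisymmetrisation `∑_σ sign σ T (w ∘ σ)` of a function of `N` variables. -/
def altSum (T : (Fin N → V) → ℝ) (w : Fin N → V) : ℝ :=
  ∑ σ : Equiv.Perm (Fin N), ((Equiv.Perm.sign σ : ℤ) : ℝ) * T (w ∘ σ)

theorem altSum_add (T T' : (Fin N → V) → ℝ) (w : Fin N → V) :
    altSum (fun w => T w + T' w) w = altSum T w + altSum T' w := by
  simp [altSum, mul_add, Finset.sum_add_distrib]

theorem altSum_mul_left (c : ℝ) (T : (Fin N → V) → ℝ) (w : Fin N → V) :
    altSum (fun w => c * T w) w = c * altSum T w := by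
  simp only [altSum, Finset.mul_sum]
  exact Finset.sum_congr rfl fun _ _ => by ring

theorem altSum_sum {ι : Type*} (s : Finset ι) (T : ι → (Fin N → V) → ℝ) (w : Fin N → V) :
    altSum (fun w => ∑ i ∈ s, T i w) w = ∑ i ∈ s, altSum (T i) w := by
  simp only [altSum, Finset.mul_sum]
  exact Finset.sum_comm

theorem altSum_comp_perm (π : Equiv.Perm (Fin N)) (T : (Fin N → V) → ℝ) (w : Fin N → V) :
    altSum (fun w => T (w ∘ π)) w = ((Equiv.Perm.sign π : ℤ) : ℝ) * altSum T w := by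
  rw [altSum, altSum, Finset.mul_sum]
  refine Fintype.sum_equiv (Equiv.mulRight π) _ _ fun σ => ?_
  have h : ((Equiv.Perm.sign π : ℤ) : ℝ) * ((Equiv.Perm.sign π : ℤ) : ℝ) = 1 := by
    rw [← Int.cast_mul, Int.units_coe_mul_self, Int.cast_one]
  simp only [Equiv.coe_mulRight, Equiv.Perm.sign_mul, Units.val_mul, Int.cast_mul,
    Equiv.Perm.coe_mul, ← Function.comp_assoc]
  linear_combination (-((Equiv.Perm.sign σ : ℤ) : ℝ) * T ((w ∘ σ) ∘ π)) * h

theorem altSum_comp_swap {i j : Fin N} (hij : i ≠ j) (T : (Fin N → V) → ℝ) (w : Fin N → V) :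
    altSum (fun w => T (w ∘ Equiv.swap i j)) w = -altSum T w := by
  rw [altSum_comp_perm, Equiv.Perm.sign_swap hij]
  simp

/-- The Laplace expansion of an antisymmetrisation along the first variable. -/
theorem altSum_succ (T : (Fin (N + 1) → V) → ℝ) (w : Fin (N + 1) → V) :
    altSum T w = ∑ i : Fin (N + 1), (-1 : ℝ) ^ (i : ℕ) *
      altSum (fun v => T (Fin.cons (w i) v)) (i.removeNth w) := by
  rw [altSum, Finset.univ_perm_fin_succ, ← Finset.univ_product_univ]
  simp only [Finset.sum_map, Equiv.toEmbedding_apply, Finset.sum_product]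
  refine Finset.sum_congr rfl fun i _ => ?_
  induction i using Fin.cases with
  | zero =>
    simp only [altSum, Fin.val_zero, pow_zero, one_mul]
    refine Finset.sum_congr rfl fun σ _ => ?_
    rw [Equiv.Perm.decomposeFin.symm_sign, if_pos rfl, one_mul]
    congr 2
    funext j
    induction j using Fin.cases with
    | zero => simp
    | succ j => simp [Fin.tail]
  | succ i =>
    -- `i.cycleRange` moves the variable `i + 1` past the `i` variables that follow the first one
    have h := altSum_comp_perm i.cycleRange
      (fun v => T (Fin.cons (w i.succ) v)) (i.succ.removeNth w)
    have h1 : (((Equiv.Perm.sign i.cycleRange : ℤ)) : ℝ) = (-1) ^ (i : ℕ) := by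
      simp [Fin.sign_cycleRange]
    rw [Fin.val_succ, pow_succ', ← h1, mul_assoc, altSum, Finset.mul_sum, Finset.mul_sum]
    refine Fintype.sum_equiv (Equiv.mulLeft i.cycleRange) _ _ fun σ => ?_
    rw [Equiv.Perm.decomposeFin.symm_sign, if_neg (Fin.succ_ne_zero i)]
    have h2 : ((Equiv.Perm.sign i.cycleRange : ℤ) : ℝ) * ((Equiv.Perm.sign i.cycleRange : ℤ) : ℝ) =
        1 := by
      rw [← Int.cast_mul, Int.units_coe_mul_self, Int.cast_one]
    have h3 : w ∘ Equiv.Perm.decomposeFin.symm (i.succ, σ) =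
        Fin.cons (w i.succ) (i.succ.removeNth w ∘ i.cycleRange ∘ σ) := by
      funext j
      induction j using Fin.cases with
      | zero => simp
      | succ j =>
        simp only [Function.comp_apply, Equiv.Perm.decomposeFin_symm_apply_succ, Fin.cons_succ,
          Fin.removeNth, Fin.succAbove_cycleRange]
    simp only [h3, Equiv.coe_mulLeft, Equiv.Perm.coe_mul, Equiv.Perm.sign_mul,
      Units.val_mul, Int.cast_mul]
    generalize T (Fin.cons (w i.succ) (i.succ.removeNth w ∘ i.cycleRange ∘ σ)) = X
    push_cast
    linear_combination ((Equiv.Perm.sign σ : ℤ) : ℝ) * X * h2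

end AltSum

/-- Recursion for the positions at which the blocks of sizes `c, p 0, p 1, …` start, as computed by
`finSigmaFinEquiv`. -/
theorem sum_castLE_cons {m : ℕ} (c : ℕ) (p : Fin m → ℕ) {b : ℕ} (hb : b + 1 ≤ m + 1) :
    ∑ j : Fin (b + 1), (Fin.cons c p : Fin (m + 1) → ℕ) (Fin.castLE hb j) =
      c + ∑ j : Fin b, p (Fin.castLE (Nat.le_of_succ_le_succ hb) j) := by
  rw [Fin.sum_univ_succ]
  rfl

/-! ### Evaluation of the invariant polynomials on forms -/

section Evaluation

variable {e : ℕ} {G : Type*} [TopologicalSpace G] [ChartedSpace (Euc e) G] [Group G]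
  {V : Type*} [AddCommGroup V] [Module ℝ V] [TopologicalSpace V]

/-- The form `f (α, β, …, β)` as an antisymmetrisation; the factor is `1 / p!` for every block of
size `p`. -/
theorem InvPoly.oneTwo_apply {k : ℕ}
    (f : InvPoly e G (k + 1)) (α : V [⋀^Fin 1]→L[ℝ] LieAlg e G)
    (β : V [⋀^Fin 2]→L[ℝ] LieAlg e G) (w : Fin (2 * k + 1) → V) :
    f.oneTwo α β w = (1 / 2) ^ k * altSum (fun w => f.toMulti (Fin.cons (α ![w ⟨0, by omega⟩])
      fun i : Fin k => β ![w ⟨2 * i + 1, by omega⟩, w ⟨2 * i + 2, by omega⟩])) w := by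
  rw [InvPoly.oneTwo, polyWedge_apply, altSum, smul_eq_mul]
  congr 1
  · simp [Fin.prod_univ_succ]
  refine Finset.sum_congr rfl fun σ _ => ?_
  rw [Units.smul_def, zsmul_eq_mul]
  congr 2
  funext i
  induction i using Fin.cases with
  | zero =>
    refine congrArg α (funext fun j : Fin 1 => ?_)
    obtain rfl := Subsingleton.elim j 0
    refine congrArg (fun x => w (σ x)) (Fin.ext ?_)
    exact finSigmaFinEquiv_apply _
  | succ i =>
    have hv : ∀ j : Fin 2, ((finSigmaFinEquiv (m := k + 1) (n := Fin.cons 1 fun _ : Fin k => 2)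
        ⟨i.succ, j⟩ : Fin _) : ℕ) = 2 * i + 1 + j := by
      intro j
      have := (finSigmaFinEquiv_apply (m := k + 1) (n := Fin.cons 1 fun _ : Fin k => 2)
        ⟨i.succ, j⟩).trans (congrArg (· + (j : ℕ))
          (sum_castLE_cons 1 (fun _ : Fin k => 2) (b := i) (by omega)))
      rw [this, Fin.sum_const, smul_eq_mul]
      ring
    refine congrArg β (funext fun j : Fin 2 => ?_)
    fin_cases j
    · exact congrArg (fun x => w (σ x)) (Fin.ext (hv 0))
    · exact congrArg (fun x => w (σ x)) (Fin.ext (hv 1))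

/-- The form `f (α, α', β₁, …, β_l)` as an antisymmetrisation. -/
theorem InvPoly.oneOneTwo_apply {l : ℕ}
    (f : InvPoly e G (l + 2)) (α α' : V [⋀^Fin 1]→L[ℝ] LieAlg e G)
    (β : Fin l → V [⋀^Fin 2]→L[ℝ] LieAlg e G) (w : Fin (2 * (l + 1)) → V) :
    f.oneOneTwo α α' β w = (1 / 2) ^ l * altSum (fun w => f.toMulti
      (Fin.cons (α ![w ⟨0, by omega⟩]) (Fin.cons (α' ![w ⟨1, by omega⟩])
        fun i : Fin l => β i ![w ⟨2 * i + 2, by omega⟩, w ⟨2 * i + 3, by omega⟩]))) w := by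
  rw [InvPoly.oneOneTwo, polyWedge_apply, altSum, smul_eq_mul]
  congr 1
  · simp [Fin.prod_univ_succ]
  refine Finset.sum_congr rfl fun σ _ => ?_
  rw [Units.smul_def, zsmul_eq_mul]
  congr 2
  funext i
  refine Fin.cases ?_ (fun i => Fin.cases ?_ (fun i => ?_) i) i
  · refine congrArg α (funext fun j : Fin 1 => ?_)
    obtain rfl := Subsingleton.elim j 0
    refine congrArg (fun x => w (σ x)) (Fin.ext ?_)
    exact finSigmaFinEquiv_apply _
  · refine congrArg α' (funext fun j : Fin 1 => ?_)
    obtain rfl := Subsingleton.elim j 0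
    refine congrArg (fun x => w (σ x)) (Fin.ext ?_)
    refine (finSigmaFinEquiv_apply _).trans ?_
    exact congrArg (· + 0) (sum_castLE_cons 1 (Fin.cons 1 fun _ : Fin l => 2) (b := 0) (by omega))
  · have hv : ∀ j : Fin 2, ((finSigmaFinEquiv (m := l + 2)
        (n := Fin.cons 1 (Fin.cons 1 fun _ : Fin l => 2))
        ⟨i.succ.succ, j⟩ : Fin _) : ℕ) = 2 * i + 2 + j := by
      intro j
      have := (finSigmaFinEquiv_apply (m := l + 2) (n := Fin.cons 1 (Fin.cons 1 fun _ : Fin l => 2))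
        ⟨i.succ.succ, j⟩).trans (congrArg (· + (j : ℕ))
          ((sum_castLE_cons 1 (Fin.cons 1 fun _ : Fin l => 2) (b := i + 1) (by omega)).trans
          (congrArg (1 + ·) (sum_castLE_cons 1 (fun _ : Fin l => 2) (b := i) (by omega)))))
      rw [this, Fin.sum_const, smul_eq_mul]
      ring
    refine congrArg (β i) (funext fun j : Fin 2 => ?_)
    fin_cases j
    · exact congrArg (fun x => w (σ x)) (Fin.ext (hv 0))
    · exact congrArg (fun x => w (σ x)) (Fin.ext (hv 1))

variable [LieGroup (𝓡 e) ∞ G]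

theorem bracketMulti_apply (v : Fin 2 → LieAlg e G) :
    bracketMulti G v = lieBracket G (v 0) (v 1) := rfl

theorem bracketCLM_apply (X Y : LieAlg e G) : bracketCLM G X Y = lieBracket G X Y := rfl

theorem formBracket_apply (α β : V [⋀^Fin 1]→L[ℝ] LieAlg e G) (u v : V) :
    formBracket G α β ![u, v] =
      lieBracket G (α ![u]) (β ![v]) - lieBracket G (α ![v]) (β ![u]) := by
  have hu : (Finset.univ : Finset (Equiv.Perm (Fin 2))) = {1, Equiv.swap 0 1} := by decide
  have hv : ∀ i : Fin 2, ((finSigmaFinEquiv (m := 2) (n := fun _ => 1) ⟨i, 0⟩ : Fin _) : ℕ) =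
      i := by
    intro i
    rw [finSigmaFinEquiv_apply]
    simp
  have hη : ∀ (i : Fin 2) (σ : Equiv.Perm (Fin 2)), (![α, β] i fun j : Fin 1 =>
      (![u, v] : Fin 2 → V)
        (σ (finCongr (by simp) (finSigmaFinEquiv (m := 2) (n := fun _ => 1) ⟨i, j⟩)))) =
      ![α, β] i ![(![u, v] : Fin 2 → V) (σ i)] := by
    intro i σ
    refine congrArg (![α, β] i) (funext fun j => ?_)
    obtain rfl := Subsingleton.elim j 0
    exact congrArg (fun x => (![u, v] : Fin 2 → V) (σ x)) (Fin.ext (hv i))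
  rw [formBracket, polyWedge_apply, hu, Finset.sum_pair (by decide)]
  simp only [hη, bracketMulti_apply]
  simp [sub_eq_add_neg]

end Evaluation

/-! ### The pointwise identity behind the transgression formula -/

section Pointwise

variable {V : Type*} {l : ℕ}

/-- Antisymmetrisation of a function of `2 l + 3` variables, three of them distinguished and the
others grouped in pairs. -/
def altTriple (H : V → V → V → (Fin l → V × V) → ℝ) (w : Fin (2 * (l + 1) + 1) → V) : ℝ :=
  altSum (fun w => H (w ⟨0, by omega⟩) (w ⟨1, by omega⟩) (w ⟨2, by omega⟩)
    fun j => (w ⟨2 * j + 3, by omega⟩, w ⟨2 * j + 4, by omega⟩)) w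

theorem altTriple_add (H H' : V → V → V → (Fin l → V × V) → ℝ) (w : Fin (2 * (l + 1) + 1) → V) :
    altTriple (fun x u v r => H x u v r + H' x u v r) w = altTriple H w + altTriple H' w :=
  altSum_add _ _ w

theorem altTriple_mul_left (c : ℝ) (H : V → V → V → (Fin l → V × V) → ℝ)
    (w : Fin (2 * (l + 1) + 1) → V) :
    altTriple (fun x u v r => c * H x u v r) w = c * altTriple H w :=
  altSum_mul_left _ _ w

theorem altTriple_sum {ι : Type*} (s : Finset ι) (H : ι → V → V → V → (Fin l → V × V) → ℝ)
    (w : Fin (2 * (l + 1) + 1) → V) :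
    altTriple (fun x u v r => ∑ i ∈ s, H i x u v r) w = ∑ i ∈ s, altTriple (H i) w :=
  altSum_sum _ _ w

theorem altTriple_swap₀₁ (H : V → V → V → (Fin l → V × V) → ℝ) (w : Fin (2 * (l + 1) + 1) → V) :
    altTriple (fun x u v r => H u x v r) w = -altTriple H w := by
  have h := altSum_comp_swap (i := (⟨0, by omega⟩ : Fin (2 * (l + 1) + 1))) (j := ⟨1, by omega⟩)
    (by simp) (fun w => H (w ⟨0, by omega⟩) (w ⟨1, by omega⟩) (w ⟨2, by omega⟩)
    fun j => (w ⟨2 * j + 3, by omega⟩, w ⟨2 * j + 4, by omega⟩)) w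
  simpa [altTriple, Equiv.swap_apply_def] using h

theorem altTriple_swap₁₂ (H : V → V → V → (Fin l → V × V) → ℝ) (w : Fin (2 * (l + 1) + 1) → V) :
    altTriple (fun x u v r => H x v u r) w = -altTriple H w := by
  have h := altSum_comp_swap (i := (⟨1, by omega⟩ : Fin (2 * (l + 1) + 1))) (j := ⟨2, by omega⟩)
    (by simp) (fun w => H (w ⟨0, by omega⟩) (w ⟨1, by omega⟩) (w ⟨2, by omega⟩)
    fun j => (w ⟨2 * j + 3, by omega⟩, w ⟨2 * j + 4, by omega⟩)) w
  simpa [altTriple, Equiv.swap_apply_def] using h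

theorem altTriple_cycle (H : V → V → V → (Fin l → V × V) → ℝ) (w : Fin (2 * (l + 1) + 1) → V) :
    altTriple (fun x u v r => H u v x r) w = altTriple H w := by
  rw [altTriple_swap₀₁ (fun x u v r => H x v u r), altTriple_swap₁₂, neg_neg]

/-- Exchanging the second and third variable with a pair is an even permutation. -/
theorem altTriple_exchange (j : Fin l) (H : V → V → V → (Fin l → V × V) → ℝ)
    (w : Fin (2 * (l + 1) + 1) → V) :
    altTriple (fun x u v r => H x (r j).1 (r j).2 (Function.update r j (u, v))) w =
      altTriple H w := by
  set π : Equiv.Perm (Fin (2 * (l + 1) + 1)) :=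
    Equiv.swap ⟨1, by omega⟩ ⟨2 * j + 3, by omega⟩ * Equiv.swap ⟨2, by omega⟩ ⟨2 * j + 4, by omega⟩
    with hπ
  have hval : ∀ m (hm : m < 2 * (l + 1) + 1), ((π ⟨m, hm⟩ : Fin _) : ℕ) =
      if m = 1 then 2 * (j : ℕ) + 3 else if m = 2 then 2 * j + 4 else
        if m = 2 * j + 3 then 1 else if m = 2 * j + 4 then 2 else m := by
    intro m hm
    simp only [hπ, Equiv.Perm.mul_apply, Equiv.swap_apply_def, Fin.ext_iff]
    split_ifs <;> simp_all
  have h := altSum_comp_perm π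
    (fun w => H (w ⟨0, by omega⟩) (w ⟨1, by omega⟩) (w ⟨2, by omega⟩)
    fun j => (w ⟨2 * j + 3, by omega⟩, w ⟨2 * j + 4, by omega⟩)) w
  rw [hπ, Equiv.Perm.sign_mul, Equiv.Perm.sign_swap (by simp), Equiv.Perm.sign_swap (by simp),
    ← hπ] at h
  simp only [mul_neg, mul_one, neg_neg, Units.val_one, Int.cast_one, one_mul] at h
  refine Eq.trans ?_ h
  refine congrArg (fun T => altSum T w) (funext fun w => ?_)
  have hw : ∀ (m m' : ℕ) (hm : m < 2 * (l + 1) + 1) (hm' : m' < 2 * (l + 1) + 1),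
      (if m = 1 then 2 * (j : ℕ) + 3 else if m = 2 then 2 * j + 4 else
        if m = 2 * j + 3 then 1 else if m = 2 * j + 4 then 2 else m) = m' →
      (w ∘ π) ⟨m, hm⟩ = w ⟨m', hm'⟩ := fun m m' hm hm' h =>
    congrArg w (Fin.ext ((hval m hm).trans h))
  rw [hw 0 0 (by omega) (by omega) (by split_ifs <;> omega),
    hw 1 (2 * j + 3) (by omega) (by omega) (by split_ifs <;> omega),
    hw 2 (2 * j + 4) (by omega) (by omega) (by split_ifs <;> omega)]
  refine congrArg (H _ _ _) (funext fun i => ?_)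
  rcases eq_or_ne i j with rfl | hij
  · rw [Function.update_self, hw (2 * i + 3) 1 (by omega) (by omega) (by split_ifs <;> omega),
      hw (2 * i + 4) 2 (by omega) (by omega) (by split_ifs <;> omega)]
  · have hne : (i : ℕ) ≠ j := fun h => hij (Fin.ext h)
    rw [Function.update_of_ne hij,
      hw (2 * i + 3) (2 * i + 3) (by omega) (by omega) (by split_ifs <;> omega),
      hw (2 * i + 4) (2 * i + 4) (by omega) (by omega) (by split_ifs <;> omega)]

/-- A term whose cyclic sum over the three distinguished variables vanishes is killed by
antisymmetrisation. -/
theorem altTriple_eq_zero_of_cyclic {H : V → V → V → (Fin l → V × V) → ℝ}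
    (hH : ∀ x u v r, H x u v r + H u v x r + H v x u r = 0) (w : Fin (2 * (l + 1) + 1) → V) :
    altTriple H w = 0 := by
  have h1 : altTriple (fun x u v r => H x u v r + H u v x r + H v x u r) w = 0 := by
    simp [hH, altTriple, altSum]
  rw [altTriple_add, altTriple_add, altTriple_cycle,
    altTriple_cycle (fun x u v r => H u v x r), altTriple_cycle] at h1
  linarith

/-- The values `F (u_j, v_j)` of a two-form on pairs. -/
def onPairs {L : Type*} (F : V → V → L) (r : Fin l → V × V) : Fin l → L :=
  fun j => F (r j).1 (r j).2

theorem onPairs_update {L : Type*} (F : V → V → L) (r : Fin l → V × V) (j : Fin l) (u v : V) :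
    onPairs F (Function.update r j (u, v)) = Function.update (onPairs F r) j (F u v) := by
  funext i
  rcases eq_or_ne i j with rfl | hij
  · simp [onPairs]
  · simp [onPairs, Function.update_of_ne hij]

end Pointwise

section InvariantIdentity

variable {e : ℕ} {G : Type*} [TopologicalSpace G] [ChartedSpace (Euc e) G] [Group G]
  {V : Type*} {l : ℕ}

/-- `f (A, B, C₁, …, C_l)`. -/
def InvPoly.eval (f : InvPoly e G (l + 2)) (A B : LieAlg e G) (C : Fin l → LieAlg e G) : ℝ :=
  f.toMulti (Fin.cons A (Fin.cons B C))

theorem InvPoly.eval_add_left (f : InvPoly e G (l + 2)) (A A' B : LieAlg e G)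
    (C : Fin l → LieAlg e G) : f.eval (A + A') B C = f.eval A B C + f.eval A' B C :=
  f.toMulti.cons_add _ _ _

theorem InvPoly.eval_smul_left (f : InvPoly e G (l + 2)) (c : ℝ) (A B : LieAlg e G)
    (C : Fin l → LieAlg e G) : f.eval (c • A) B C = c * f.eval A B C :=
  f.toMulti.cons_smul _ _ _

theorem InvPoly.eval_comm (f : InvPoly e G (l + 2)) (A B : LieAlg e G)
    (C : Fin l → LieAlg e G) : f.eval A B C = f.eval B A C := by
  rw [InvPoly.eval, ← f.symm (Equiv.swap 0 1)]
  refine congrArg f.toMulti (funext fun i => ?_)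
  refine Fin.cases ?_ (fun i => Fin.cases ?_ (fun i => ?_) i) i
  · simp
  · simp
  · have h1 : Equiv.swap (0 : Fin (l + 2)) 1 i.succ.succ = i.succ.succ :=
      Equiv.swap_apply_of_ne_of_ne (Fin.succ_ne_zero _)
        (fun h => Fin.succ_ne_zero i (Fin.succ_injective _ h))
    simp [h1]

theorem InvPoly.eval_add_right (f : InvPoly e G (l + 2)) (A B B' : LieAlg e G)
    (C : Fin l → LieAlg e G) : f.eval A (B + B') C = f.eval A B C + f.eval A B' C := by
  rw [f.eval_comm, f.eval_add_left, f.eval_comm B, f.eval_comm B']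

theorem InvPoly.eval_smul_right (f : InvPoly e G (l + 2)) (c : ℝ) (A B : LieAlg e G)
    (C : Fin l → LieAlg e G) : f.eval A (c • B) C = c * f.eval A B C := by
  rw [f.eval_comm, f.eval_smul_left, f.eval_comm B]

theorem InvPoly.eval_update (f : InvPoly e G (l + 2)) (A B : LieAlg e G)
    (C : Fin l → LieAlg e G) (j : Fin l) (Z : LieAlg e G) :
    f.eval A B (Function.update C j Z) =
      f.toMulti (Function.update (Fin.cons A (Fin.cons B C)) j.succ.succ Z) := by
  rw [InvPoly.eval, ← Fin.cons_update, ← Fin.cons_update]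

theorem InvPoly.eval_update_add (f : InvPoly e G (l + 2)) (A B : LieAlg e G)
    (C : Fin l → LieAlg e G) (j : Fin l) (Z Z' : LieAlg e G) :
    f.eval A B (Function.update C j (Z + Z')) =
      f.eval A B (Function.update C j Z) + f.eval A B (Function.update C j Z') := by
  simp only [f.eval_update]
  exact f.toMulti.map_update_add _ _ _ _

theorem InvPoly.eval_update_smul (f : InvPoly e G (l + 2)) (A B : LieAlg e G)
    (C : Fin l → LieAlg e G) (j : Fin l) (c : ℝ) (Z : LieAlg e G) :
    f.eval A B (Function.update C j (c • Z)) = c * f.eval A B (Function.update C j Z) := by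
  simp only [f.eval_update]
  exact f.toMulti.map_update_smul _ _ _ _

/-- Exchange of the second argument with a later one. -/
theorem InvPoly.eval_exchange (f : InvPoly e G (l + 2)) (A Z : LieAlg e G)
    (C : Fin l → LieAlg e G) (j : Fin l) :
    f.eval A (C j) (Function.update C j Z) = f.eval A Z C := by
  rw [InvPoly.eval, ← f.symm (Equiv.swap (Fin.succ 0) j.succ.succ)]
  refine congrArg f.toMulti (funext fun i => ?_)
  refine Fin.cases ?_ (fun i => Fin.cases ?_ (fun i => ?_) i) i
  · have h1 : Equiv.swap (Fin.succ 0 : Fin (l + 2)) j.succ.succ 0 = 0 :=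
      Equiv.swap_apply_of_ne_of_ne (Fin.succ_ne_zero _).symm (Fin.succ_ne_zero _).symm
    simp only [Function.comp_apply, h1, Fin.cons_zero]
  · simp only [Function.comp_apply, Equiv.swap_apply_left, Fin.cons_succ, Function.update_self,
      Fin.cons_zero]
  · rcases eq_or_ne i j with rfl | hij
    · simp only [Function.comp_apply, Equiv.swap_apply_right, Fin.cons_succ, Fin.cons_zero]
    · have h1 : Equiv.swap (Fin.succ 0 : Fin (l + 2)) j.succ.succ i.succ.succ = i.succ.succ :=
        Equiv.swap_apply_of_ne_of_ne
          (fun h => Fin.succ_ne_zero i (Fin.succ_injective _ h))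
          (fun h => hij (Fin.succ_injective _ (Fin.succ_injective _ h)))
      simp only [Function.comp_apply, h1, Fin.cons_succ, Function.update_of_ne hij]

/-- The variation of `f (β, F, …, F)` with `F`: all `l + 1` slots contribute equally, since
exchanging two of them exchanges two pairs of variables. -/
theorem InvPoly.altTriple_variation (f : InvPoly e G (l + 2)) (β : V → LieAlg e G)
    (F F' : V → V → LieAlg e G) (w : Fin (2 * (l + 1) + 1) → V) :
    altTriple (fun v x u r => f.eval (β v) (F' x u) (onPairs F r) +
      ∑ j, f.eval (β v) (F x u) (Function.update (onPairs F r) j (F' (r j).1 (r j).2))) w =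
    (l + 1) * altTriple (fun v x u r => f.eval (β v) (F' x u) (onPairs F r)) w := by
  have h1 : ∀ j : Fin l, altTriple (fun v x u r => f.eval (β v) (F x u)
      (Function.update (onPairs F r) j (F' (r j).1 (r j).2))) w =
      altTriple (fun v x u r => f.eval (β v) (F' x u) (onPairs F r)) w := by
    intro j
    rw [← altTriple_exchange j]
    congr 1
    funext v x u r
    simp only [onPairs_update, Function.update_idem, Function.update_self]
    exact f.eval_exchange _ _ (onPairs F r) j
  rw [altTriple_add, altTriple_sum, Finset.sum_congr rfl fun j _ => h1 j]
  simp
  ring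

/-- A two-form that is an antisymmetrised `Ψ` may be replaced by `Ψ` under `altTriple`. -/
theorem InvPoly.altTriple_antisymm (f : InvPoly e G (l + 2)) (β : V → LieAlg e G)
    (F Ψ : V → V → LieAlg e G) (c : ℝ) (w : Fin (2 * (l + 1) + 1) → V) :
    altTriple (fun v x u r => f.eval (β v) (c • (Ψ x u - Ψ u x)) (onPairs F r)) w =
      2 * c * altTriple (fun v x u r => f.eval (β v) (Ψ x u) (onPairs F r)) w := by
  have h1 : (fun (v x u : V) (r : Fin l → V × V) =>
      f.eval (β v) (c • (Ψ x u - Ψ u x)) (onPairs F r)) = fun v x u r =>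
      c * f.eval (β v) (Ψ x u) (onPairs F r) + (-c) * f.eval (β v) (Ψ u x) (onPairs F r) := by
    funext v x u r
    rw [f.eval_smul_right, sub_eq_add_neg, f.eval_add_right, ← neg_one_smul ℝ, f.eval_smul_right]
    ring
  rw [h1, altTriple_add, altTriple_mul_left, altTriple_mul_left,
    altTriple_swap₁₂ (fun v x u r => f.eval (β v) (Ψ x u) (onPairs F r))]
  ring

/-- Cyclic relabelling of the variables, after which the one-form `β` comes second. -/
theorem InvPoly.altTriple_rotate (f : InvPoly e G (l + 2)) (β : V → LieAlg e G)
    (F Ψ : V → V → LieAlg e G) (w : Fin (2 * (l + 1) + 1) → V) :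
    altTriple (fun v x u r => f.eval (β v) (Ψ x u) (onPairs F r)) w =
      altTriple (fun x u v r => f.eval (Ψ x u) (β v) (onPairs F r)) w := by
  rw [← altTriple_cycle (fun v x u r => f.eval (β v) (Ψ x u) (onPairs F r)), ← altTriple_cycle]
  congr 1
  funext x u v r
  exact f.eval_comm _ _ _

variable [LieGroup (𝓡 e) ∞ G]

/-- Infinitesimal invariance of `f`, with the first two arguments singled out. -/
theorem InvPoly.eval_invariant (f : InvPoly e G (l + 2)) (X A B : LieAlg e G)
    (C : Fin l → LieAlg e G) :
    f.eval (lieBracket G X A) B C + f.eval A (lieBracket G X B) C +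
      ∑ j, f.eval A B (Function.update C j (lieBracket G X (C j))) = 0 := by
  have h := f.sum_update_lieBracket X (Fin.cons A (Fin.cons B C))
  rw [Fin.sum_univ_succ, Fin.sum_univ_succ] at h
  simp only [← Fin.cons_update, Fin.update_cons_zero, Fin.cons_zero, Fin.cons_succ] at h
  rw [← add_assoc] at h
  exact h

/-- The exterior derivative of `f (α, a, F, …, F)`, after the Bianchi identity and the invariance
of `f`. -/
theorem InvPoly.altTriple_derivative (f : InvPoly e G (l + 2)) {a α : V → LieAlg e G}
    {Da Dα F : V → V → LieAlg e G} {DF : V → V → V → LieAlg e G} {s : ℝ}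
    (hB : ∀ x u v, DF x u v + DF u v x + DF v x u =
      -(s • (lieBracket G (a x) (F u v) + lieBracket G (a u) (F v x) + lieBracket G (a v) (F x u))))
    (w : Fin (2 * (l + 1) + 1) → V) :
    altTriple (fun x u v r => f.eval (Dα x u) (a v) (onPairs F r) +
      f.eval (α u) (Da x v) (onPairs F r) +
      ∑ j, f.eval (α u) (a v) (Function.update (onPairs F r) j (DF x (r j).1 (r j).2))) w =
    altTriple (fun x u v r =>
      f.eval (Dα x u + s • lieBracket G (a x) (α u)) (a v) (onPairs F r)) w +
    altTriple (fun x u v r =>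
      f.eval (α u) (Da x v + s • lieBracket G (a x) (a v)) (onPairs F r)) w := by
  -- by the Bianchi identity the covariant derivative of `F` has vanishing cyclic sum
  have h1 : ∀ j : Fin l, altTriple (fun x u v r => f.eval (α u) (a v)
      (Function.update (onPairs F r) j
        (DF x (r j).1 (r j).2 + s • lieBracket G (a x) (F (r j).1 (r j).2)))) w = 0 := by
    intro j
    rw [← altTriple_exchange j]
    refine altTriple_eq_zero_of_cyclic (fun x u v r => ?_) w
    simp only [onPairs_update, Function.update_idem, Function.update_self]
    rw [← f.eval_update_add, ← f.eval_update_add]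
    have h2 : DF x u v + s • lieBracket G (a x) (F u v) +
        (DF u v x + s • lieBracket G (a u) (F v x)) +
        (DF v x u + s • lieBracket G (a v) (F x u)) = 0 := by
      have := hB x u v
      rw [← sub_eq_zero] at this
      rw [← this]
      module
    rw [h2, ← zero_smul ℝ (0 : LieAlg e G), f.eval_update_smul, zero_mul]
  have h3 : altTriple (fun x u v r => ∑ j, f.eval (α u) (a v) (Function.update (onPairs F r) j
        (DF x (r j).1 (r j).2 + s • lieBracket G (a x) (F (r j).1 (r j).2)))) w = 0 := by
    rw [altTriple_sum]
    exact Finset.sum_eq_zero fun j _ => h1 j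
  rw [← altTriple_add]
  refine Eq.trans ?_ (add_zero _)
  rw [← h3, ← altTriple_add]
  congr 1
  funext x u v r
  -- invariance moves the brackets with `a x` from the copies of `F` to `α` and `a`
  have h4 := f.eval_invariant (a x) (α u) (a v) (onPairs F r)
  simp only [f.eval_add_left, f.eval_add_right, f.eval_smul_left, f.eval_smul_right,
    f.eval_update_add, f.eval_update_smul, Finset.sum_add_distrib, ← Finset.mul_sum]
  simp only [onPairs] at h4 ⊢
  linear_combination (-s) * h4

end InvariantIdentity

/-! ### Smooth families of Lie-algebra-valued forms -/

section OneForms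

variable {e n : ℕ}

/-- The value of a one-form on a vector, as a linear map. -/
def toOneForm (n e : ℕ) : (Euc n [⋀^Fin 1]→L[ℝ] Euc e) →L[ℝ] (Euc n →L[ℝ] Euc e) :=
  ((ContinuousAlternatingMap.ofSubsingletonLIE (0 : Fin 1)).symm :
    (Euc n [⋀^Fin 1]→L[ℝ] Euc e) ≃ₗᵢ[ℝ] (Euc n →L[ℝ] Euc e)).toContinuousLinearEquiv

theorem toOneForm_apply (η : Euc n [⋀^Fin 1]→L[ℝ] Euc e) (v : Euc n) :
    toOneForm n e η v = η ![v] := by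
  refine congrArg η (funext fun i => ?_)
  obtain rfl := Subsingleton.elim i 0
  rfl

theorem extDeriv_one_apply {η : Euc n → Euc n [⋀^Fin 1]→L[ℝ] Euc e} {y : Euc n}
    (hη : DifferentiableAt ℝ η y) (u v : Euc n) :
    extDeriv η y ![u, v] = fderiv ℝ (fun y => toOneForm n e (η y)) y u v -
      fderiv ℝ (fun y => toOneForm n e (η y)) y v u := by
  have h1 : ∀ u v : Euc n, fderiv ℝ (fun y => η y ![v]) y u =
      fderiv ℝ (fun y => toOneForm n e (η y)) y u v := by
    intro u v
    have h2 : HasFDerivAt (fun y => toOneForm n e (η y)) _ y :=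
      (toOneForm n e).hasFDerivAt.comp y hη.hasFDerivAt
    have h3 := h2.clm_apply (hasFDerivAt_const v y)
    have h4 : (fun y => toOneForm n e (η y) v) = fun y => η y ![v] :=
      funext fun y => toOneForm_apply _ _
    rw [h2.fderiv, ← h4, h3.fderiv]
    simp
  rw [extDeriv_apply hη, Fin.sum_univ_two, ← h1, ← h1]
  have h5 : (0 : Fin 2).removeNth ![u, v] = ![v] := by
    funext i; obtain rfl := Subsingleton.elim i 0; rfl
  have h6 : (1 : Fin 2).removeNth ![u, v] = ![u] := by
    funext i; obtain rfl := Subsingleton.elim i 0; rfl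
  simp [h5, h6, sub_eq_add_neg]

end OneForms

section SmoothFamilies

variable {e n : ℕ} {G : Type*} [TopologicalSpace G] [ChartedSpace (Euc e) G] [Group G]
  {X : Type*} [NormedAddCommGroup X] [NormedSpace ℝ X] {s : Set X}

theorem contDiffOn_multilinear_comp {k : ℕ}
    (f : ContinuousMultilinearMap ℝ (fun _ : Fin k => Euc e) ℝ) {v : X → Fin k → Euc e}
    (hv : ∀ i, ContDiffOn ℝ ∞ (fun x => v x i) s) : ContDiffOn ℝ ∞ (fun x => f (v x)) s :=
  f.contDiff.comp_contDiffOn (contDiffOn_pi.2 hv)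

theorem contDiffOn_altSum {V : Type*} {N : ℕ} {T : X → (Fin N → V) → ℝ}
    (hT : ∀ w, ContDiffOn ℝ ∞ (fun x => T x w) s) (w : Fin N → V) :
    ContDiffOn ℝ ∞ (fun x => altSum (T x) w) s :=
  ContDiffOn.sum fun _ _ => contDiffOn_const.mul (hT _)

theorem contDiffOn_oneTwo {k : ℕ} (f : InvPoly e G (k + 1))
    {α : X → Euc n [⋀^Fin 1]→L[ℝ] LieAlg e G} {β : X → Euc n [⋀^Fin 2]→L[ℝ] LieAlg e G}
    (hα : ContDiffOn ℝ ∞ α s) (hβ : ContDiffOn ℝ ∞ β s) :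
    ContDiffOn ℝ ∞ (fun x => f.oneTwo (α x) (β x)) s := by
  rw [contDiffOn_continuousAlternatingMap_iff] at hα hβ ⊢
  intro w
  simp only [InvPoly.oneTwo_apply]
  refine contDiffOn_const.mul (contDiffOn_altSum (fun w => contDiffOn_multilinear_comp _
    fun i => ?_) w)
  refine Fin.cases ?_ (fun i => ?_) i
  · exact hα _
  · exact hβ _

theorem contDiffOn_oneOneTwo {l : ℕ} (f : InvPoly e G (l + 2))
    {α α' : X → Euc n [⋀^Fin 1]→L[ℝ] LieAlg e G} {β : X → Fin l → Euc n [⋀^Fin 2]→L[ℝ] LieAlg e G}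
    (hα : ContDiffOn ℝ ∞ α s) (hα' : ContDiffOn ℝ ∞ α' s)
    (hβ : ∀ i, ContDiffOn ℝ ∞ (fun x => β x i) s) :
    ContDiffOn ℝ ∞ (fun x => f.oneOneTwo (α x) (α' x) (β x)) s := by
  simp only [contDiffOn_continuousAlternatingMap_iff] at hα hα' hβ ⊢
  intro w
  simp only [InvPoly.oneOneTwo_apply]
  refine contDiffOn_const.mul (contDiffOn_altSum (fun w => contDiffOn_multilinear_comp _
    fun i => ?_) w)
  refine Fin.cases ?_ (fun i => Fin.cases ?_ (fun i => ?_) i) i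
  · exact hα _
  · exact hα' _
  · exact hβ i _

variable [LieGroup (𝓡 e) ∞ G]

theorem contDiffOn_formBracket {α α' : X → Euc n [⋀^Fin 1]→L[ℝ] LieAlg e G}
    (hα : ContDiffOn ℝ ∞ α s) (hα' : ContDiffOn ℝ ∞ α' s) :
    ContDiffOn ℝ ∞ (fun x => formBracket G (α x) (α' x)) s := by
  simp only [contDiffOn_continuousAlternatingMap_iff] at hα hα' ⊢
  intro w
  have hw : w = ![w 0, w 1] := by funext i; fin_cases i <;> rfl
  rw [hw]
  simp only [formBracket_apply, ← bracketCLM_apply]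
  exact ((contDiffOn_const.clm_apply (hα _)).clm_apply (hα' _)).sub
    ((contDiffOn_const.clm_apply (hα _)).clm_apply (hα' _))

end SmoothFamilies

section TimeDependent

variable {e n : ℕ} {V : Set (Euc n)} {a : ℝ → Euc n → Euc n [⋀^Fin 1]→L[ℝ] Euc e}

/-- The spatial exterior derivative of a smooth time-dependent one-form is jointly smooth. -/
theorem contDiffOn_extDeriv_family (hV : IsOpen V)
    (ha : ContDiffOn ℝ ∞ (fun z : Euc n × ℝ => a z.2 z.1) (V ×ˢ univ)) :
    ContDiffOn ℝ ∞ (fun z : Euc n × ℝ => extDeriv (a z.2) z.1) (V ×ˢ univ) := by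
  have h1 : ContDiffOn ℝ ∞ (fun z : Euc n × ℝ => toOneForm n e (a z.2 z.1)) (V ×ˢ univ) :=
    (toOneForm n e).contDiff.comp_contDiffOn ha
  have h2 := contDiffOn_partial_fderiv hV h1
  rw [contDiffOn_continuousAlternatingMap_iff]
  intro w
  have hw : w = ![w 0, w 1] := by funext i; fin_cases i <;> rfl
  rw [hw]
  have h0 : ∀ u v : Euc n, ContDiffOn ℝ ∞ (fun z : Euc n × ℝ =>
      (fderiv ℝ (fun z : Euc n × ℝ => toOneForm n e (a z.2 z.1)) z).comp (.inl ℝ (Euc n) ℝ) u v)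
      (V ×ˢ univ) := fun u v =>
    (h2.clm_apply (contDiffOn_const (c := u))).clm_apply (contDiffOn_const (c := v))
  refine ((h0 (w 0) (w 1)).sub (h0 (w 1) (w 0))).congr fun z hz => ?_
  have h3 := hasFDerivAt_fst_of_contDiffOn hV ha hz.1 z.2
  have h4 := hasFDerivAt_fst_of_contDiffOn hV h1 hz.1 z.2
  rw [extDeriv_one_apply h3.differentiableAt, h4.fderiv]

theorem contDiffOn_deriv_family {F : Type*} [NormedAddCommGroup F] [NormedSpace ℝ F]
    {b : ℝ → Euc n → F} (hV : IsOpen V)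
    (hb : ContDiffOn ℝ ∞ (fun z : Euc n × ℝ => b z.2 z.1) (V ×ˢ univ)) :
    ContDiffOn ℝ ∞ (fun z : Euc n × ℝ => deriv (fun t => b t z.1) z.2) (V ×ˢ univ) := by
  have hO := hV.prod (isOpen_univ (X := ℝ))
  refine ((hb.fderiv_of_isOpen (m := ∞) hO (by simp)).clm_apply
    (contDiffOn_const (c := ((0 : Euc n), (1 : ℝ))))).congr fun z hz => ?_
  have h1 := ((hb z hz).contDiffAt (hO.mem_nhds hz)).differentiableAt (by simp) |>.hasFDerivAt
  have h2 : HasFDerivAt (fun t => (fun z : Euc n × ℝ => b z.2 z.1) (z.1, t)) _ z.2 :=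
    HasFDerivAt.comp (g := fun z : Euc n × ℝ => b z.2 z.1) z.2 h1 (hasFDerivAt_prodMk_right z.1 z.2)
  rw [h2.hasDerivAt.deriv]
  simp

end TimeDependent

section EvalDerivative

variable {e : ℕ} {G : Type*} [TopologicalSpace G] [ChartedSpace (Euc e) G] [Group G] {l : ℕ}

theorem InvPoly.hasDerivAt_eval (f : InvPoly e G (l + 2)) {A B : ℝ → LieAlg e G}
    {C : ℝ → Fin l → LieAlg e G} {A' B' : LieAlg e G} {C' : Fin l → LieAlg e G}
    {t : ℝ} (hA : HasDerivAt A A' t) (hB : HasDerivAt B B' t)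
    (hC : ∀ j, HasDerivAt (fun t => C t j) (C' j) t) :
    HasDerivAt (fun t => f.eval (A t) (B t) (C t)) (f.eval A' (B t) (C t) + f.eval (A t) B' (C t) +
        ∑ j, f.eval (A t) (B t) (Function.update (C t) j (C' j))) t := by
  have h := (HasFDerivAt.multilinear_comp f.toMulti (x := t)
    (g := fun i t => (Fin.cons (A t) (Fin.cons (B t) (C t)) : Fin (l + 2) → LieAlg e G) i)
    (g' := fun i => ContinuousLinearMap.toSpanSingleton ℝ
      ((Fin.cons A' (Fin.cons B' C') : Fin (l + 2) → LieAlg e G) i))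
    (fun i => Fin.cases hA.hasFDerivAt (fun i => Fin.cases hB.hasFDerivAt
      (fun j => (hC j).hasFDerivAt) i) i)).hasDerivAt
  -- the `i`-th term of the Leibniz rule replaces the `i`-th argument by its derivative
  have h2 : ∀ g' : Fin (l + 2) → ℝ →L[ℝ] LieAlg e G, (∑ i, (f.toMulti.toContinuousLinearMap
      (fun j => (Fin.cons (A t) (Fin.cons (B t) (C t)) : Fin (l + 2) → LieAlg e G) j) i).comp
        (g' i)) 1 = ∑ i, f.toMulti (Function.update
      (Fin.cons (A t) (Fin.cons (B t) (C t)) : Fin (l + 2) → LieAlg e G) i (g' i 1)) := by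
    intro g'
    simp [ContinuousMultilinearMap.toContinuousLinearMap]
  rw [h2, Fin.sum_univ_succ, Fin.sum_univ_succ, ← add_assoc] at h
  simp only [Fin.cons_zero, Fin.cons_succ, ← Fin.cons_update, Fin.update_cons_zero,
    ContinuousLinearMap.toSpanSingleton_apply, one_smul] at h
  exact h

theorem hasDerivAt_altSum {V : Type*} {N : ℕ} {T : ℝ → (Fin N → V) → ℝ} {T' : (Fin N → V) → ℝ}
    {t : ℝ} (hT : ∀ w, HasDerivAt (fun t => T t w) (T' w) t) (w : Fin N → V) :
    HasDerivAt (fun t => altSum (T t) w) (altSum T' w) t :=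
  HasDerivAt.fun_sum fun _ _ => (hT _).const_mul _

end EvalDerivative

/-! ### The transgression formula -/

section FamilyMap

variable {e n : ℕ} {V : Set (Euc n)} {a : ℝ → Euc n → Euc n [⋀^Fin 1]→L[ℝ] Euc e}

/-- The family of one-forms `a`, as a function on `ℝⁿ × ℝ` with values in linear maps. -/
def familyMap (a : ℝ → Euc n → Euc n [⋀^Fin 1]→L[ℝ] Euc e) (z : Euc n × ℝ) :
    Euc n →L[ℝ] Euc e :=
  toOneForm n e (a z.2 z.1)

theorem contDiffAt_familyMap (hV : IsOpen V)
    (ha : ContDiffOn ℝ ∞ (fun z : Euc n × ℝ => a z.2 z.1) (V ×ˢ univ)) {y : Euc n} (hy : y ∈ V)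
    (θ : ℝ) : ContDiffAt ℝ ∞ (familyMap a) (y, θ) :=
  (toOneForm n e).contDiff.contDiffAt.comp (y, θ) ((ha (y, θ) ⟨hy, mem_univ _⟩).contDiffAt
    ((hV.prod isOpen_univ).mem_nhds ⟨hy, mem_univ _⟩))

theorem familyMap_apply (y : Euc n) (θ : ℝ) (v : Euc n) : familyMap a (y, θ) v = a θ y ![v] :=
  toOneForm_apply _ _

theorem deriv_family_apply (hV : IsOpen V)
    (ha : ContDiffOn ℝ ∞ (fun z : Euc n × ℝ => a z.2 z.1) (V ×ˢ univ)) {y : Euc n} (hy : y ∈ V)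
    (θ : ℝ) (v : Euc n) :
    deriv (fun t => a t y) θ ![v] = fderiv ℝ (familyMap a) (y, θ) (0, 1) v := by
  have h1 : DifferentiableAt ℝ (fun t => a t y) θ :=
    DifferentiableAt.comp (g := fun z : Euc n × ℝ => a z.2 z.1) (f := fun t : ℝ => (y, t)) θ
      (((ha (y, θ) ⟨hy, mem_univ _⟩).contDiffAt
        ((hV.prod isOpen_univ).mem_nhds ⟨hy, mem_univ _⟩)).differentiableAt (by simp))
      (by fun_prop)
  have h2 := (toOneForm n e).hasFDerivAt.comp_hasDerivAt θ h1.hasDerivAt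
  have h3 : HasDerivAt (fun t => familyMap a (y, t)) (fderiv ℝ (familyMap a) (y, θ) (0, 1)) θ :=
    ((contDiffAt_familyMap hV ha hy θ).differentiableAt (by simp)).hasFDerivAt.comp_hasDerivAt θ
      ((hasDerivAt_const θ y).prodMk (hasDerivAt_id θ))
  rw [← toOneForm_apply, ← h3.unique h2]

end FamilyMap

section Transgression

variable {e n : ℕ} {G : Type*} [TopologicalSpace G] [ChartedSpace (Euc e) G] [Group G]

/-- `f (α, β, …, β)` with the first copy of `β` singled out. -/
theorem InvPoly.oneTwo_eq_altTriple {V : Type*} [AddCommGroup V] [Module ℝ V] [TopologicalSpace V]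
    {l : ℕ} (f : InvPoly e G (l + 2)) (α : V [⋀^Fin 1]→L[ℝ] LieAlg e G)
    (β : V [⋀^Fin 2]→L[ℝ] LieAlg e G) (w : Fin (2 * (l + 1) + 1) → V) :
    InvPoly.oneTwo (k := l + 1) f α β w = (1 / 2) ^ (l + 1) * altTriple (fun v x u r =>
      f.eval (α ![v]) (β ![x, u]) (onPairs (fun u v => β ![u, v]) r)) w := by
  rw [InvPoly.oneTwo_apply, altTriple]
  congr 2
  funext w
  refine congrArg f.toMulti (funext fun i => ?_)
  refine Fin.cases ?_ (fun i => Fin.cases ?_ (fun i => ?_) i) i <;> rfl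

variable [LieGroup (𝓡 e) ∞ G]

/-- The curvature `s da + s²/2 [a, a]` of the rescaled connection form `s a`. -/
def scaledCurv (a : ℝ → Euc n → Euc n [⋀^Fin 1]→L[ℝ] LieAlg e G) (s θ : ℝ) (y : Euc n) :
    Euc n [⋀^Fin 2]→L[ℝ] LieAlg e G :=
  s • extDeriv (a θ) y + (s ^ 2 / 2) • formBracket G (a θ y) (a θ y)

theorem contDiffOn_scaledCurv {V : Set (Euc n)}
    {a : ℝ → Euc n → Euc n [⋀^Fin 1]→L[ℝ] LieAlg e G} (hV : IsOpen V)
    (ha : ContDiffOn ℝ ∞ (fun z : Euc n × ℝ => a z.2 z.1) (V ×ˢ univ)) (s : ℝ) :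
    ContDiffOn ℝ ∞ (fun z : Euc n × ℝ => scaledCurv a s z.2 z.1) (V ×ˢ univ) :=
  ((contDiffOn_extDeriv_family hV ha).const_smul s).add
    ((contDiffOn_formBracket ha ha).const_smul (s ^ 2 / 2))

/-- The value on two vectors of the curvature of the rescaled family of one-forms `s A`. -/
def scaledCurvVal (G : Type*) [TopologicalSpace G] [ChartedSpace (Euc e) G] [Group G]
    [LieGroup (𝓡 e) ∞ G] (A : Euc n × ℝ → Euc n →L[ℝ] LieAlg e G) (s : ℝ) (z : Euc n × ℝ)
    (u v : Euc n) : LieAlg e G :=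
  s • (fderiv ℝ A z (u, 0) v - fderiv ℝ A z (v, 0) u) + s ^ 2 • bracketCLM G (A z u) (A z v)

theorem bracketCLM_antisymm (X Y : LieAlg e G) : bracketCLM G X Y = -bracketCLM G Y X :=
  (lie_skew (L := GroupLieAlgebra (𝓡 e) G) X Y).symm

theorem bracketCLM_jacobi (X Y Z : LieAlg e G) :
    bracketCLM G X (bracketCLM G Y Z) + bracketCLM G Y (bracketCLM G Z X) +
      bracketCLM G Z (bracketCLM G X Y) = 0 :=
  lie_jacobi (L := GroupLieAlgebra (𝓡 e) G) X Y Z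

section Values

variable {A : Euc n × ℝ → Euc n →L[ℝ] LieAlg e G} {z : Euc n × ℝ}

/-- The derivative of the curvature along a curve `c` in `ℝⁿ × ℝ`. -/
theorem hasDerivAt_scaledCurvVal (hA : ContDiffAt ℝ ∞ A z) (s : ℝ) (u v : Euc n)
    {c : ℝ → Euc n × ℝ} {ζ : Euc n × ℝ} {t : ℝ} (hc : HasDerivAt c ζ t) (hct : c t = z) :
    HasDerivAt (fun t => scaledCurvVal G A s (c t) u v)
      (s • (fderiv ℝ (fderiv ℝ A) z ζ (u, 0) v - fderiv ℝ (fderiv ℝ A) z ζ (v, 0) u) +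
        s ^ 2 • (bracketCLM G (fderiv ℝ A z ζ u) (A z v) + bracketCLM G (A z u) (fderiv ℝ A z ζ v)))
      t := by
  subst hct
  have h1 : HasDerivAt (fun t => A (c t)) (fderiv ℝ A (c t) ζ) t :=
    (hA.differentiableAt (by simp)).hasFDerivAt.comp_hasDerivAt t hc
  have h2 : HasDerivAt (fun t => fderiv ℝ A (c t)) (fderiv ℝ (fderiv ℝ A) (c t) ζ) t :=
    ((hA.fderiv_right (m := ∞) (by simp)).differentiableAt (by simp)).hasFDerivAt.comp_hasDerivAt
      t hc
  have h3 : ∀ ζ' v, HasDerivAt (fun t => fderiv ℝ A (c t) ζ' v)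
      (fderiv ℝ (fderiv ℝ A) (c t) ζ ζ' v) t := by
    intro ζ' v
    have := (h2.clm_apply (hasDerivAt_const t ζ')).clm_apply (hasDerivAt_const t v)
    simpa using this
  have h4 : ∀ v, HasDerivAt (fun t => A (c t) v) (fderiv ℝ A (c t) ζ v) t := by
    intro v
    simpa using h1.clm_apply (hasDerivAt_const t v)
  have h5 := (((hasDerivAt_const t (bracketCLM G)).clm_apply (h4 u)).clm_apply (h4 v))
  have h6 := (((h3 (u, 0) v).sub (h3 (v, 0) u)).const_smul s).add (h5.const_smul (s ^ 2))
  refine h6.congr_deriv ?_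
  simp

/-- The Bianchi identity for the rescaled connection forms. -/
theorem scaledCurvVal_bianchi (hA : ContDiffAt ℝ ∞ A z) (s : ℝ)
    {DF : Euc n → Euc n → Euc n → LieAlg e G}
    (hDF : ∀ x u v, DF x u v =
      s • (fderiv ℝ (fderiv ℝ A) z (x, 0) (u, 0) v - fderiv ℝ (fderiv ℝ A) z (x, 0) (v, 0) u) +
        s ^ 2 • (bracketCLM G (fderiv ℝ A z (x, 0) u) (A z v) +
          bracketCLM G (A z u) (fderiv ℝ A z (x, 0) v))) (x u v : Euc n) :
    DF x u v + DF u v x + DF v x u = -(s • (lieBracket G (A z x) (scaledCurvVal G A s z u v) +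
      lieBracket G (A z u) (scaledCurvVal G A s z v x) +
      lieBracket G (A z v) (scaledCurvVal G A s z x u))) := by
  have hsymm : ∀ v w, fderiv ℝ (fderiv ℝ A) z v w = fderiv ℝ (fderiv ℝ A) z w v := fun v w =>
    (hA.isSymmSndFDerivAt (by
      rw [minSmoothness_of_isRCLikeNormedField]; exact ENat.LEInfty.out)) v w
  -- second derivatives cancel by symmetry, the quadratic terms cancel in pairs, and the cubic ones
  -- are the Jacobi identity
  have hj := bracketCLM_jacobi (A z x) (A z u) (A z v)
  simp only [← bracketCLM_apply, hDF, scaledCurvVal, map_add, map_smul, map_sub]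
  rw [hsymm (u, 0) (x, 0), hsymm (v, 0) (x, 0), hsymm (v, 0) (u, 0),
    bracketCLM_antisymm (fderiv ℝ A z (x, 0) u), bracketCLM_antisymm (fderiv ℝ A z (u, 0) v),
    bracketCLM_antisymm (fderiv ℝ A z (v, 0) x)]
  linear_combination (norm := module) (s ^ 3) • hj

end Values

section Family

variable {V : Set (Euc n)} {a : ℝ → Euc n → Euc n [⋀^Fin 1]→L[ℝ] LieAlg e G}

theorem scaledCurv_apply (hV : IsOpen V)
    (ha : ContDiffOn ℝ ∞ (fun z : Euc n × ℝ => a z.2 z.1) (V ×ˢ univ)) {y : Euc n} (hy : y ∈ V)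
    (s θ : ℝ) (u v : Euc n) :
    scaledCurv a s θ y ![u, v] = scaledCurvVal G (familyMap a) s (y, θ) u v := by
  have h1 := hasFDerivAt_fst_of_contDiffOn hV ha hy θ
  have h2 : HasFDerivAt (fun y => familyMap a (y, θ)) _ y := HasFDerivAt.comp (g := familyMap a) y
    ((contDiffAt_familyMap hV ha hy θ).differentiableAt (by simp)).hasFDerivAt
    (hasFDerivAt_prodMk_left y θ)
  have h3 := extDeriv_one_apply (e := e) h1.differentiableAt u v
  have h4 : (fun y => toOneForm n e (a θ y)) = fun y => familyMap a (y, θ) := rfl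
  rw [h4, h2.fderiv] at h3
  simp only [scaledCurv, scaledCurvVal, ContinuousAlternatingMap.add_apply,
    ContinuousAlternatingMap.smul_apply, formBracket_apply, familyMap_apply, ← bracketCLM_apply]
  rw [h3, bracketCLM_antisymm (a θ y ![v])]
  simp only [ContinuousLinearMap.comp_apply, ContinuousLinearMap.inl_apply]
  module

variable {l : ℕ}

/-- The exterior derivative of a form given by antisymmetrisation. -/
theorem extDeriv_apply_of_altSum {N : ℕ} {η : Euc n → Euc n [⋀^Fin N]→L[ℝ] ℝ}
    {T : Euc n → (Fin N → Euc n) → ℝ} {T' : Euc n → (Fin N → Euc n) → ℝ} {c : ℝ} {y : Euc n}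
    (hη : DifferentiableAt ℝ η y) (hT : ∀ᶠ z in 𝓝 y, ∀ w, η z w = c * altSum (T z) w)
    (hT' : ∀ x w, HasDerivAt (fun t : ℝ => T (y + t • x) w) (T' x w) 0)
    (w : Fin (N + 1) → Euc n) :
    extDeriv η y w = c * altSum (fun w => T' (w 0) (Fin.tail w)) w := by
  rw [extDeriv_apply hη, altSum_succ, Finset.mul_sum]
  refine Finset.sum_congr rfl fun i _ => ?_
  have h1 : HasDerivAt (fun t : ℝ => y + t • w i) (w i) 0 := by
    simpa using ((hasDerivAt_id (0 : ℝ)).smul_const (w i)).const_add y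
  have h2 : HasFDerivAt (fun z => η z (i.removeNth w))
      (fderiv ℝ (fun z => η z (i.removeNth w)) y) (y + (0 : ℝ) • w i) := by
    rw [zero_smul, add_zero]
    exact ((ContinuousAlternatingMap.apply ℝ (Euc n) ℝ (i.removeNth w)).differentiableAt.comp y
      hη).hasFDerivAt
  have h3 := h2.comp_hasDerivAt (0 : ℝ) h1
  have h4 : HasDerivAt (fun t : ℝ => c * altSum (T (y + t • w i)) (i.removeNth w))
      (c * altSum (T' (w i)) (i.removeNth w)) 0 := (hasDerivAt_altSum (hT' (w i)) _).const_mul c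
  have h5 : Filter.Tendsto (fun t : ℝ => y + t • w i) (𝓝 0) (𝓝 y) := by
    have := h1.continuousAt
    rwa [ContinuousAt, zero_smul, add_zero] at this
  have h6 := h3.unique (h4.congr_of_eventuallyEq ((h5.eventually hT).mono fun t ht => ht _))
  rw [h6]
  simp only [Fin.cons_zero, Fin.tail_cons]
  ring

/-- The exterior derivative of `f (∂a, a, F_s, …, F_s)`: the sum of the terms in which `∂a` and `a`
are replaced by their covariant derivatives with respect to `s a`. -/
theorem InvPoly.extDeriv_oneOneTwo (f : InvPoly e G (l + 2)) (hV : IsOpen V)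
    (ha : ContDiffOn ℝ ∞ (fun z : Euc n × ℝ => a z.2 z.1) (V ×ˢ univ)) {y : Euc n} (hy : y ∈ V)
    (s θ : ℝ) (w : Fin (2 * (l + 1) + 1) → Euc n) :
    extDeriv (fun y => f.oneOneTwo (deriv (fun t => a t y) θ) (a θ y)
      (fun _ => scaledCurv a s θ y)) y w = (1 / 2) ^ l * (
    altTriple (fun x u v r => f.eval (fderiv ℝ (fderiv ℝ (familyMap a)) (y, θ) (x, 0) (0, 1) u +
        s • lieBracket G (familyMap a (y, θ) x) (fderiv ℝ (familyMap a) (y, θ) (0, 1) u))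
      (familyMap a (y, θ) v) (onPairs (scaledCurvVal G (familyMap a) s (y, θ)) r)) w +
    altTriple (fun x u v r => f.eval (fderiv ℝ (familyMap a) (y, θ) (0, 1) u)
      (fderiv ℝ (familyMap a) (y, θ) (x, 0) v +
        s • lieBracket G (familyMap a (y, θ) x) (familyMap a (y, θ) v))
      (onPairs (scaledCurvVal G (familyMap a) s (y, θ)) r)) w) := by
  have hA := contDiffAt_familyMap hV ha hy θ
  set A := familyMap a with hAdef
  set z : Euc n × ℝ := (y, θ) with hz
  have hη := hasFDerivAt_fst_of_contDiffOn hV (contDiffOn_oneOneTwo f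
    (contDiffOn_deriv_family hV ha) ha
    (fun _ : Fin l => contDiffOn_scaledCurv hV ha s)) hy θ
  -- `T` is the integrand of the antisymmetrisation, `T'` its derivative in the direction `x`
  rw [extDeriv_apply_of_altSum (c := (1 / 2) ^ l)
    (T := fun y w =>
      f.eval (fderiv ℝ A (y, θ) (0, 1) (w ⟨0, by omega⟩)) (A (y, θ) (w ⟨1, by omega⟩))
        (fun i : Fin l => scaledCurvVal G A s (y, θ) (w ⟨2 * i + 2, by omega⟩)
          (w ⟨2 * i + 3, by omega⟩)))
    (T' := fun x w =>
      f.eval (fderiv ℝ (fderiv ℝ A) z (x, 0) (0, 1) (w ⟨0, by omega⟩)) (A z (w ⟨1, by omega⟩))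
        (fun i : Fin l => scaledCurvVal G A s z (w ⟨2 * i + 2, by omega⟩)
          (w ⟨2 * i + 3, by omega⟩)) +
      f.eval (fderiv ℝ A z (0, 1) (w ⟨0, by omega⟩)) (fderiv ℝ A z (x, 0) (w ⟨1, by omega⟩))
        (fun i : Fin l => scaledCurvVal G A s z (w ⟨2 * i + 2, by omega⟩)
          (w ⟨2 * i + 3, by omega⟩)) +
      ∑ j : Fin l, f.eval (fderiv ℝ A z (0, 1) (w ⟨0, by omega⟩)) (A z (w ⟨1, by omega⟩))
        (Function.update (fun i : Fin l =>
          scaledCurvVal G A s z (w ⟨2 * i + 2, by omega⟩) (w ⟨2 * i + 3, by omega⟩)) j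
        (s • (fderiv ℝ (fderiv ℝ A) z (x, 0) (w ⟨2 * j + 2, by omega⟩, 0)
              (w ⟨2 * j + 3, by omega⟩) -
            fderiv ℝ (fderiv ℝ A) z (x, 0) (w ⟨2 * j + 3, by omega⟩, 0) (w ⟨2 * j + 2, by omega⟩)) +
          s ^ 2 • (bracketCLM G (fderiv ℝ A z (x, 0) (w ⟨2 * j + 2, by omega⟩))
              (A z (w ⟨2 * j + 3, by omega⟩)) +
            bracketCLM G (A z (w ⟨2 * j + 2, by omega⟩))
              (fderiv ℝ A z (x, 0) (w ⟨2 * j + 3, by omega⟩)))))) hη.differentiableAt ?_ ?_]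
  · rw [← f.altTriple_derivative (DF := fun x u v =>
      s • (fderiv ℝ (fderiv ℝ A) z (x, 0) (u, 0) v - fderiv ℝ (fderiv ℝ A) z (x, 0) (v, 0) u) +
        s ^ 2 • (bracketCLM G (fderiv ℝ A z (x, 0) u) (A z v) +
          bracketCLM G (A z u) (fderiv ℝ A z (x, 0) v)))
      (scaledCurvVal_bianchi hA s fun _ _ _ => rfl)]
    rfl
  · filter_upwards [hV.mem_nhds hy] with y hy w
    rw [InvPoly.oneOneTwo_apply]
    simp only [deriv_family_apply hV ha hy, scaledCurv_apply hV ha hy, ← familyMap_apply]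
    rfl
  · intro x w
    have hc : HasDerivAt (fun t : ℝ => (y + t • x, θ)) (x, 0) 0 := by
      simpa using (((hasDerivAt_id (0 : ℝ)).smul_const x).const_add y).prodMk
        (hasDerivAt_const (0 : ℝ) θ)
    have hct : (y + (0 : ℝ) • x, θ) = z := by rw [zero_smul, add_zero]
    have h1 : HasDerivAt (fun t : ℝ => A (y + t • x, θ) (w ⟨1, by omega⟩))
        (fderiv ℝ A z (x, 0) (w ⟨1, by omega⟩)) 0 := by
      have := (hA.differentiableAt (by simp)).hasFDerivAt.comp_hasDerivAt_of_eq (0 : ℝ) hc hct.symm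
      simpa using this.clm_apply (hasDerivAt_const (0 : ℝ) (w ⟨1, by omega⟩))
    have h2 : HasDerivAt (fun t : ℝ => fderiv ℝ A (y + t • x, θ) (0, 1) (w ⟨0, by omega⟩))
        (fderiv ℝ (fderiv ℝ A) z (x, 0) (0, 1) (w ⟨0, by omega⟩)) 0 := by
      have := ((hA.fderiv_right (m := ∞) (by simp)).differentiableAt
        (by simp)).hasFDerivAt.comp_hasDerivAt_of_eq (0 : ℝ) hc hct.symm
      simpa using (this.clm_apply (hasDerivAt_const (0 : ℝ) ((0 : Euc n), (1 : ℝ)))).clm_apply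
        (hasDerivAt_const (0 : ℝ) (w ⟨0, by omega⟩))
    have h3 := f.hasDerivAt_eval h2 h1 (fun j : Fin l => hasDerivAt_scaledCurvVal hA s
      (w ⟨2 * j + 2, by omega⟩) (w ⟨2 * j + 3, by omega⟩) hc hct)
    simp only [hct] at h3
    exact h3

theorem InvPoly.oneTwo_scaledCurv (f : InvPoly e G (l + 2)) (hV : IsOpen V)
    (ha : ContDiffOn ℝ ∞ (fun z : Euc n × ℝ => a z.2 z.1) (V ×ˢ univ)) {y : Euc n} (hy : y ∈ V)
    (s θ : ℝ) (α : Euc n [⋀^Fin 1]→L[ℝ] LieAlg e G) (w : Fin (2 * (l + 1) + 1) → Euc n) :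
    InvPoly.oneTwo (k := l + 1) f α (scaledCurv a s θ y) w =
      (1 / 2) ^ (l + 1) * altTriple (fun v x u r => f.eval (α ![v])
        (scaledCurvVal G (familyMap a) s (y, θ) x u)
        (onPairs (scaledCurvVal G (familyMap a) s (y, θ)) r)) w := by
  rw [f.oneTwo_eq_altTriple]
  simp only [scaledCurv_apply hV ha hy]

/-- The derivative of `f (a, F_s, …, F_s)` in `θ`, where `∂_θ F_s` is `s` times the covariant
exterior derivative of `∂_θ a` with respect to `s a`. -/
theorem InvPoly.hasDerivAt_oneTwo_time (f : InvPoly e G (l + 2)) (hV : IsOpen V)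
    (ha : ContDiffOn ℝ ∞ (fun z : Euc n × ℝ => a z.2 z.1) (V ×ˢ univ)) {y : Euc n} (hy : y ∈ V)
    (s θ : ℝ) (w : Fin (2 * (l + 1) + 1) → Euc n) :
    HasDerivAt (fun t => InvPoly.oneTwo (k := l + 1) f (a t y) (scaledCurv a s t y) w)
      (InvPoly.oneTwo (k := l + 1) f (deriv (fun t => a t y) θ) (scaledCurv a s θ y) w +
        (1 / 2) ^ l * (l + 1) * s * altTriple (fun x u v r => f.eval
        (fderiv ℝ (fderiv ℝ (familyMap a)) (y, θ) (x, 0) (0, 1) u +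
        s • lieBracket G (familyMap a (y, θ) x) (fderiv ℝ (familyMap a) (y, θ) (0, 1) u))
      (familyMap a (y, θ) v) (onPairs (scaledCurvVal G (familyMap a) s (y, θ)) r)) w) θ := by
  have hA := contDiffAt_familyMap hV ha hy θ
  have hsymm : ∀ v w, fderiv ℝ (fderiv ℝ (familyMap a)) (y, θ) v w =
      fderiv ℝ (fderiv ℝ (familyMap a)) (y, θ) w v := fun v w =>
    (hA.isSymmSndFDerivAt (by
      rw [minSmoothness_of_isRCLikeNormedField]; exact ENat.LEInfty.out)) v w
  simp only [f.oneTwo_scaledCurv hV ha hy, ← familyMap_apply, deriv_family_apply hV ha hy]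
  set A := familyMap a with hAdef
  have hc : HasDerivAt (fun t : ℝ => (y, t)) ((0 : Euc n), (1 : ℝ)) θ :=
    (hasDerivAt_const θ y).prodMk (hasDerivAt_id θ)
  have h1 : ∀ v, HasDerivAt (fun t : ℝ => A (y, t) v) (fderiv ℝ A (y, θ) (0, 1) v) θ := by
    intro v
    have := (hA.differentiableAt (by simp)).hasFDerivAt.comp_hasDerivAt_of_eq θ hc rfl
    simpa using this.clm_apply (hasDerivAt_const θ v)
  -- `Ψ` antisymmetrises to the covariant exterior derivative of `∂a`
  set Ψ : Euc n → Euc n → LieAlg e G := fun x u => fderiv ℝ (fderiv ℝ A) (y, θ) (x, 0) (0, 1) u +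
        s • lieBracket G (A (y, θ) x) (fderiv ℝ A (y, θ) (0, 1) u) with hΨ
  have h2 : ∀ u v, HasDerivAt (fun t : ℝ => scaledCurvVal G A s (y, t) u v)
      (s • (Ψ u v - Ψ v u)) θ := by
    intro u v
    refine (hasDerivAt_scaledCurvVal hA s u v hc rfl).congr_deriv ?_
    simp only [hΨ, ← bracketCLM_apply]
    rw [hsymm (0, 1) (u, 0), hsymm (0, 1) (v, 0),
      bracketCLM_antisymm (fderiv ℝ A (y, θ) (0, 1) u)]
    module
  have h3 := (hasDerivAt_altSum (fun w : Fin (2 * (l + 1) + 1) → Euc n => f.hasDerivAt_eval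
    (h1 (w ⟨0, by omega⟩)) (h2 (w ⟨1, by omega⟩) (w ⟨2, by omega⟩))
    (fun j : Fin l => h2 (w ⟨2 * j + 3, by omega⟩) (w ⟨2 * j + 4, by omega⟩))) w).const_mul
      ((1 / 2 : ℝ) ^ (l + 1))
  refine h3.congr_deriv ?_
  have h4 := f.altTriple_variation (A (y, θ)) (scaledCurvVal G A s (y, θ))
    (fun x u => s • (Ψ x u - Ψ u x)) w
  rw [f.altTriple_antisymm, f.altTriple_rotate] at h4
  have h5 := altTriple_add (fun v x u r => f.eval (fderiv ℝ A (y, θ) (0, 1) v)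
      (scaledCurvVal G A s (y, θ) x u) (onPairs (scaledCurvVal G A s (y, θ)) r))
    (fun v x u r => f.eval (A (y, θ) v) (s • (Ψ x u - Ψ u x))
      (onPairs (scaledCurvVal G A s (y, θ)) r) +
      ∑ j, f.eval (A (y, θ) v) (scaledCurvVal G A s (y, θ) x u)
        (Function.update (onPairs (scaledCurvVal G A s (y, θ)) r) j
          (s • (Ψ (r j).1 (r j).2 - Ψ (r j).2 (r j).1)))) w
  rw [h4] at h5
  simp only [← add_assoc] at h5
  have h6 : ∀ x : ℝ, (1 / 2 : ℝ) ^ (l + 1) * x = 1 / 2 * (1 / 2) ^ l * x := fun x => by ring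
  refine (congrArg ((1 / 2 : ℝ) ^ (l + 1) * ·) h5).trans ?_
  simp only [h6]
  ring

/-- The derivative of `s f (∂a, F_s, …, F_s)` in `s`, where `∂_s F_s` is the covariant exterior
derivative `da + s [a, a]` of `a` with respect to `s a`. -/
theorem InvPoly.hasDerivAt_oneTwo_scale (f : InvPoly e G (l + 2)) (hV : IsOpen V)
    (ha : ContDiffOn ℝ ∞ (fun z : Euc n × ℝ => a z.2 z.1) (V ×ˢ univ)) {y : Euc n} (hy : y ∈ V)
    (s θ : ℝ) (w : Fin (2 * (l + 1) + 1) → Euc n) :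
    HasDerivAt (fun s => s * InvPoly.oneTwo (k := l + 1) f (deriv (fun t => a t y) θ)
        (scaledCurv a s θ y) w)
      (InvPoly.oneTwo (k := l + 1) f (deriv (fun t => a t y) θ) (scaledCurv a s θ y) w -
        (1 / 2) ^ l * (l + 1) * s * altTriple (fun x u v r => f.eval
          (fderiv ℝ (familyMap a) (y, θ) (0, 1) u)
          (fderiv ℝ (familyMap a) (y, θ) (x, 0) v +
            s • lieBracket G (familyMap a (y, θ) x) (familyMap a (y, θ) v))
          (onPairs (scaledCurvVal G (familyMap a) s (y, θ)) r)) w) s := by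
  simp only [f.oneTwo_scaledCurv hV ha hy, deriv_family_apply hV ha hy]
  set A := familyMap a with hAdef
  -- `Ξ` antisymmetrises to the covariant exterior derivative of `a`
  set Ξ : Euc n → Euc n → LieAlg e G := fun x u => fderiv ℝ A (y, θ) (x, 0) u +
        s • lieBracket G (A (y, θ) x) (A (y, θ) u) with hΞ
  have h2 : ∀ u v, HasDerivAt (fun s : ℝ => scaledCurvVal G A s (y, θ) u v)
      ((1 : ℝ) • (Ξ u v - Ξ v u)) s := by
    intro u v
    have h1 := ((hasDerivAt_id s).smul_const
      (fderiv ℝ A (y, θ) (u, 0) v - fderiv ℝ A (y, θ) (v, 0) u)).add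
      ((hasDerivAt_pow 2 s).smul_const (bracketCLM G (A (y, θ) u) (A (y, θ) v)))
    refine h1.congr_deriv ?_
    simp only [hΞ, ← bracketCLM_apply]
    rw [bracketCLM_antisymm (A (y, θ) v) (A (y, θ) u)]
    push_cast
    module
  have h3 := (hasDerivAt_altSum (fun w : Fin (2 * (l + 1) + 1) → Euc n => f.hasDerivAt_eval
    (hasDerivAt_const s (fderiv ℝ A (y, θ) (0, 1) (w ⟨0, by omega⟩)))
    (h2 (w ⟨1, by omega⟩) (w ⟨2, by omega⟩))
    (fun j : Fin l => h2 (w ⟨2 * j + 3, by omega⟩) (w ⟨2 * j + 4, by omega⟩))) w).const_mul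
      ((1 / 2 : ℝ) ^ (l + 1))
  refine ((hasDerivAt_id s).mul h3).congr_deriv ?_
  have h4 := f.altTriple_variation (fderiv ℝ A (y, θ) (0, 1)) (scaledCurvVal G A s (y, θ))
    (fun x u => (1 : ℝ) • (Ξ x u - Ξ u x)) w
  rw [f.altTriple_antisymm] at h4
  have h5 := altTriple_swap₀₁ (fun v x u r => f.eval (fderiv ℝ A (y, θ) (0, 1) v) (Ξ x u)
    (onPairs (scaledCurvVal G A s (y, θ)) r)) w
  rw [h5]
  have h0 : ∀ B C, f.eval (0 : LieAlg e G) B C = 0 := fun B C => by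
    rw [← zero_smul ℝ (0 : LieAlg e G), f.eval_smul_left, zero_mul]
  simp only [h0, zero_add]
  have h6 : ∀ x : ℝ, (1 / 2 : ℝ) ^ (l + 1) * x = 1 / 2 * (1 / 2) ^ l * x := fun x => by ring
  refine Eq.trans (congrArg (fun X => 1 * ((1 / 2 : ℝ) ^ (l + 1) * altTriple
    (fun v x u r => f.eval (fderiv ℝ A (y, θ) (0, 1) v)
      (scaledCurvVal G A s (y, θ) x u) (onPairs (scaledCurvVal G A s (y, θ)) r)) w) +
    s * ((1 / 2 : ℝ) ^ (l + 1) * X)) h4) ?_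
  simp only [h6]
  ring

/-- The infinitesimal transgression formula: `(k - 1) s d f(∂a, a, F_s, …, F_s)`
is `∂_θ f(a, F_s, …, F_s) - ∂_s (s f(∂a, F_s, …, F_s))` for `f` of degree `k = l + 2`,
where `F_s = s da + s²/2 [a, a]`. -/
theorem InvPoly.exists_hasDerivAt_oneTwo (f : InvPoly e G (l + 2)) (hV : IsOpen V)
    (ha : ContDiffOn ℝ ∞ (fun z : Euc n × ℝ => a z.2 z.1) (V ×ˢ univ)) {y : Euc n} (hy : y ∈ V)
    (s θ : ℝ) (w : Fin (2 * (l + 1) + 1) → Euc n) :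
    ∃ p q : ℝ,
      HasDerivAt (fun t => InvPoly.oneTwo (k := l + 1) f (a t y) (scaledCurv a s t y) w) p θ ∧
      HasDerivAt (fun s => s * InvPoly.oneTwo (k := l + 1) f (deriv (fun t => a t y) θ)
        (scaledCurv a s θ y) w) q s ∧
      (l + 1) * (s * extDeriv (fun y => f.oneOneTwo (deriv (fun t => a t y) θ) (a θ y)
        (fun _ => scaledCurv a s θ y)) y w) = p - q := by
  refine ⟨_, _, f.hasDerivAt_oneTwo_time hV ha hy s θ w, f.hasDerivAt_oneTwo_scale hV ha hy s θ w,
    ?_⟩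
  rw [f.extDeriv_oneOneTwo hV ha hy]
  ring

end Family

end Transgression

/-! ### The binomial expansion -/

section Binomial

/-- The binomial formula for a symmetric multilinear map. -/
theorem map_smul_add_smul_of_symm {l : ℕ} {X Y : Type*} [AddCommGroup X]
    [Module ℝ X] [AddCommGroup Y] [Module ℝ Y] (T : MultilinearMap ℝ (fun _ : Fin l => X) Y)
    (hT : ∀ i j v, i ≠ j → T (v ∘ Equiv.swap i j) = T v) (s t : ℝ) (B C : X) :
    T (fun _ => s • B + t • C) = ∑ i ∈ Finset.range (l + 1),
      ((l.choose i : ℝ) * (s ^ (l - i) * t ^ i)) •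
        T (fun j : Fin l => if (j : ℕ) < l - i then B else C) := by
  have hperm : ∀ (σ : Equiv.Perm (Fin l)) v, T (v ∘ σ) = T v := by
    intro σ
    induction σ using Equiv.Perm.swap_induction_on with
    | one => intro v; rfl
    | swap_mul σ x y hxy ih =>
      intro v
      rw [Equiv.Perm.coe_mul, ← Function.comp_assoc, ih, hT _ _ _ hxy]
  have hpiece : ∀ u : Finset (Fin l), T (u.piecewise (fun _ => t • C) fun _ => s • B) =
      (s ^ (l - u.card) * t ^ u.card) •
        T (fun j : Fin l => if (j : ℕ) < l - u.card then B else C) := by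
    intro u
    have hu : u.card ≤ l := by simpa using Finset.card_le_univ u
    have hcard : Fintype.card {j : Fin l // (j : ℕ) < l - u.card} =
        Fintype.card {j : Fin l // j ∉ u} := by
      rw [Fintype.card_subtype, Fin.card_filter_val_lt, Fintype.card_subtype_compl]
      simp
    -- a permutation that moves the first `l - #u` indices to the complement of `u`
    obtain ⟨ε⟩ := Fintype.card_eq.1 hcard
    have h1 : (u.piecewise (fun _ => t • C) fun _ => s • B) ∘ ε.extendSubtype =
        fun j : Fin l => (if (j : ℕ) < l - u.card then s else t) •
          (if (j : ℕ) < l - u.card then B else C) := by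
      funext j
      by_cases hj : (j : ℕ) < l - u.card
      · have := ε.extendSubtype_mem j hj
        simp [this, hj]
      · have := ε.extendSubtype_not_mem j hj
        rw [not_not] at this
        simp [this, hj]
    rw [← hperm ε.extendSubtype, h1, T.map_smul_univ]
    congr 1
    have h2 := Finset.card_filter_add_card_filter_not (s := (Finset.univ : Finset (Fin l)))
      (fun j => (j : ℕ) < l - u.card)
    rw [Fin.card_filter_val_lt, Finset.card_univ, Fintype.card_fin] at h2
    rw [Finset.prod_ite, Finset.prod_const, Finset.prod_const, Fin.card_filter_val_lt]
    congr 2 <;> omega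
  have h := T.map_add_univ (fun _ => t • C) (fun _ => s • B)
  have h0 : (fun _ : Fin l => s • B + t • C) = (fun _ => t • C) + fun _ => s • B := by
    funext j
    exact add_comm _ _
  rw [h0, h]
  simp only [hpiece]
  have h3 := Finset.sum_powerset_apply_card (fun m => (s ^ (l - m) * t ^ m) •
    T (fun j : Fin l => if (j : ℕ) < l - m then B else C)) (x := (Finset.univ : Finset (Fin l)))
  rw [Finset.powerset_univ, Finset.card_univ, Fintype.card_fin] at h3
  rw [h3]
  refine Finset.sum_congr rfl fun i _ => ?_
  rw [← Nat.cast_smul_eq_nsmul ℝ, smul_smul]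

variable {e l : ℕ} {G : Type*} [TopologicalSpace G] [ChartedSpace (Euc e) G] [Group G]
  {V : Type*} [AddCommGroup V] [Module ℝ V] [TopologicalSpace V]

/-- Symmetry of `f` in all arguments but the first two. -/
theorem InvPoly.eval_comp_swap (f : InvPoly e G (l + 2)) (A B : LieAlg e G)
    (C : Fin l → LieAlg e G) (i j : Fin l) : f.eval A B (C ∘ Equiv.swap i j) = f.eval A B C := by
  rw [InvPoly.eval, InvPoly.eval, ← f.symm (Equiv.swap i.succ.succ j.succ.succ)]
  refine congrArg f.toMulti (funext fun m => ?_)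
  have h : ∀ m : Fin l, Equiv.swap i.succ.succ j.succ.succ m.succ.succ =
      (Equiv.swap i j m).succ.succ := fun m =>
    ((Fin.succ_injective _).comp (Fin.succ_injective _)).swap_apply i j m
  refine Fin.cases ?_ (fun m => Fin.cases ?_ (fun m => ?_) m) m
  · have h1 : Equiv.swap i.succ.succ j.succ.succ (0 : Fin (l + 2)) = 0 :=
      Equiv.swap_apply_of_ne_of_ne (Fin.succ_ne_zero _).symm (Fin.succ_ne_zero _).symm
    simp only [Function.comp_apply, h1, Fin.cons_zero]
  · have h1 : Equiv.swap i.succ.succ j.succ.succ (Fin.succ 0 : Fin (l + 2)) = Fin.succ 0 :=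
      Equiv.swap_apply_of_ne_of_ne (fun h => Fin.succ_ne_zero _ (Fin.succ_injective _ h).symm)
        (fun h => Fin.succ_ne_zero _ (Fin.succ_injective _ h).symm)
    simp only [Function.comp_apply, h1, Fin.cons_succ, Fin.cons_zero]
  · simp only [Function.comp_apply, h, Fin.cons_succ, Equiv.swap_apply_self]

/-- Two-forms commute: exchanging two pairs of variables is an even permutation. -/
theorem InvPoly.oneOneTwo_comp_swap (f : InvPoly e G (l + 2)) (α α' : V [⋀^Fin 1]→L[ℝ] LieAlg e G)
    (β : Fin l → V [⋀^Fin 2]→L[ℝ] LieAlg e G) {i j : Fin l} (hij : i ≠ j) :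
    f.oneOneTwo α α' (β ∘ Equiv.swap i j) = f.oneOneTwo α α' β := by
  have hne : (i : ℕ) ≠ j := fun h => hij (Fin.ext h)
  ext w
  rw [InvPoly.oneOneTwo_apply, InvPoly.oneOneTwo_apply]
  congr 1
  set π : Equiv.Perm (Fin (2 * (l + 1))) :=
    Equiv.swap ⟨2 * i + 2, by omega⟩ ⟨2 * j + 2, by omega⟩ *
      Equiv.swap ⟨2 * i + 3, by omega⟩ ⟨2 * j + 3, by omega⟩ with hπ
  have hval : ∀ m (hm : m < 2 * (l + 1)), ((π ⟨m, hm⟩ : Fin _) : ℕ) =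
      if m = 2 * (i : ℕ) + 2 then 2 * (j : ℕ) + 2 else if m = 2 * i + 3 then 2 * j + 3 else
        if m = 2 * j + 2 then 2 * i + 2 else if m = 2 * j + 3 then 2 * i + 3 else m := by
    intro m hm
    simp only [hπ, Equiv.Perm.mul_apply, Equiv.swap_apply_def, Fin.ext_iff]
    split_ifs <;> simp_all <;> omega
  have h := altSum_comp_perm π (fun w : Fin (2 * (l + 1)) → V =>
    f.eval (α ![w ⟨0, by omega⟩]) (α' ![w ⟨1, by omega⟩])
    fun j => β j ![w ⟨2 * j + 2, by omega⟩, w ⟨2 * j + 3, by omega⟩]) w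
  rw [hπ, Equiv.Perm.sign_mul, Equiv.Perm.sign_swap (by simpa [Fin.ext_iff] using hne),
    Equiv.Perm.sign_swap (by simpa [Fin.ext_iff] using hne), ← hπ] at h
  simp only [mul_neg, mul_one, neg_neg, Units.val_one, Int.cast_one, one_mul] at h
  refine Eq.trans ?_ h
  refine congrArg (fun T => altSum T w) (funext fun w => ?_)
  have hw : ∀ (m m' : ℕ) (hm : m < 2 * (l + 1)) (hm' : m' < 2 * (l + 1)),
      (if m = 2 * (i : ℕ) + 2 then 2 * (j : ℕ) + 2 else if m = 2 * i + 3 then 2 * j + 3 else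
        if m = 2 * j + 2 then 2 * i + 2 else if m = 2 * j + 3 then 2 * i + 3 else m) = m' →
      (w ∘ π) ⟨m, hm⟩ = w ⟨m', hm'⟩ := fun m m' hm hm' h =>
    congrArg w (Fin.ext ((hval m hm).trans h))
  rw [hw 0 0 (by omega) (by omega) (by split_ifs <;> omega),
    hw 1 1 (by omega) (by omega) (by split_ifs <;> omega), ← f.eval_comp_swap _ _ _ i j]
  refine congrArg (f.eval _ _) (funext fun m => ?_)
  simp only [Function.comp_apply]
  have hs : ∀ m, ((Equiv.swap i j m : Fin l) : ℕ) = if (m : ℕ) = i then (j : ℕ) else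
      if (m : ℕ) = j then i else m := by
    intro m
    simp only [Equiv.swap_apply_def, Fin.ext_iff]
    split_ifs <;> rfl
  have h1 := hw (2 * (Equiv.swap i j m : Fin l) + 2) (2 * m + 2) (by omega) (by omega)
    (by rw [hs]; split_ifs <;> omega)
  have h2 := hw (2 * (Equiv.swap i j m : Fin l) + 3) (2 * m + 3) (by omega) (by omega)
    (by rw [hs]; split_ifs <;> omega)
  simp only [Function.comp_apply] at h1 h2
  rw [h1, h2]

/-- `f (α, α', β₁, …, β_l)` as a multilinear function of the two-forms. -/
def InvPoly.oneOneTwoMulti (f : InvPoly e G (l + 2)) (α α' : V [⋀^Fin 1]→L[ℝ] LieAlg e G) :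
    MultilinearMap ℝ (fun _ : Fin l => V [⋀^Fin 2]→L[ℝ] LieAlg e G)
      (V [⋀^Fin (2 * (l + 1))]→L[ℝ] ℝ) :=
  MultilinearMap.mk' (f.oneOneTwo α α')
    (fun β i x y => by
      ext w
      simp only [ContinuousAlternatingMap.add_apply, InvPoly.oneOneTwo_apply]
      rw [← mul_add, ← altSum_add]
      refine congrArg (fun T => _ * altSum T w) (funext fun w => ?_)
      have h : ∀ z : V [⋀^Fin 2]→L[ℝ] LieAlg e G, (fun j : Fin l => Function.update β i z j
          ![w ⟨2 * j + 2, by omega⟩, w ⟨2 * j + 3, by omega⟩]) = Function.update (fun j : Fin l =>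
          β j ![w ⟨2 * j + 2, by omega⟩, w ⟨2 * j + 3, by omega⟩]) i
          (z ![w ⟨2 * i + 2, by omega⟩, w ⟨2 * i + 3, by omega⟩]) := by
        intro z
        funext j
        rcases eq_or_ne j i with rfl | hj
        · simp
        · simp [hj]
      simp only [h]
      exact f.eval_update_add _ _ _ _ _ _)
    (fun β i c x => by
      ext w
      simp only [ContinuousAlternatingMap.smul_apply, InvPoly.oneOneTwo_apply, smul_eq_mul]
      rw [mul_left_comm c, ← altSum_mul_left c]
      refine congrArg (fun T => _ * altSum T w) (funext fun w => ?_)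
      have h : ∀ z : V [⋀^Fin 2]→L[ℝ] LieAlg e G, (fun j : Fin l => Function.update β i z j
          ![w ⟨2 * j + 2, by omega⟩, w ⟨2 * j + 3, by omega⟩]) = Function.update (fun j : Fin l =>
          β j ![w ⟨2 * j + 2, by omega⟩, w ⟨2 * j + 3, by omega⟩]) i
          (z ![w ⟨2 * i + 2, by omega⟩, w ⟨2 * i + 3, by omega⟩]) := by
        intro z
        funext j
        rcases eq_or_ne j i with rfl | hj
        · simp
        · simp [hj]
      simp only [h]
      exact f.eval_update_smul _ _ _ _ _ _)

theorem InvPoly.oneOneTwo_smul_add_smul (f : InvPoly e G (l + 2))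
    (α α' : V [⋀^Fin 1]→L[ℝ] LieAlg e G) (s t : ℝ) (β γ : V [⋀^Fin 2]→L[ℝ] LieAlg e G) :
    f.oneOneTwo α α' (fun _ => s • β + t • γ) = ∑ i ∈ Finset.range (l + 1),
      ((l.choose i : ℝ) * (s ^ (l - i) * t ^ i)) •
        f.oneOneTwo α α' (fun j : Fin l => if (j : ℕ) < l - i then β else γ) :=
  map_smul_add_smul_of_symm (f.oneOneTwoMulti α α')
    (fun _ _ _ hij => f.oneOneTwo_comp_swap α α' _ hij) s t β γ

end Binomial

/-! ### Integration over the parameters -/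

section BetaIntegral

/-- Euler's Beta integral at integers, by induction on `n` and integration by parts. -/
theorem integral_pow_mul_one_sub_pow (m n : ℕ) :
    ∫ s in (0 : ℝ)..1, s ^ m * (1 - s) ^ n =
      (m.factorial * n.factorial : ℝ) / ((m + n + 1).factorial : ℝ) := by
  induction n generalizing m with
  | zero =>
    simp only [pow_zero, mul_one, integral_pow, Nat.factorial_zero, Nat.cast_one, add_zero]
    rw [Nat.factorial_succ]
    have := Nat.factorial_ne_zero m
    push_cast
    field_simp
    simp
  | succ n ih =>
    have h1 : ∀ s : ℝ, HasDerivAt (fun s : ℝ => s ^ (m + 1) / (m + 1)) (s ^ m) s := by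
      intro s
      have := (hasDerivAt_pow (m + 1) s).div_const ((m : ℝ) + 1)
      refine this.congr_deriv ?_
      have : (m : ℝ) + 1 ≠ 0 := by positivity
      push_cast
      field_simp
    have h2 : ∀ s : ℝ, HasDerivAt (fun s : ℝ => (1 - s) ^ (n + 1))
        (-((n + 1) * (1 - s) ^ n)) s := by
      intro s
      have := (((hasDerivAt_id s).const_sub 1).pow (n + 1))
      refine this.congr_deriv ?_
      push_cast
      simp
    have h3 := intervalIntegral.integral_mul_deriv_eq_deriv_mul (a := 0) (b := 1)
      (u := fun s : ℝ => (1 - s) ^ (n + 1)) (v := fun s : ℝ => s ^ (m + 1) / (m + 1))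
      (fun s _ => h2 s) (fun s _ => h1 s)
      (Continuous.intervalIntegrable (by fun_prop) _ _)
      (Continuous.intervalIntegrable (by fun_prop) _ _)
    have h4 : (fun s : ℝ => s ^ m * (1 - s) ^ (n + 1)) = fun s => (1 - s) ^ (n + 1) * s ^ m :=
      funext fun s => mul_comm _ _
    have h5 : (fun s : ℝ => -((n + 1) * (1 - s) ^ n) * (s ^ (m + 1) / (m + 1))) =
        fun s => -(((n : ℝ) + 1) / (m + 1)) * (s ^ (m + 1) * (1 - s) ^ n) := by
      funext s
      ring
    rw [h4, h3, h5, intervalIntegral.integral_const_mul, ih]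
    have h6 : m + 1 + n + 1 = m + (n + 1) + 1 := by ring
    rw [h6, Nat.factorial_succ m, Nat.factorial_succ n]
    have := Nat.factorial_ne_zero (m + (n + 1) + 1)
    have : (m : ℝ) + 1 ≠ 0 := by positivity
    push_cast
    field_simp
    simp

end BetaIntegral

section ExtDerivIntegral

variable {n N : ℕ} {V : Set (Euc n)}

theorem extDeriv_apply_of_hasFDerivAt {η : Euc n → Euc n [⋀^Fin N]→L[ℝ] ℝ}
    {η' : Euc n →L[ℝ] Euc n [⋀^Fin N]→L[ℝ] ℝ} {y : Euc n} (h : HasFDerivAt η η' y)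
    (w : Fin (N + 1) → Euc n) :
    extDeriv η y w = ∑ i : Fin (N + 1), (-1 : ℝ) ^ (i : ℕ) * η' (w i) (i.removeNth w) := by
  rw [extDeriv, h.fderiv, ContinuousAlternatingMap.alternatizeUncurryFin_apply]
  simp

/-- The exterior derivative of a family of forms is continuous in the parameter. -/
theorem continuous_extDeriv_family {b : ℝ → Euc n → Euc n [⋀^Fin N]→L[ℝ] ℝ} (hV : IsOpen V)
    (hb : ContDiffOn ℝ ∞ (fun z : Euc n × ℝ => b z.2 z.1) (V ×ˢ univ)) {y : Euc n} (hy : y ∈ V)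
    (w : Fin (N + 1) → Euc n) : Continuous fun θ => extDeriv (b θ) y w := by
  simp only [fun θ => extDeriv_apply_of_hasFDerivAt (hasFDerivAt_fst_of_contDiffOn hV hb hy θ) w]
  refine continuous_finsetSum _ fun i _ => continuous_const.mul ?_
  exact (ContinuousAlternatingMap.apply ℝ (Euc n) ℝ (i.removeNth w)).continuous.comp
    ((continuous_slice_of_contDiffOn (contDiffOn_partial_fderiv hV hb) hy).clm_apply
      continuous_const)

/-- The exterior derivative commutes with integration over a parameter. -/
theorem extDeriv_integral {b : ℝ → Euc n → Euc n [⋀^Fin N]→L[ℝ] ℝ} (hV : IsOpen V)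
    (hb : ContDiffOn ℝ ∞ (fun z : Euc n × ℝ => b z.2 z.1) (V ×ˢ univ)) {y : Euc n} (hy : y ∈ V)
    (T₀ T₁ : ℝ) (w : Fin (N + 1) → Euc n) :
    extDeriv (fun y => ∫ θ in T₀..T₁, b θ y) y w = ∫ θ in T₀..T₁, extDeriv (b θ) y w := by
  have hc := continuous_slice_of_contDiffOn (contDiffOn_partial_fderiv hV hb) hy
  have hpart : ∀ u, Continuous fun θ =>
      ((fderiv ℝ (fun z : Euc n × ℝ => b z.2 z.1) (y, θ)).comp (.inl ℝ (Euc n) ℝ)) u :=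
    fun u => hc.clm_apply continuous_const
  rw [extDeriv_apply_of_hasFDerivAt (hasFDerivAt_integral_of_contDiffOn hV hb T₀ T₁ hy)]
  simp only [fun θ => extDeriv_apply_of_hasFDerivAt (hasFDerivAt_fst_of_contDiffOn hV hb hy θ) w]
  rw [intervalIntegral.integral_finsetSum fun i _ => ?_]
  · refine Finset.sum_congr rfl fun i _ => ?_
    rw [intervalIntegral.integral_const_mul,
      ContinuousLinearMap.intervalIntegral_apply (hc.intervalIntegrable _ _)]
    congr 1
    exact ((ContinuousAlternatingMap.apply ℝ (Euc n) ℝ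
      (i.removeNth w)).intervalIntegral_comp_comm ((hpart (w i)).intervalIntegrable _ _)).symm
  · exact (continuous_const.mul ((ContinuousAlternatingMap.apply ℝ (Euc n) ℝ
      (i.removeNth w)).continuous.comp (hpart (w i)))).intervalIntegrable _ _

end ExtDerivIntegral

section Transgression

variable {e n l : ℕ} {G : Type*} [TopologicalSpace G] [ChartedSpace (Euc e) G] [Group G]

theorem InvPoly.oneTwo_smul_right {V : Type*} [AddCommGroup V] [Module ℝ V] [TopologicalSpace V]
    {k : ℕ} (f : InvPoly e G (k + 1)) (α : V [⋀^Fin 1]→L[ℝ] LieAlg e G)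
    (c : ℝ) (β : V [⋀^Fin 2]→L[ℝ] LieAlg e G) : f.oneTwo α (c • β) = c ^ k • f.oneTwo α β := by
  ext w
  rw [ContinuousAlternatingMap.smul_apply, InvPoly.oneTwo_apply, InvPoly.oneTwo_apply, smul_eq_mul,
    mul_left_comm (c ^ k), ← altSum_mul_left (c ^ k)]
  refine congrArg (fun T => _ * altSum T w) (funext fun w => ?_)
  have h := f.toMulti.map_smul_univ (Fin.cons 1 fun _ : Fin k => c)
    (Fin.cons (α ![w ⟨0, by omega⟩])
      fun i : Fin k => β ![w ⟨2 * i + 1, by omega⟩, w ⟨2 * i + 2, by omega⟩])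
  rw [Fin.prod_univ_succ] at h
  simp only [Fin.cons_zero, Fin.cons_succ, Finset.prod_const, Finset.card_univ, Fintype.card_fin,
    one_mul, smul_eq_mul] at h
  rw [← h]
  refine congrArg f.toMulti (funext fun i => ?_)
  refine Fin.cases ?_ (fun i => ?_) i
  · simp
  · simp

variable [LieGroup (𝓡 e) ∞ G]

/-- The form `∑ᵢ cᵢ ∫_0^T f (∂_θ a, a, da, …, da, [a,a], …, [a,a]) dθ` of a family `a` of
one-forms. -/
def canonicalOfFamily (f : InvPoly e G (l + 2)) (a : ℝ → Euc n → Euc n [⋀^Fin 1]→L[ℝ] LieAlg e G)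
    (T : ℝ) (y : Euc n) : Euc n [⋀^Fin (2 * (l + 1))]→L[ℝ] ℝ :=
  ∑ i ∈ Finset.range (l + 1),
    (((l + 2) * (l + 1).factorial : ℝ) /
      (2 ^ i * i.factorial * (l - i).factorial * (l + 2 + i))) •
      ∫ θ in (0 : ℝ)..T,
        f.oneOneTwo (deriv (fun t => a t y) θ) (a θ y)
          (fun j : Fin l => if (j : ℕ) < l - i then extDeriv (a θ) y
            else formBracket G (a θ y) (a θ y))

variable {V : Set (Euc n)} {a : ℝ → Euc n → Euc n [⋀^Fin 1]→L[ℝ] LieAlg e G}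

theorem contDiffOn_canonical_integrand (f : InvPoly e G (l + 2)) (hV : IsOpen V)
    (ha : ContDiffOn ℝ ∞ (fun z : Euc n × ℝ => a z.2 z.1) (V ×ˢ univ)) (i : ℕ) :
    ContDiffOn ℝ ∞ (fun z : Euc n × ℝ => f.oneOneTwo (deriv (fun t => a t z.1) z.2) (a z.2 z.1)
          (fun j : Fin l => if (j : ℕ) < l - i then extDeriv (a z.2) z.1
            else formBracket G (a z.2 z.1) (a z.2 z.1))) (V ×ˢ univ) := by
  refine contDiffOn_oneOneTwo f (contDiffOn_deriv_family hV ha) ha fun j => ?_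
  split_ifs
  · exact contDiffOn_extDeriv_family hV ha
  · exact contDiffOn_formBracket ha ha

theorem contDiffOn_canonicalOfFamily (f : InvPoly e G (l + 2)) (hV : IsOpen V)
    (ha : ContDiffOn ℝ ∞ (fun z : Euc n × ℝ => a z.2 z.1) (V ×ˢ univ)) (T : ℝ) :
    ContDiffOn ℝ ∞ (canonicalOfFamily f a T) V :=
  ContDiffOn.sum fun i _ =>
    (contDiffOn_integral hV (contDiffOn_canonical_integrand f hV ha i) 0 T).const_smul _

/-- The coefficients of the canonical form come from `∫_0^1 s · s^{l-i} (s²/2)^i ds`. -/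
theorem integral_mul_scale {i : ℕ} (hi : i ≤ l) :
    ((l + 2) * (l + 1) : ℝ) * ((l.choose i : ℝ) *
      ∫ s in (0 : ℝ)..1, s * (s ^ (l - i) * (s ^ 2 / 2) ^ i)) =
    ((l + 2) * (l + 1).factorial : ℝ) /
      (2 ^ i * i.factorial * (l - i).factorial * (l + 2 + i)) := by
  have h1 : ∀ s : ℝ, s * (s ^ (l - i) * (s ^ 2 / 2) ^ i) = (1 / 2 ^ i) * s ^ (l + 1 + i) := by
    intro s
    have h2 : l + 1 + i = 1 + (l - i) + 2 * i := by omega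
    rw [h2, div_pow, pow_add, pow_add, pow_mul]
    ring
  simp only [h1, intervalIntegral.integral_const_mul, integral_pow]
  rw [Nat.cast_choose ℝ hi, Nat.factorial_succ]
  have h3 := Nat.factorial_ne_zero i
  have h4 := Nat.factorial_ne_zero (l - i)
  have h5 : (l : ℝ) + 2 + i ≠ 0 := by positivity
  have h6 : ((l : ℝ) + 1 + i + 1) = l + 2 + i := by ring
  push_cast
  rw [h6]
  field_simp
  simp

/-- The canonical form is `k (k - 1) ∫∫ s f (∂_θ a, a, F_s, …, F_s) ds dθ` for `f` of degree
`k = l + 2`: expand `F_s = s da + s²/2 [a, a]` by the binomial formula and integrate over `s`. Here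
this is stated for exterior derivatives. -/
theorem extDeriv_canonicalOfFamily_eq_integral (f : InvPoly e G (l + 2)) (hV : IsOpen V)
    (ha : ContDiffOn ℝ ∞ (fun z : Euc n × ℝ => a z.2 z.1) (V ×ˢ univ)) {y : Euc n} (hy : y ∈ V)
    (T : ℝ) (w : Fin (2 * (l + 1) + 1) → Euc n) :
    extDeriv (canonicalOfFamily f a T) y w = (l + 2) * ∫ θ in (0 : ℝ)..T, ∫ s in (0 : ℝ)..1,
      (l + 1) * (s * extDeriv (fun y => f.oneOneTwo (deriv (fun t => a t y) θ) (a θ y)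
        (fun _ => scaledCurv a s θ y)) y w) := by
  set X : ℕ → ℝ → Euc n → Euc n [⋀^Fin (2 * (l + 1))]→L[ℝ] ℝ := fun i θ y =>
    f.oneOneTwo (deriv (fun t => a t y) θ) (a θ y)
          (fun j : Fin l => if (j : ℕ) < l - i then extDeriv (a θ) y
            else formBracket G (a θ y) (a θ y)) with hX
  have hXs : ∀ i, ContDiffOn ℝ ∞ (fun z : Euc n × ℝ => X i z.2 z.1) (V ×ˢ univ) :=
    contDiffOn_canonical_integrand f hV ha
  have hXd : ∀ i θ, DifferentiableAt ℝ (X i θ) y := fun i θ =>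
    (hasFDerivAt_fst_of_contDiffOn hV (hXs i) hy θ).differentiableAt
  -- the exterior derivative of a linear combination
  have hsumd : ∀ (s : Finset ℕ) (c : ℕ → ℝ) (Z : ℕ → Euc n → Euc n [⋀^Fin (2 * (l + 1))]→L[ℝ] ℝ),
      (∀ i, DifferentiableAt ℝ (Z i) y) →
      extDeriv (fun y => ∑ i ∈ s, c i • Z i y) y w = ∑ i ∈ s, c i * extDeriv (Z i) y w := by
    intro s c Z hZ
    have h : HasFDerivAt (fun y => ∑ i ∈ s, c i • Z i y) _ y :=
      HasFDerivAt.fun_sum fun i (_ : i ∈ s) => (hZ i).hasFDerivAt.const_smul (c i)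
    rw [extDeriv_apply_of_hasFDerivAt h w]
    simp only [fun i => extDeriv_apply_of_hasFDerivAt (hZ i).hasFDerivAt w, Finset.mul_sum]
    rw [Finset.sum_comm]
    refine Finset.sum_congr rfl fun i _ => ?_
    rw [sum_apply, ContinuousAlternatingMap.sum_apply, Finset.mul_sum]
    refine Finset.sum_congr rfl fun j _ => ?_
    exact mul_left_comm _ _ _
  have h1 : ∀ s θ, extDeriv (fun y => f.oneOneTwo (deriv (fun t => a t y) θ) (a θ y)
        (fun _ => scaledCurv a s θ y)) y w = ∑ i ∈ Finset.range (l + 1),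
      ((l.choose i : ℝ) * (s ^ (l - i) * (s ^ 2 / 2) ^ i)) * extDeriv (X i θ) y w := by
    intro s θ
    simp only [scaledCurv, f.oneOneTwo_smul_add_smul]
    exact hsumd _ _ _ fun i => hXd i θ
  have h2 : ∀ θ, (∫ s in (0 : ℝ)..1, (l + 1) * (s * extDeriv (fun y =>
      f.oneOneTwo (deriv (fun t => a t y) θ) (a θ y) (fun _ => scaledCurv a s θ y)) y w)) =
      ∑ i ∈ Finset.range (l + 1), ((l + 1 : ℝ) * ((l.choose i : ℝ) *
      ∫ s in (0 : ℝ)..1, s * (s ^ (l - i) * (s ^ 2 / 2) ^ i))) * extDeriv (X i θ) y w := by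
    intro θ
    have h3 : ∀ s : ℝ, (l + 1) * (s * extDeriv (fun y =>
      f.oneOneTwo (deriv (fun t => a t y) θ) (a θ y) (fun _ => scaledCurv a s θ y)) y w) =
      ∑ i ∈ Finset.range (l + 1), (((l + 1 : ℝ) * (l.choose i : ℝ) * extDeriv (X i θ) y w) *
        (s * (s ^ (l - i) * (s ^ 2 / 2) ^ i))) := by
      intro s
      rw [h1, Finset.mul_sum, Finset.mul_sum]
      refine Finset.sum_congr rfl fun i _ => ?_
      ring
    simp only [h3]
    rw [intervalIntegral.integral_finsetSum
      fun i _ => Continuous.intervalIntegrable (by fun_prop) _ _]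
    refine Finset.sum_congr rfl fun i _ => ?_
    rw [intervalIntegral.integral_const_mul]
    ring
  simp only [h2]
  rw [intervalIntegral.integral_finsetSum fun i _ => ((continuous_extDeriv_family hV (hXs i)
    hy w).const_mul _).intervalIntegrable _ _]
  have h4 : extDeriv (canonicalOfFamily f a T) y w = _ :=
    hsumd (Finset.range (l + 1)) _ (fun i y => ∫ θ in (0 : ℝ)..T, X i θ y)
      fun i => (hasFDerivAt_integral_of_contDiffOn hV (hXs i) 0 T hy).differentiableAt
  rw [h4, Finset.mul_sum]
  refine Finset.sum_congr rfl fun i hi => ?_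
  rw [extDeriv_integral hV (hXs i) hy, intervalIntegral.integral_const_mul,
    ← integral_mul_scale (Nat.lt_succ_iff.1 (Finset.mem_range.1 hi))]
  ring

/-- Joint smoothness in the time and the scale. -/
theorem contDiff_oneTwo_scaledCurv (f : InvPoly e G (l + 2)) (hV : IsOpen V)
    (ha : ContDiffOn ℝ ∞ (fun z : Euc n × ℝ => a z.2 z.1) (V ×ˢ univ)) {y : Euc n} (hy : y ∈ V)
    {α : ℝ → Euc n [⋀^Fin 1]→L[ℝ] LieAlg e G} (hα : ContDiff ℝ ∞ α)
    (w : Fin (2 * (l + 1) + 1) → Euc n) : ContDiff ℝ ∞ (fun x : ℝ × ℝ =>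
      InvPoly.oneTwo (k := l + 1) f (α x.1) (scaledCurv a x.2 x.1 y) w) := by
  have hslice : ∀ {F : Type} [NormedAddCommGroup F] [NormedSpace ℝ F] {g : Euc n × ℝ → F},
      ContDiffOn ℝ ∞ g (V ×ˢ univ) → ContDiff ℝ ∞ (fun x : ℝ × ℝ => g (y, x.1)) := by
    intro F _ _ g hg
    rw [← contDiffOn_univ]
    exact hg.comp (contDiff_const.prodMk contDiff_fst).contDiffOn fun x _ => ⟨hy, mem_univ _⟩
  have h1 : ContDiff ℝ ∞ (fun x : ℝ × ℝ => scaledCurv a x.2 x.1 y) :=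
    (contDiff_snd.smul (hslice (contDiffOn_extDeriv_family hV ha))).add
      (((contDiff_snd.pow 2).div_const 2).smul (hslice (contDiffOn_formBracket ha ha)))
  have h2 := contDiffOn_oneTwo (k := l + 1) f (hα.comp contDiff_fst).contDiffOn
    (contDiffOn_univ.2 h1)
  rw [contDiffOn_univ] at h2
  exact (ContinuousAlternatingMap.apply ℝ (Euc n) ℝ w).contDiff.comp h2

/-- The transgression formula: the integral of `f(∂_θ a, F, …, F)` along a path of connection
forms is the difference of the Chern-Simons forms of its ends, up to the exterior derivative of
the canonical form. -/
theorem InvPoly.extDeriv_canonicalOfFamily (f : InvPoly e G (l + 2)) (hV : IsOpen V)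
    (ha : ContDiffOn ℝ ∞ (fun z : Euc n × ℝ => a z.2 z.1) (V ×ˢ univ)) {y : Euc n} (hy : y ∈ V)
    (T : ℝ) (w : Fin (2 * (l + 1) + 1) → Euc n) :
    extDeriv (canonicalOfFamily f a T) y w = (l + 2) *
      ((∫ s in (0 : ℝ)..1, InvPoly.oneTwo (k := l + 1) f (a T y) (scaledCurv a s T y) w) -
        (∫ s in (0 : ℝ)..1, InvPoly.oneTwo (k := l + 1) f (a 0 y) (scaledCurv a s 0 y) w) -
        ∫ θ in (0 : ℝ)..T, InvPoly.oneTwo (k := l + 1) f (deriv (fun t => a t y) θ)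
          (scaledCurv a 1 θ y) w) := by
  rw [extDeriv_canonicalOfFamily_eq_integral f hV ha hy]
  congr 1
  have hα : ContDiff ℝ ∞ (fun θ => a θ y) := by
    rw [← contDiffOn_univ]
    exact ha.comp (contDiff_const.prodMk contDiff_id).contDiffOn fun x _ => ⟨hy, mem_univ _⟩
  have hα' : ContDiff ℝ ∞ (fun θ => deriv (fun t => a t y) θ) :=
    ((contDiff_infty_iff_deriv (f := fun θ => a θ y)).1 hα).2
  have hP := contDiff_oneTwo_scaledCurv f hV ha hy hα w
  have hQ := contDiff_snd.mul (contDiff_oneTwo_scaledCurv f hV ha hy hα' w)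
  set P : ℝ × ℝ → ℝ := fun x => InvPoly.oneTwo (k := l + 1) f (a x.1 y) (scaledCurv a x.2 x.1 y) w
    with hPdef
  set Q : ℝ × ℝ → ℝ := fun x => x.2 * InvPoly.oneTwo (k := l + 1) f (deriv (fun t => a t y) x.1)
    (scaledCurv a x.2 x.1 y) w with hQdef
  have hPd : Differentiable ℝ P := hP.differentiable (by simp)
  have hQd : Differentiable ℝ Q := hQ.differentiable (by simp)
  have h1 : ∀ θ s, (l + 1) * (s * extDeriv (fun y => f.oneOneTwo (deriv (fun t => a t y) θ) (a θ y)
        (fun _ => scaledCurv a s θ y)) y w) =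
      fderiv ℝ P (θ, s) (1, 0) + (-fderiv ℝ Q (θ, s)) (0, 1) := by
    intro θ s
    obtain ⟨p, q, hp, hq, h⟩ := f.exists_hasDerivAt_oneTwo hV ha hy s θ w
    have hp' := (hPd (θ, s)).hasFDerivAt.comp_hasDerivAt θ
      ((hasDerivAt_id θ).prodMk (hasDerivAt_const θ s))
    have hq' := (hQd (θ, s)).hasFDerivAt.comp_hasDerivAt s
      ((hasDerivAt_const s θ).prodMk (hasDerivAt_id s))
    rw [h, hp.unique hp', hq.unique hq', sub_eq_add_neg]
    rfl
  simp only [h1]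
  -- the divergence theorem on `[0, T] × [0, 1]`; `s f (∂a, F_s, …)` vanishes on the side `s = 0`
  rw [MeasureTheory.integral2_divergence_prod_of_hasFDerivAt P (fun x => -Q x) (fderiv ℝ P)
    (fun x => -fderiv ℝ Q x) 0 0 T 1 hP.continuous.continuousOn hQ.continuous.neg.continuousOn
    (fun x _ => (hPd x).hasFDerivAt) (fun x _ => (hQd x).hasFDerivAt.neg)]
  · simp only [hPdef, hQdef, intervalIntegral.integral_neg, one_mul, zero_mul,
      intervalIntegral.integral_zero]
    ring
  · refine ContinuousOn.integrableOn_compact (isCompact_uIcc.prod isCompact_uIcc) ?_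
    exact (((hP.continuous_fderiv (by simp)).clm_apply continuous_const).add
      ((hQ.continuous_fderiv (by simp)).neg.clm_apply continuous_const)).continuousOn

/-- The Chern-Simons form of a flat connection form `a` is a multiple of `f (a, [a, a], …, [a, a])`,
the factor being given by a Beta integral. -/
theorem InvPoly.integral_oneTwo_scaledCurv_of_flat (f : InvPoly e G (l + 2)) {T : ℝ} {y : Euc n}
    (hflat : scaledCurv a 1 T y = 0) (w : Fin (2 * (l + 1) + 1) → Euc n) :
    (l + 2) * ∫ s in (0 : ℝ)..1, InvPoly.oneTwo (k := l + 1) f (a T y) (scaledCurv a s T y) w =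
      ((-1 / 2 : ℝ) ^ (l + 1) * ((l + 2).factorial * (l + 1).factorial) /
        ((2 * (l + 1) + 1).factorial : ℝ)) *
      InvPoly.oneTwo (k := l + 1) f (a T y) (formBracket G (a T y) (a T y)) w := by
  -- flatness `da = -½ [a, a]` turns `F_s` into `-½ s (1 - s) [a, a]`
  have h1 : ∀ s : ℝ, scaledCurv a s T y =
      (-1 / 2 * (s * (1 - s))) • formBracket G (a T y) (a T y) := by
    intro s
    simp only [scaledCurv] at hflat ⊢
    linear_combination (norm := module) s • hflat
  have h2 : ∀ s : ℝ, InvPoly.oneTwo (k := l + 1) f (a T y) (scaledCurv a s T y) w =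
      ((-1 / 2) ^ (l + 1) * InvPoly.oneTwo (k := l + 1) f (a T y) (formBracket G (a T y) (a T y)) w)
        * (s ^ (l + 1) * (1 - s) ^ (l + 1)) := by
    intro s
    rw [h1, f.oneTwo_smul_right (k := l + 1), ContinuousAlternatingMap.smul_apply, smul_eq_mul,
      mul_pow, mul_pow]
    ring
  simp only [h2, intervalIntegral.integral_const_mul, integral_pow_mul_one_sub_pow]
  rw [Nat.factorial_succ (l + 1), show l + 1 + (l + 1) + 1 = 2 * (l + 1) + 1 by ring]
  push_cast
  ring

end Transgression

/-! ### Gauge transformations of families of connection forms -/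

section Gauge

variable {e n : ℕ} {G : Type*} [TopologicalSpace G] [ChartedSpace (Euc e) G] [Group G]

variable {k : ℕ}

theorem InvPoly.oneTwo_Ad {V : Type*} [AddCommGroup V] [Module ℝ V] [TopologicalSpace V]
    (f : InvPoly e G (k + 1)) (g : G) (β : V [⋀^Fin 1]→L[ℝ] LieAlg e G)
    (γ : V [⋀^Fin 2]→L[ℝ] LieAlg e G) :
    f.oneTwo ((Ad G g).compContinuousAlternatingMap β) ((Ad G g).compContinuousAlternatingMap γ) =
      f.oneTwo β γ := by
  ext1 w
  rw [InvPoly.oneTwo_apply, InvPoly.oneTwo_apply]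
  refine congrArg (fun T => _ * altSum T w) (funext fun w => ?_)
  refine Eq.trans ?_ (f.invariant g _)
  refine congrArg f.toMulti (funext fun i => ?_)
  refine Fin.cases ?_ (fun i => ?_) i <;> rfl

theorem InvPoly.oneTwo_neg_left {V : Type*} [AddCommGroup V] [Module ℝ V] [TopologicalSpace V]
    (f : InvPoly e G (k + 1)) (β : V [⋀^Fin 1]→L[ℝ] LieAlg e G)
    (γ : V [⋀^Fin 2]→L[ℝ] LieAlg e G) : f.oneTwo (-β) γ = -f.oneTwo β γ := by
  ext1 w
  rw [ContinuousAlternatingMap.neg_apply, InvPoly.oneTwo_apply, InvPoly.oneTwo_apply, ← mul_neg,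
    neg_eq_neg_one_mul (altSum _ _), ← altSum_mul_left (-1)]
  refine congrArg (fun T => _ * altSum T w) (funext fun w => ?_)
  have := f.toMulti.cons_smul (fun i : Fin k =>
      γ ![w ⟨2 * i + 1, by omega⟩, w ⟨2 * i + 2, by omega⟩])
    (-1 : ℝ) (β ![w ⟨0, by omega⟩])
  rw [smul_eq_mul, neg_one_smul] at this
  exact this

/-- The family of one-forms `Ad(g) (α - g⁻¹ dg)`, where `d` is the derivative in the direction of
`ℝⁿ` only. -/
def gaugeFamily (α : ℝ → Euc n → Euc n [⋀^Fin 1]→L[ℝ] LieAlg e G) (g : Euc n × ℝ → G) (θ : ℝ)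
    (y : Euc n) : Euc n [⋀^Fin 1]→L[ℝ] LieAlg e G :=
  (Ad G (g (y, θ))).compContinuousAlternatingMap
    (α θ y - oneForm (mcPullback G (fun z => g (z, θ)) y))

variable {V : Set (Euc n)} {α : ℝ → Euc n → Euc n [⋀^Fin 1]→L[ℝ] LieAlg e G} {g : Euc n × ℝ → G}

theorem gaugeFamily_apply {y : Euc n} {θ : ℝ}
    (hg : ContMDiffAt 𝓘(ℝ, Euc n × ℝ) (𝓡 e) ∞ g (y, θ)) (v : Euc n) :
    gaugeFamily α g θ y ![v] = Ad G (g (y, θ)) (familyMap α (y, θ) v - mc e g (y, θ) (v, 0)) := by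
  have h1 : mc e (fun z => g (z, θ)) y = (mc e g (y, θ)).comp (fderiv ℝ (fun z => (z, θ)) y) :=
    mc_comp (u := fun z : Euc n => (z, θ)) hg (by fun_prop)
  rw [(hasFDerivAt_prodMk_left y θ).fderiv] at h1
  have h2 : mc e (fun z => g (z, θ)) y v = mc e g (y, θ) (v, 0) := by rw [h1]; rfl
  rw [familyMap_apply, ← h2]
  rfl

variable [LieGroup (𝓡 e) ∞ G]

theorem contDiffOn_gaugeFamily (hV : IsOpen V)
    (hα : ContDiffOn ℝ ∞ (fun z : Euc n × ℝ => α z.2 z.1) (V ×ˢ univ))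
    (hg : ∀ z ∈ V ×ˢ (univ : Set ℝ), ContMDiffAt 𝓘(ℝ, Euc n × ℝ) (𝓡 e) ∞ g z) :
    ContDiffOn ℝ ∞ (fun z : Euc n × ℝ => gaugeFamily α g z.2 z.1) (V ×ˢ univ) := by
  rw [contDiffOn_continuousAlternatingMap_iff]
  intro w
  have hw : w = ![w 0] := by funext i; fin_cases i; rfl
  rw [hw]
  refine ContDiffOn.congr (f := fun z => Ad G (g z) (familyMap α z (w 0) - mc e g z (w 0, 0)))
    (fun z hz => ?_) fun z hz => gaugeFamily_apply (hg z hz) _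
  exact ((contDiffAt_Ad (hg z hz)).clm_apply (((contDiffAt_familyMap hV hα hz.1 z.2).clm_apply
    contDiffAt_const).sub ((contDiffAt_mc (hg z hz)).clm_apply contDiffAt_const))).contDiffWithinAt

/-- The derivative of `Ad(g) (α - g⁻¹ dg)` in a direction `ζ` of `ℝⁿ × ℝ`. -/
theorem fderiv_familyMap_gaugeFamily (hV : IsOpen V)
    (hα : ContDiffOn ℝ ∞ (fun z : Euc n × ℝ => α z.2 z.1) (V ×ˢ univ))
    (hg : ∀ z ∈ V ×ˢ (univ : Set ℝ), ContMDiffAt 𝓘(ℝ, Euc n × ℝ) (𝓡 e) ∞ g z) {y : Euc n}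
    (hy : y ∈ V) (θ : ℝ) (ζ : Euc n × ℝ) (v : Euc n) :
    fderiv ℝ (familyMap (gaugeFamily α g)) (y, θ) ζ v = Ad G (g (y, θ))
      (lieBracket G (mc e g (y, θ) ζ) (familyMap α (y, θ) v - mc e g (y, θ) (v, 0)) +
        (fderiv ℝ (familyMap α) (y, θ) ζ v - fderiv ℝ (mc e g) (y, θ) ζ (v, 0))) := by
  have hgz := hg (y, θ) ⟨hy, mem_univ _⟩
  have h1 : familyMap (gaugeFamily α g) =ᶠ[𝓝 (y, θ)] fun z =>
      (Ad G (g z)).comp (familyMap α z - (mc e g z).comp (.inl ℝ (Euc n) ℝ)) := by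
    filter_upwards [(hV.prod isOpen_univ).mem_nhds (⟨hy, mem_univ _⟩ : (y, θ) ∈ V ×ˢ univ)]
      with z hz
    ext1 v
    exact (familyMap_apply z.1 z.2 v).trans (gaugeFamily_apply (hg z hz) v)
  have h2 : HasFDerivAt (fun z => familyMap α z - (mc e g z).comp (.inl ℝ (Euc n) ℝ)) _ (y, θ) :=
    (((contDiffAt_familyMap hV hα hy θ).differentiableAt (by simp)).hasFDerivAt).sub
      (((contDiffAt_mc hgz).differentiableAt (by simp)).hasFDerivAt.clm_comp
        (hasFDerivAt_const _ _))
  have h3 := (hasFDerivAt_Ad hgz).clm_comp h2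
  rw [h1.fderiv_eq, h3.fderiv]
  simp only [← bracketCLM_apply]
  simp
  abel

/-- The time derivative of `a = Ad(g) (α - g⁻¹ dg)`, where `g⁻¹ ∂g = ξ`, is
`-Ad(g) (dξ + [α, ξ] - ∂α)`. -/
theorem deriv_gaugeFamily (hV : IsOpen V)
    (hα : ContDiffOn ℝ ∞ (fun z : Euc n × ℝ => α z.2 z.1) (V ×ˢ univ))
    (hg : ∀ z ∈ V ×ˢ (univ : Set ℝ), ContMDiffAt 𝓘(ℝ, Euc n × ℝ) (𝓡 e) ∞ g z)
    {ξ : Euc n × ℝ → LieAlg e G}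
    (hξ : ∀ z ∈ V ×ˢ (univ : Set ℝ), mc e g z (0, 1) = ξ z)
    {y : Euc n} (hy : y ∈ V) (θ : ℝ) :
    deriv (fun t => gaugeFamily α g t y) θ = -(Ad G (g (y, θ))).compContinuousAlternatingMap
      (oneForm (fderiv ℝ (fun z => ξ (z, θ)) y) +
        ((bracketCLM G).flip (ξ (y, θ))).compContinuousAlternatingMap (α θ y) -
        deriv (fun t => α t y) θ) := by
  have hgz := hg (y, θ) ⟨hy, mem_univ _⟩
  ext1 w
  have hw : w = ![w 0] := by funext i; fin_cases i; rfl
  rw [hw]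
  generalize w 0 = v
  rw [deriv_family_apply hV (contDiffOn_gaugeFamily hV hα hg) hy,
    fderiv_familyMap_gaugeFamily hV hα hg hy]
  have h1 : fderiv ℝ (fun z => ξ (z, θ)) y v = fderiv ℝ (mc e g) (y, θ) (v, 0) (0, 1) := by
    have h2 : (fun z => ξ (z, θ)) =ᶠ[𝓝 y] fun z => mc e g (z, θ) (0, 1) := by
      filter_upwards [hV.mem_nhds hy] with z hz using (hξ (z, θ) ⟨hz, mem_univ _⟩).symm
    have h3 := HasFDerivAt.comp (g := mc e g) (f := fun z => (z, θ)) y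
      ((contDiffAt_mc hgz).differentiableAt (by simp)).hasFDerivAt (hasFDerivAt_prodMk_left y θ)
    have h4 := h3.clm_apply (hasFDerivAt_const ((0 : Euc n), (1 : ℝ)) y)
    rw [h2.fderiv_eq]
    refine (congrArg (fun L : Euc n →L[ℝ] Euc e => L v) h4.fderiv).trans ?_
    simp
  -- the Maurer-Cartan equation exchanges the time derivative of `g⁻¹ dg` for the derivative of `ξ`
  have hmc := maurerCartan_equation hgz (0, 1) (v, 0)
  rw [hξ (y, θ) ⟨hy, mem_univ _⟩] at hmc ⊢
  have h5 : (-(Ad G (g (y, θ))).compContinuousAlternatingMap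
      (oneForm (fderiv ℝ (fun z => ξ (z, θ)) y) +
        ((bracketCLM G).flip (ξ (y, θ))).compContinuousAlternatingMap (α θ y) -
        deriv (fun t => α t y) θ)) ![v] = -Ad G (g (y, θ)) (fderiv ℝ (fun z => ξ (z, θ)) y v +
        bracketCLM G (α θ y ![v]) (ξ (y, θ)) - deriv (fun t => α t y) θ ![v]) := rfl
  rw [h5, deriv_family_apply hV hα hy, h1, ← map_neg]
  refine congrArg (Ad (e := e) G (g (y, θ))) ?_
  rw [← familyMap_apply]
  simp only [← bracketCLM_apply] at hmc ⊢
  rw [bracketCLM_antisymm (familyMap α (y, θ) v), map_sub]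
  linear_combination (norm := module) (-1 : ℝ) • hmc

/-- Curvature transforms by the adjoint action under gauge transformations. -/
theorem scaledCurv_gaugeFamily (hV : IsOpen V)
    (hα : ContDiffOn ℝ ∞ (fun z : Euc n × ℝ => α z.2 z.1) (V ×ˢ univ))
    (hg : ∀ z ∈ V ×ˢ (univ : Set ℝ), ContMDiffAt 𝓘(ℝ, Euc n × ℝ) (𝓡 e) ∞ g z)
    {y : Euc n} (hy : y ∈ V) (θ : ℝ) :
    scaledCurv (gaugeFamily α g) 1 θ y =
      (Ad G (g (y, θ))).compContinuousAlternatingMap (scaledCurv α 1 θ y) := by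
  have hgz := hg (y, θ) ⟨hy, mem_univ _⟩
  ext1 w
  have hw : w = ![w 0, w 1] := by funext i; fin_cases i <;> rfl
  rw [hw]
  generalize w 0 = u
  generalize w 1 = v
  rw [ContinuousLinearMap.compContinuousAlternatingMap_coe, Function.comp_apply,
    scaledCurv_apply hV (contDiffOn_gaugeFamily hV hα hg) hy, scaledCurv_apply hV hα hy]
  simp only [scaledCurvVal, fderiv_familyMap_gaugeFamily hV hα hg hy]
  have h1 : ∀ v, familyMap (gaugeFamily α g) (y, θ) v =
      Ad G (g (y, θ)) (familyMap α (y, θ) v - mc e g (y, θ) (v, 0)) := fun v =>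
    (familyMap_apply y θ v).trans (gaugeFamily_apply hgz v)
  rw [h1, h1, bracketCLM_apply, ← Ad_lieBracket, ← map_sub, ← map_smul, ← map_smul, ← map_add]
  refine congrArg (Ad (e := e) G (g (y, θ))) ?_
  have hmc := maurerCartan_equation hgz (u, 0) (v, 0)
  simp only [← bracketCLM_apply] at hmc ⊢
  simp only [map_sub, sub_apply]
  rw [bracketCLM_antisymm (mc e g (y, θ) (v, 0)) (familyMap α (y, θ) u),
    bracketCLM_antisymm (mc e g (y, θ) (v, 0)) (mc e g (y, θ) (u, 0))]
  linear_combination (norm := module) (-1 : ℝ) • hmc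

theorem formBracket_Ad {V : Type*} [AddCommGroup V] [Module ℝ V] [TopologicalSpace V]
    (g : G) (β γ : V [⋀^Fin 1]→L[ℝ] LieAlg e G) :
    formBracket G ((Ad G g).compContinuousAlternatingMap β)
      ((Ad G g).compContinuousAlternatingMap γ) =
      (Ad G g).compContinuousAlternatingMap (formBracket G β γ) := by
  ext1 w
  have hw : w = ![w 0, w 1] := by funext i; fin_cases i <;> rfl
  rw [hw, ContinuousLinearMap.compContinuousAlternatingMap_coe, Function.comp_apply,
    formBracket_apply, formBracket_apply, map_sub, Ad_lieBracket, Ad_lieBracket]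
  rfl

theorem formBracket_neg {V : Type*} [AddCommGroup V] [Module ℝ V] [TopologicalSpace V]
    (β : V [⋀^Fin 1]→L[ℝ] LieAlg e G) : formBracket G (-β) (-β) = formBracket G β β := by
  ext1 w
  have hw : w = ![w 0, w 1] := by funext i; fin_cases i <;> rfl
  rw [hw, formBracket_apply, formBracket_apply]
  simp only [← bracketCLM_apply, ContinuousAlternatingMap.neg_apply, map_neg,
    neg_apply, neg_neg]

end Gauge

/-! ### Naturality of the forms on plots -/

section Family

variable {e m n : ℕ} {U : Set (Euc m)} {V : Set (Euc n)} {φ : Euc n → Euc m}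
  {a : ℝ → Euc m → Euc m [⋀^Fin 1]→L[ℝ] Euc e}
  {a' : ℝ → Euc n → Euc n [⋀^Fin 1]→L[ℝ] Euc e}

theorem deriv_family_pullback (hU : IsOpen U)
    (ha : ContDiffOn ℝ ∞ (fun z : Euc m × ℝ => a z.2 z.1) (U ×ˢ univ)) {y : Euc n}
    (hy : φ y ∈ U)
    (h : ∀ θ, a' θ y = (a θ (φ y)).compContinuousLinearMap (fderiv ℝ φ y)) (θ : ℝ) :
    deriv (fun t => a' t y) θ =
      (deriv (fun t => a t (φ y)) θ).compContinuousLinearMap (fderiv ℝ φ y) := by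
  have h1 : DifferentiableAt ℝ (fun t => a t (φ y)) θ :=
    DifferentiableAt.comp (g := fun z : Euc m × ℝ => a z.2 z.1) (f := fun t : ℝ => (φ y, t)) θ
      (((ha (φ y, θ) ⟨hy, mem_univ _⟩).contDiffAt
        ((hU.prod isOpen_univ).mem_nhds ⟨hy, mem_univ _⟩)).differentiableAt (by simp))
      (by fun_prop)
  simp only [h]
  exact ((ContinuousAlternatingMap.compContinuousLinearMapCLM
    (fderiv ℝ φ y)).hasFDerivAt.comp_hasDerivAt θ h1.hasDerivAt).deriv

theorem extDeriv_family_pullback (hU : IsOpen U) (hV : IsOpen V)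
    (ha : ContDiffOn ℝ ∞ (fun z : Euc m × ℝ => a z.2 z.1) (U ×ˢ univ)) (hφ : ContDiffOn ℝ ∞ φ V)
    (hm : MapsTo φ V U)
    (h : ∀ θ, ∀ y ∈ V, a' θ y = (a θ (φ y)).compContinuousLinearMap (fderiv ℝ φ y)) (θ : ℝ)
    {y : Euc n} (hy : y ∈ V) :
    extDeriv (a' θ) y = (extDeriv (a θ) (φ y)).compContinuousLinearMap (fderiv ℝ φ y) := by
  have h1 : a' θ =ᶠ[𝓝 y] fun y => (a θ (φ y)).compContinuousLinearMap (fderiv ℝ φ y) := by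
    filter_upwards [hV.mem_nhds hy] with y hy using h θ y hy
  rw [h1.extDeriv_eq]
  exact extDeriv_pullback (hasFDerivAt_fst_of_contDiffOn hU ha (hm hy) θ).differentiableAt
    ((hφ y hy).contDiffAt (hV.mem_nhds hy))
    (by rw [minSmoothness_of_isRCLikeNormedField]; exact ENat.LEInfty.out)

end Family

section Pullback

variable {e : ℕ} {G : Type*} [TopologicalSpace G] [ChartedSpace (Euc e) G] [Group G]

section Linear

variable {V V' : Type*} [AddCommGroup V] [Module ℝ V] [TopologicalSpace V]
  [AddCommGroup V'] [Module ℝ V'] [TopologicalSpace V']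

theorem InvPoly.oneTwo_compContinuousLinearMap {k : ℕ} (f : InvPoly e G (k + 1))
    (α : V [⋀^Fin 1]→L[ℝ] LieAlg e G) (β : V [⋀^Fin 2]→L[ℝ] LieAlg e G) (L : V' →L[ℝ] V) :
    f.oneTwo (α.compContinuousLinearMap L) (β.compContinuousLinearMap L) =
      (f.oneTwo α β).compContinuousLinearMap L := by
  ext w
  rw [ContinuousAlternatingMap.compContinuousLinearMap_apply, InvPoly.oneTwo_apply,
    InvPoly.oneTwo_apply]
  refine congrArg (_ * ·) (Finset.sum_congr rfl fun σ _ => congrArg (_ * ·) ?_)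
  refine congrArg f.toMulti (funext fun i => ?_)
  refine Fin.cases ?_ (fun i => ?_) i
  · refine congrArg α (funext fun j => ?_)
    fin_cases j
    rfl
  · refine congrArg β (funext fun j => ?_)
    fin_cases j <;> rfl

theorem InvPoly.oneOneTwo_compContinuousLinearMap {l : ℕ} (f : InvPoly e G (l + 2))
    (α α' : V [⋀^Fin 1]→L[ℝ] LieAlg e G) (β : Fin l → V [⋀^Fin 2]→L[ℝ] LieAlg e G)
    (L : V' →L[ℝ] V) :
    f.oneOneTwo (α.compContinuousLinearMap L) (α'.compContinuousLinearMap L)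
      (fun j => (β j).compContinuousLinearMap L) =
      (f.oneOneTwo α α' β).compContinuousLinearMap L := by
  ext w
  rw [ContinuousAlternatingMap.compContinuousLinearMap_apply, InvPoly.oneOneTwo_apply,
    InvPoly.oneOneTwo_apply]
  refine congrArg (_ * ·) (Finset.sum_congr rfl fun σ _ => congrArg (_ * ·) ?_)
  refine congrArg f.toMulti (funext fun i => ?_)
  refine Fin.cases ?_ (fun i => Fin.cases ?_ (fun i => ?_) i) i
  · refine congrArg α (funext fun j => ?_)
    fin_cases j
    rfl
  · refine congrArg α' (funext fun j => ?_)
    fin_cases j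
    rfl
  · refine congrArg (β i) (funext fun j => ?_)
    fin_cases j <;> rfl

variable [LieGroup (𝓡 e) ∞ G]

theorem formBracket_compContinuousLinearMap (α β : V [⋀^Fin 1]→L[ℝ] LieAlg e G) (L : V' →L[ℝ] V) :
    formBracket G (α.compContinuousLinearMap L) (β.compContinuousLinearMap L) =
      (formBracket G α β).compContinuousLinearMap L := by
  ext1 w
  have h1 : ∀ u : V', (L ∘ ![u] : Fin 1 → V) = ![L u] := fun u => by
    funext j; fin_cases j; rfl
  have hw : w = ![w 0, w 1] := by funext i; fin_cases i <;> rfl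
  have h2 : (L ∘ w : Fin 2 → V) = ![L (w 0), L (w 1)] := by funext j; fin_cases j <;> rfl
  rw [ContinuousAlternatingMap.compContinuousLinearMap_apply, h2, hw, formBracket_apply,
    formBracket_apply]
  simp only [ContinuousAlternatingMap.compContinuousLinearMap_apply, h1, Matrix.cons_val_zero,
    Matrix.cons_val_one]

end Linear

variable {m n : ℕ} {U : Set (Euc m)} {V : Set (Euc n)} {φ : Euc n → Euc m}
  {a : ℝ → Euc m → Euc m [⋀^Fin 1]→L[ℝ] LieAlg e G}
  {a' : ℝ → Euc n → Euc n [⋀^Fin 1]→L[ℝ] LieAlg e G}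

variable [LieGroup (𝓡 e) ∞ G]

theorem scaledCurv_pullback (hU : IsOpen U) (hV : IsOpen V)
    (ha : ContDiffOn ℝ ∞ (fun z : Euc m × ℝ => a z.2 z.1) (U ×ˢ univ)) (hφ : ContDiffOn ℝ ∞ φ V)
    (hm : MapsTo φ V U)
    (h : ∀ θ, ∀ y ∈ V, a' θ y = (a θ (φ y)).compContinuousLinearMap (fderiv ℝ φ y)) (s θ : ℝ)
    {y : Euc n} (hy : y ∈ V) :
    scaledCurv a' s θ y = (scaledCurv a s θ (φ y)).compContinuousLinearMap (fderiv ℝ φ y) := by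
  rw [scaledCurv, extDeriv_family_pullback hU hV ha hφ hm h θ hy, h θ y hy,
    formBracket_compContinuousLinearMap]
  rfl

theorem intervalIntegral_compContinuousLinearMap {N : ℕ} {b : ℝ → Euc m [⋀^Fin N]→L[ℝ] ℝ}
    (hb : Continuous b) (S T : ℝ) (L : Euc n →L[ℝ] Euc m) :
    ∫ θ in S..T, (b θ).compContinuousLinearMap L =
      (∫ θ in S..T, b θ).compContinuousLinearMap L :=
  (ContinuousAlternatingMap.compContinuousLinearMapCLM L).intervalIntegral_comp_comm
    (hb.intervalIntegrable _ _)

/-- The canonical form of a family that is pulled back along `φ`, uniformly in the time, is pulled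
back along `φ`. -/
theorem canonicalOfFamily_pullback {l : ℕ} (f : InvPoly e G (l + 2)) (hU : IsOpen U)
    (hV : IsOpen V)
    (ha : ContDiffOn ℝ ∞ (fun z : Euc m × ℝ => a z.2 z.1) (U ×ˢ univ)) (hφ : ContDiffOn ℝ ∞ φ V)
    (hm : MapsTo φ V U)
    (h : ∀ θ, ∀ y ∈ V, a' θ y = (a θ (φ y)).compContinuousLinearMap (fderiv ℝ φ y)) (T : ℝ)
    {y : Euc n} (hy : y ∈ V) :
    canonicalOfFamily f a' T y =
      (canonicalOfFamily f a T (φ y)).compContinuousLinearMap (fderiv ℝ φ y) := by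
  have h0 : (canonicalOfFamily f a T (φ y)).compContinuousLinearMap (fderiv ℝ φ y) =
    ContinuousAlternatingMap.compContinuousLinearMapCLM (fderiv ℝ φ y)
      (canonicalOfFamily f a T (φ y)) := rfl
  rw [h0, canonicalOfFamily, canonicalOfFamily, map_sum]
  refine Finset.sum_congr rfl fun i _ => ?_
  rw [map_smul]
  congr 1
  have hc := continuous_slice_of_contDiffOn (contDiffOn_canonical_integrand f hU ha i) (hm hy)
  refine Eq.trans ?_ (intervalIntegral_compContinuousLinearMap hc 0 T (fderiv ℝ φ y))
  refine congrArg (fun F : ℝ → Euc n [⋀^Fin (2 * (l + 1))]→L[ℝ] ℝ => ∫ θ in (0 : ℝ)..T, F θ)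
    (funext fun θ => ?_)
  rw [← InvPoly.oneOneTwo_compContinuousLinearMap]
  rw [deriv_family_pullback hU ha (hm hy) (fun θ => h θ y hy), h θ y hy,
    extDeriv_family_pullback hU hV ha hφ hm h θ hy, formBracket_compContinuousLinearMap]
  refine congrArg (f.oneOneTwo _ _) (funext fun j => ?_)
  split_ifs <;> rfl

theorem integral_oneTwo_pullback {k : ℕ} (f : InvPoly e G (k + 1)) (hU : IsOpen U)
    (hV : IsOpen V)
    (ha : ContDiffOn ℝ ∞ (fun z : Euc m × ℝ => a z.2 z.1) (U ×ˢ univ)) (hφ : ContDiffOn ℝ ∞ φ V)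
    (hm : MapsTo φ V U)
    (h : ∀ θ, ∀ y ∈ V, a' θ y = (a θ (φ y)).compContinuousLinearMap (fderiv ℝ φ y)) (T : ℝ)
    {y : Euc n} (hy : y ∈ V) :
    ∫ θ in (0 : ℝ)..T, f.oneTwo (deriv (fun t => a' t y) θ) (scaledCurv a' 1 θ y) =
      (∫ θ in (0 : ℝ)..T, f.oneTwo (deriv (fun t => a t (φ y)) θ)
        (scaledCurv a 1 θ (φ y))).compContinuousLinearMap (fderiv ℝ φ y) := by
  have hc := continuous_slice_of_contDiffOn (contDiffOn_oneTwo f (contDiffOn_deriv_family hU ha)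
    (contDiffOn_scaledCurv hU ha 1)) (hm hy)
  rw [← intervalIntegral_compContinuousLinearMap hc]
  simp only [deriv_family_pullback hU ha (hm hy) (fun θ => h θ y hy),
    scaledCurv_pullback hU hV ha hφ hm h _ _ hy, InvPoly.oneTwo_compContinuousLinearMap]

end Pullback

/-! ### Transgression along a gauge transformation -/

section GaugeTransgression

variable {e n : ℕ} {G : Type*} [TopologicalSpace G] [ChartedSpace (Euc e) G] [Group G]

theorem InvPoly.oneTwo_zero_apply {V : Type*} [AddCommGroup V] [Module ℝ V] [TopologicalSpace V]
    (f : InvPoly e G (0 + 1)) (α : V [⋀^Fin 1]→L[ℝ] LieAlg e G)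
    (β : V [⋀^Fin 2]→L[ℝ] LieAlg e G) (w : Fin (2 * 0 + 1) → V) :
    f.oneTwo α β w = f.toMulti fun _ => α ![w 0] := by
  rw [InvPoly.oneTwo_apply, altSum]
  have : (Finset.univ : Finset (Equiv.Perm (Fin (2 * 0 + 1)))) = {1} := by decide
  rw [this, Finset.sum_singleton]
  simp only [pow_zero, Equiv.Perm.sign_one, Units.val_one, Int.cast_one, one_mul]
  refine congrArg f.toMulti (funext fun i => ?_)
  exact Fin.cases rfl (fun i => i.elim0) i

variable {V : Set (Euc n)}

/-- The case of a linear form `f`, where `f (∂_θ a)` is the derivative of `f (a)`; the two-forms `β`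
do not occur in the integrand. -/
theorem InvPoly.integral_oneTwo_zero (f : InvPoly e G (0 + 1))
    {a : ℝ → Euc n → Euc n [⋀^Fin 1]→L[ℝ] LieAlg e G}
    (ha : ContDiffOn ℝ ∞ (fun z : Euc n × ℝ => a z.2 z.1) (V ×ˢ univ)) {y : Euc n} (hy : y ∈ V)
    (T : ℝ) (β : ℝ → Euc n [⋀^Fin 2]→L[ℝ] LieAlg e G) (w : Fin (2 * 0 + 1) → Euc n) :
    ∫ θ in (0 : ℝ)..T, f.oneTwo (deriv (fun t => a t y) θ) (β θ) w =
      f.oneTwo (a T y) (β T) w - f.oneTwo (a 0 y) (β 0) w := by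
  simp only [f.oneTwo_zero_apply]
  have hα : ContDiff ℝ ∞ (fun θ => a θ y) := by
    rw [← contDiffOn_univ]
    exact ha.comp (contDiff_const.prodMk contDiff_id).contDiffOn fun x _ => ⟨hy, mem_univ _⟩
  have hα' : ContDiff ℝ ∞ (fun θ => deriv (fun t => a t y) θ) :=
    ((contDiff_infty_iff_deriv (f := fun θ => a θ y)).1 hα).2
  -- `f` as a linear form
  let F : LieAlg e G →L[ℝ] ℝ := f.toMulti.toContinuousLinearMap (fun _ => 0) 0
  have hF : ∀ X, f.toMulti (fun _ => X) = F X := fun X => by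
    refine congrArg f.toMulti (funext fun i => ?_)
    refine Fin.cases ?_ (fun i => i.elim0) i
    simp
  simp only [hF]
  let ev := ContinuousAlternatingMap.apply ℝ (Euc n) (LieAlg e G) ![w 0]
  refine intervalIntegral.integral_eq_sub_of_hasDerivAt (f := fun θ => F (ev (a θ y)))
    (f' := fun θ => F (ev (deriv (fun t => a t y) θ))) (fun θ _ => ?_)
    ((F.continuous.comp (ev.continuous.comp hα'.continuous)).intervalIntegrable _ _)
  exact F.hasFDerivAt.comp_hasDerivAt θ (ev.hasFDerivAt.comp_hasDerivAt θ
    (hα.differentiable (by simp) θ).hasDerivAt)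

variable {α : ℝ → Euc n → Euc n [⋀^Fin 1]→L[ℝ] LieAlg e G} {g : Euc n × ℝ → G}

/-- Where `α` vanishes, the transformed form is `-Ad(g) g⁻¹ dg = -dg g⁻¹`. -/
theorem gaugeFamily_of_eq_zero {θ : ℝ} {y : Euc n} (h : α θ y = 0) :
    gaugeFamily α g θ y = -(Ad G (g (y, θ))).compContinuousAlternatingMap
      (oneForm (mcPullback G (fun z => g (z, θ)) y)) := by
  ext1 w
  rw [gaugeFamily, h, zero_sub]
  exact map_neg (Ad G (g (y, θ))) _

theorem gaugeFamily_zero (hV : IsOpen V) {y : Euc n} (hy : y ∈ V) [LieGroup (𝓡 e) ∞ G]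
    (h : α 0 y = 0) (hg0 : ∀ y ∈ V, g (y, 0) = 1) : gaugeFamily α g 0 y = 0 := by
  have h1 : mc e (fun z => g (z, 0)) y = 0 :=
    (mc_congr (by filter_upwards [hV.mem_nhds hy] with z hz using hg0 z hz)).trans (mc_const 1 y)
  ext1 w
  rw [gaugeFamily_of_eq_zero h, mcPullback_eq_mc, h1]
  have h2 : (-(Ad G (g (y, 0))).compContinuousAlternatingMap
      (oneForm (0 : Euc n →L[ℝ] LieAlg e G))) w = -Ad G (g (y, 0)) 0 := rfl
  rw [h2, map_zero, neg_zero]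
  rfl

theorem InvPoly.oneTwo_zero_left {V : Type*} [AddCommGroup V] [Module ℝ V] [TopologicalSpace V]
    {k : ℕ} (f : InvPoly e G (k + 1)) (β : V [⋀^Fin 2]→L[ℝ] LieAlg e G)
    (w : Fin (2 * k + 1) → V) : f.oneTwo 0 β w = 0 := by
  have h := congrArg (· w) (f.oneTwo_neg_left 0 β)
  simp only [neg_zero, ContinuousAlternatingMap.neg_apply] at h
  exact self_eq_neg.1 h

variable [LieGroup (𝓡 e) ∞ G]

theorem scaledCurv_eq_zero (hV : IsOpen V) {θ : ℝ} (h : ∀ y ∈ V, α θ y = 0) {y : Euc n}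
    (hy : y ∈ V) : scaledCurv α 1 θ y = 0 := by
  have h1 : α θ =ᶠ[𝓝 y] (0 : Euc n → Euc n [⋀^Fin 1]→L[ℝ] LieAlg e G) := by
    filter_upwards [hV.mem_nhds hy] with y hy using h y hy
  have h2 : ∀ w, formBracket G (α θ y) (α θ y) w = 0 := by
    intro w
    have hw : w = ![w 0, w 1] := by funext i; fin_cases i <;> rfl
    rw [hw, formBracket_apply, ← bracketCLM_apply, ← bracketCLM_apply, h y hy]
    simp
  have h3 : ∀ w, extDeriv (α θ) y w = 0 := by
    intro w
    have := extDeriv_fun_smul (x := y) (0 : ℝ) fun _ : Euc n => (0 : Euc n [⋀^Fin 1]→L[ℝ] Euc e)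
    simp only [zero_smul] at this
    rw [h1.extDeriv_eq]
    exact congrArg (· w) this
  ext1 w
  rw [scaledCurv, ContinuousAlternatingMap.add_apply, ContinuousAlternatingMap.smul_apply,
    ContinuousAlternatingMap.smul_apply, h2, h3, smul_zero, smul_zero, add_zero]
  rfl

theorem InvPoly.oneTwo_gaugeFamily_of_eq_zero {k : ℕ} (f : InvPoly e G (k + 1)) {θ : ℝ} {y : Euc n}
    (h : α θ y = 0) :
    f.oneTwo (gaugeFamily α g θ y) (formBracket G (gaugeFamily α g θ y) (gaugeFamily α g θ y)) =
      -f.oneTwo (oneForm (mcPullback G (fun z => g (z, θ)) y))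
        (formBracket G (oneForm (mcPullback G (fun z => g (z, θ)) y))
          (oneForm (mcPullback G (fun z => g (z, θ)) y))) := by
  rw [gaugeFamily_of_eq_zero h, formBracket_neg, f.oneTwo_neg_left, formBracket_Ad, f.oneTwo_Ad]

/-- The transgression formula for the path of connection forms from `0` to the flat connection
form `-dg g⁻¹`. -/
theorem InvPoly.integral_oneTwo_gaugeFamily {l : ℕ} (f : InvPoly e G (l + 2)) (hV : IsOpen V)
    (hα : ContDiffOn ℝ ∞ (fun z : Euc n × ℝ => α z.2 z.1) (V ×ˢ univ))
    (hg : ∀ z ∈ V ×ˢ (univ : Set ℝ), ContMDiffAt 𝓘(ℝ, Euc n × ℝ) (𝓡 e) ∞ g z)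
    {T : ℝ} (h0 : ∀ y ∈ V, α 0 y = 0) (hT : ∀ y ∈ V, α T y = 0) (hg0 : ∀ y ∈ V, g (y, 0) = 1)
    {y : Euc n} (hy : y ∈ V) (w : Fin (2 * (l + 1) + 1) → Euc n) :
    (l + 2) * ∫ θ in (0 : ℝ)..T, InvPoly.oneTwo (k := l + 1) f
      (deriv (fun t => gaugeFamily α g t y) θ) (scaledCurv (gaugeFamily α g) 1 θ y) w =
    -(((-1 / 2 : ℝ) ^ (l + 1) * ((l + 2).factorial * (l + 1).factorial) /
        ((2 * (l + 1) + 1).factorial : ℝ)) *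
      InvPoly.oneTwo (k := l + 1) f (oneForm (mcPullback G (fun z => g (z, T)) y))
        (formBracket G (oneForm (mcPullback G (fun z => g (z, T)) y))
          (oneForm (mcPullback G (fun z => g (z, T)) y))) w) -
      extDeriv (canonicalOfFamily f (gaugeFamily α g) T) y w := by
  have ha := contDiffOn_gaugeFamily hV hα hg
  rw [f.extDeriv_canonicalOfFamily hV ha hy, mul_sub, mul_sub]
  have hflat : scaledCurv (gaugeFamily α g) 1 T y = 0 := by
    rw [scaledCurv_gaugeFamily hV hα hg hy, scaledCurv_eq_zero hV hT hy]
    ext1 w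
    exact map_zero (Ad G (g (y, T)))
  rw [f.integral_oneTwo_scaledCurv_of_flat hflat, gaugeFamily_zero hV hy (h0 y hy) hg0,
    InvPoly.oneTwo_gaugeFamily_of_eq_zero (k := l + 1) f (hT y hy)]
  simp only [InvPoly.oneTwo_zero_left (k := l + 1) f, intervalIntegral.integral_zero,
    ContinuousAlternatingMap.neg_apply]
  ring

/-- The linear case of `InvPoly.integral_oneTwo_gaugeFamily`. -/
theorem InvPoly.integral_oneTwo_gaugeFamily_zero (f : InvPoly e G (0 + 1)) (hV : IsOpen V)
    (hα : ContDiffOn ℝ ∞ (fun z : Euc n × ℝ => α z.2 z.1) (V ×ˢ univ))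
    (hg : ∀ z ∈ V ×ˢ (univ : Set ℝ), ContMDiffAt 𝓘(ℝ, Euc n × ℝ) (𝓡 e) ∞ g z)
    {T : ℝ} (h0 : ∀ y ∈ V, α 0 y = 0) (hT : ∀ y ∈ V, α T y = 0) (hg0 : ∀ y ∈ V, g (y, 0) = 1)
    {y : Euc n} (hy : y ∈ V) (β : ℝ → Euc n [⋀^Fin 2]→L[ℝ] LieAlg e G)
    (w : Fin (2 * 0 + 1) → Euc n) :
    ∫ θ in (0 : ℝ)..T, f.oneTwo (deriv (fun t => gaugeFamily α g t y) θ) (β θ) w =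
    -f.oneTwo (oneForm (mcPullback G (fun z => g (z, T)) y))
        (formBracket G (oneForm (mcPullback G (fun z => g (z, T)) y))
          (oneForm (mcPullback G (fun z => g (z, T)) y))) w := by
  rw [f.integral_oneTwo_zero (contDiffOn_gaugeFamily hV hα hg) hy,
    gaugeFamily_zero hV hy (h0 y hy) hg0, f.oneTwo_zero_left, sub_zero,
    ← ContinuousAlternatingMap.neg_apply, ← f.oneTwo_gaugeFamily_of_eq_zero (hT y hy)]
  simp only [f.oneTwo_zero_apply]

end GaugeTransgression

/-! ### Plots of loop bundles -/

section Plots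

variable {e d : ℕ} {G : Type*} [TopologicalSpace G] [ChartedSpace (Euc e) G] [Group G]
  [LieGroup (𝓡 e) ∞ G] {M Q : Type*} [TopologicalSpace M] [ChartedSpace (Euc d) M]

theorem smoothLoopsOn_iff {n : ℕ} {V : Set (Euc n)} {γ : Euc n → LoopGroup e G} :
    SmoothLoopsOn n V γ ↔ ContMDiffOn 𝓘(ℝ, Euc n × ℝ) (𝓡 e) ∞
      (fun z : Euc n × ℝ => (γ z.1 : ℝ → G) z.2) (V ×ˢ univ) := by
  rw [SmoothLoopsOn, modelWithCornersSelf_prod, chartedSpaceSelf_prod]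

variable (B : LoopBundle e d G M Q)

open Classical in
/-- The loop that moves `q` to `q'`, for two points of the same fibre. -/
def LoopBundle.translation (q q' : Q) : LoopGroup e G :=
  if h : B.proj q = B.proj q' then (B.transitive q q' h).choose else 1

variable {B}

theorem LoopBundle.act_translation {q q' : Q} (h : B.proj q = B.proj q') :
    B.act q (B.translation q q') = q' := by
  rw [LoopBundle.translation, dif_pos h]
  exact (B.transitive q q' h).choose_spec

theorem LoopBundle.act_injective {q : Q} {γ γ' : LoopGroup e G} (h : B.act q γ = B.act q γ') :
    γ = γ' := by
  have h1 : B.act q (γ * γ'⁻¹) = q := by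
    rw [B.act_mul, h, ← B.act_mul, mul_inv_cancel, B.act_one]
  exact mul_inv_eq_one.1 (B.free _ _ h1)

theorem LoopBundle.smoothLoopsOn_translation_sec (x x' : M) :
    SmoothLoopsOn d (B.base x ∩ B.base x') fun m => B.translation (B.sec x m) (B.sec x' m) :=
  B.smooth_transition x x' _ fun _ hm => LoopBundle.act_translation
    ((B.proj_sec _ _ hm.1).trans (B.proj_sec _ _ hm.2).symm)

/-- A map that is smooth in one local trivialisation is a plot. -/
theorem LoopBundle.isPlotOn_act_sec {n : ℕ} {V : Set (Euc n)} {p : Euc n → Q} (hV : IsOpen V)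
    {μ : Euc n → M} (hμ : ContMDiffOn (𝓡 n) (𝓡 d) ∞ μ V) {x : M} (hx : MapsTo μ V (B.base x))
    {γ : Euc n → LoopGroup e G} (hγ : SmoothLoopsOn n V γ)
    (hp : ∀ y ∈ V, p y = B.act (B.sec x (μ y)) (γ y)) : B.IsPlotOn V p := by
  have hproj : ∀ y ∈ V, B.proj (p y) = μ y := fun y hy => by
    rw [hp y hy, B.proj_act, B.proj_sec _ _ (hx hy)]
  refine ⟨hV, hμ.congr hproj, fun x' γ' h => ?_⟩
  have hmap : ContMDiffOn ((𝓡 n).prod 𝓘(ℝ, ℝ)) ((𝓡 d).prod 𝓘(ℝ, ℝ)) ∞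
      (fun z : Euc n × ℝ => (μ z.1, z.2)) (V ×ˢ univ) :=
    (hμ.comp contMDiff_fst.contMDiffOn (fun z hz => hz.1)).prodMk contMDiff_snd.contMDiffOn
  -- in another trivialisation the fibre component is the transition loop times `γ`
  have h1 := ContMDiffOn.comp (t := (B.base x' ∩ B.base x) ×ˢ univ)
    (s := (V ∩ {y | B.proj (p y) ∈ B.base x'}) ×ˢ univ)
    (LoopBundle.smoothLoopsOn_translation_sec (B := B) x' x)
    (hmap.mono (prod_mono inter_subset_left le_rfl)) (fun z hz => ⟨⟨by
      have := hz.1.2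
      rw [mem_ofPred_eq, hproj _ hz.1.1] at this
      exact this, hx hz.1.1⟩, mem_univ _⟩)
  have h2 := ContMDiffOn.mono hγ (t := (V ∩ {y | B.proj (p y) ∈ B.base x'}) ×ˢ univ)
    (prod_mono inter_subset_left le_rfl)
  refine (h1.mul h2).congr fun z hz => ?_
  have h3 : γ' z.1 = B.translation (B.sec x' (μ z.1)) (B.sec x (μ z.1)) * γ z.1 := by
    have hb : μ z.1 ∈ B.base x' := by
      have := hz.1.2
      rwa [mem_ofPred_eq, hproj _ hz.1.1] at this
    refine LoopBundle.act_injective (B := B) (q := B.sec x' (μ z.1)) ?_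
    have h4 := h z.1 hz.1
    rw [hproj _ hz.1.1] at h4
    rw [h4, B.act_mul, LoopBundle.act_translation
      ((B.proj_sec _ _ hb).trans (B.proj_sec _ _ (hx hz.1.1)).symm), ← hp _ hz.1.1]
  rw [h3]
  rfl

theorem smoothLoopsOn_const {n : ℕ} (V : Set (Euc n)) (γ : LoopGroup e G) :
    SmoothLoopsOn n V fun _ => γ :=
  (γ.2.1.comp contMDiff_snd).contMDiffOn

theorem LoopBundle.isPlotOn_const {n : ℕ} (q : Q) : B.IsPlotOn univ fun _ : Euc n => q :=
  LoopBundle.isPlotOn_act_sec isOpen_univ contMDiffOn_const (fun _ _ => B.mem_base (B.proj q))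
    (smoothLoopsOn_const _ (B.translation (B.sec (B.proj q) (B.proj q)) q))
    fun _ _ => (LoopBundle.act_translation (B.proj_sec _ _ (B.mem_base _))).symm

/-- The local section over `base x`, read in the chart at `x'`. -/
def LoopBundle.secPlot (B : LoopBundle e d G M Q) (x x' : M) (y : Euc d) : Q :=
  B.sec x ((extChartAt (𝓡 d) x').symm y)

/-- The domain of the plot `secPlot`. -/
def LoopBundle.secDomain (B : LoopBundle e d G M Q) (x x' : M) : Set (Euc d) :=
  (extChartAt (𝓡 d) x').target ∩ (extChartAt (𝓡 d) x').symm ⁻¹' B.base x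

theorem LoopBundle.isOpen_secDomain (x x' : M) : IsOpen (B.secDomain x x') :=
  (continuousOn_extChartAt_symm x').isOpen_inter_preimage (isOpen_extChartAt_target x')
    (B.isOpen_base x)

theorem LoopBundle.mem_secDomain (x : M) : extChartAt (𝓡 d) x x ∈ B.secDomain x x :=
  ⟨mem_extChartAt_target x, by
    rw [mem_preimage, extChartAt_to_inv]
    exact B.mem_base x⟩

theorem LoopBundle.proj_secPlot {x x' : M} {y : Euc d} (hy : y ∈ B.secDomain x x') :
    B.proj (B.secPlot x x' y) = (extChartAt (𝓡 d) x').symm y :=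
  B.proj_sec _ _ hy.2

theorem LoopBundle.isPlotOn_secPlot [IsManifold (𝓡 d) ∞ M] (x x' : M) :
    B.IsPlotOn (B.secDomain x x') (B.secPlot x x') :=
  LoopBundle.isPlotOn_act_sec (B.isOpen_secDomain x x')
    ((contMDiffOn_extChartAt_symm x').mono inter_subset_left) (fun _ hy => hy.2)
    (smoothLoopsOn_const _ 1) fun _ _ => (B.act_one _).symm

theorem LoopBundle.IsPlotOn.isOpen_inter_base {n : ℕ} {V : Set (Euc n)} {p : Euc n → Q}
    (hp : B.IsPlotOn V p) (x : M) : IsOpen (V ∩ {y | B.proj (p y) ∈ B.base x}) :=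
  hp.smooth_proj.continuousOn.isOpen_inter_preimage hp.isOpen (B.isOpen_base x)

theorem LoopBundle.IsPlotOn.smoothLoopsOn_translation {n : ℕ} {V : Set (Euc n)} {p : Euc n → Q}
    (hp : B.IsPlotOn V p) (x : M) : SmoothLoopsOn n (V ∩ {y | B.proj (p y) ∈ B.base x})
      fun y => B.translation (B.sec x (B.proj (p y))) (p y) :=
  hp.smooth_fibre x _ fun _ hy => LoopBundle.act_translation (B.proj_sec _ _ hy.2)

/-- The transformation law of connection forms: if `p = s(φ) γ`, then
`p^* A = Ad(γ⁻¹) φ^* s^* A + γ⁻¹ dγ`. It follows by restricting the form to the plot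
`(u, z) ↦ s(u) γ(z)`, whose two partial derivatives are given by equivariance and verticality. -/
theorem LoopConnection.form_gauge (A : LoopConnection B) {m n : ℕ} {p : Euc n → Q} {s : Euc m → Q}
    {U : Set (Euc m)} {V : Set (Euc n)} {φ : Euc n → Euc m} {γ : Euc n → LoopGroup e G}
    (hs : B.IsPlotOn U s) (hV : IsOpen V) (hφ : ContDiffOn ℝ ∞ φ V) (hm : MapsTo φ V U)
    (hγ : SmoothLoopsOn n V γ) (hp : ∀ y ∈ V, p y = B.act (s (φ y)) (γ y)) (θ : ℝ) {y : Euc n}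
    (hy : y ∈ V) :
    A.form p θ y = (Ad G ((γ y : ℝ → G) θ)⁻¹).compContinuousAlternatingMap
      ((A.form s θ (φ y)).compContinuousLinearMap (fderiv ℝ φ y)) +
      oneForm (mcPullback G (fun z => (γ z : ℝ → G) θ) y) := by
  set x := B.proj (s (φ y)) with hx
  set U' := U ∩ {u | B.proj (s u) ∈ B.base x} with hU'
  have hU'o : IsOpen U' := hs.isOpen_inter_base x
  have hφy : φ y ∈ U' := ⟨hm hy, B.mem_base x⟩
  let ε : (Euc m × Euc n) ≃L[ℝ] Euc (m + n) :=
    ContinuousLinearEquiv.ofFinrankEq (by simp)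
  set W : Set (Euc (m + n)) := ε.symm ⁻¹' (U' ×ˢ V) with hW
  have hWo : IsOpen W := (hU'o.prod hV).preimage ε.symm.continuous
  have hsm₁ : ContMDiff (𝓡 (m + n)) (𝓡 m) ∞ fun ζ => (ε.symm ζ).1 :=
    (contDiff_fst.comp ε.symm.contDiff).contMDiff
  have hsm₂ : ContMDiff (𝓡 (m + n)) (𝓡 n) ∞ fun ζ => (ε.symm ζ).2 :=
    (contDiff_snd.comp ε.symm.contDiff).contMDiff
  -- the product plot `(u, z) ↦ s(u) γ(z)`
  have hP : B.IsPlotOn W fun ζ => B.act (s (ε.symm ζ).1) (γ (ε.symm ζ).2) := by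
    refine LoopBundle.isPlotOn_act_sec (x := x) (μ := fun ζ => B.proj (s (ε.symm ζ).1))
      (γ := fun ζ => B.translation (B.sec x (B.proj (s (ε.symm ζ).1))) (s (ε.symm ζ).1) *
        γ (ε.symm ζ).2) hWo ?_ (fun ζ hζ => hζ.1.2) ?_ ?_
    · exact hs.smooth_proj.comp hsm₁.contMDiffOn fun ζ hζ => hζ.1.1
    · have hmap₁ : ContMDiffOn ((𝓡 (m + n)).prod 𝓘(ℝ, ℝ)) ((𝓡 m).prod 𝓘(ℝ, ℝ)) ∞
          (fun z : Euc (m + n) × ℝ => ((ε.symm z.1).1, z.2)) (W ×ˢ univ) :=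
        ((hsm₁.comp contMDiff_fst).prodMk contMDiff_snd).contMDiffOn
      have hmap₂ : ContMDiffOn ((𝓡 (m + n)).prod 𝓘(ℝ, ℝ)) ((𝓡 n).prod 𝓘(ℝ, ℝ)) ∞
          (fun z : Euc (m + n) × ℝ => ((ε.symm z.1).2, z.2)) (W ×ˢ univ) :=
        ((hsm₂.comp contMDiff_fst).prodMk contMDiff_snd).contMDiffOn
      exact (ContMDiffOn.comp (hs.smoothLoopsOn_translation x) hmap₁
        fun z hz => ⟨hz.1.1, mem_univ _⟩).mul (ContMDiffOn.comp hγ hmap₂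
          fun z hz => ⟨hz.1.2, mem_univ _⟩)
    · intro ζ hζ
      rw [B.act_mul, LoopBundle.act_translation (B.proj_sec _ _ hζ.1.2)]
  set N := V ∩ φ ⁻¹' U' with hN
  have hNo : IsOpen N := hφ.continuousOn.isOpen_inter_preimage hV hU'o
  have e1 := A.comp _ W p N (fun z => ε (φ z, z)) hP hNo
    (ε.contDiff.comp_contDiffOn ((hφ.mono inter_subset_left).prodMk contDiffOn_id))
    (fun z hz => by simpa [hW] using ⟨hz.2, hz.1⟩) (fun z hz => by simpa using hp z hz.1) θ y
    ⟨hy, hφy⟩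
  have e2 := A.comp _ W (fun u => B.act (s u) (γ y)) U' (fun u => ε (u, y)) hP hU'o
    (ε.contDiff.comp (contDiff_id.prodMk contDiff_const)).contDiffOn
    (fun z hz => by simpa [hW] using ⟨hz, hy⟩) (fun z hz => by simp) θ (φ y) hφy
  have e3 := A.comp _ W (fun z => B.act (s (φ y)) (γ z)) V (fun z => ε (φ y, z)) hP hV
    (ε.contDiff.comp (contDiff_const.prodMk contDiff_id)).contDiffOn
    (fun z hz => by simpa [hW] using ⟨hφy, hz⟩) (fun z hz => by simp) θ y hy
  rw [A.equivariant s U (γ y) hs θ (φ y) hφy.1] at e2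
  rw [A.vertical (s (φ y)) V γ hV hγ θ y hy] at e3
  have hφd : DifferentiableAt ℝ φ y :=
    ((hφ y hy).contDiffAt (hV.mem_nhds hy)).differentiableAt (by simp)
  have d1 : fderiv ℝ (fun z => ε (φ z, z)) y =
      (ε : Euc m × Euc n →L[ℝ] Euc (m + n)).comp ((fderiv ℝ φ y).prod (.id ℝ _)) :=
    (ε.hasFDerivAt.comp y (hφd.hasFDerivAt.prodMk (hasFDerivAt_id y))).fderiv
  have d2 : fderiv ℝ (fun u => ε (u, y)) (φ y) =
      (ε : Euc m × Euc n →L[ℝ] Euc (m + n)).comp (.inl ℝ _ _) :=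
    (ε.hasFDerivAt.comp (φ y) (hasFDerivAt_prodMk_left (φ y) y)).fderiv
  have d3 : fderiv ℝ (fun z => ε (φ y, z)) y =
      (ε : Euc m × Euc n →L[ℝ] Euc (m + n)).comp (.inr ℝ _ _) :=
    (ε.hasFDerivAt.comp y (hasFDerivAt_prodMk_right (φ y) y)).fderiv
  rw [d1] at e1
  rw [d2] at e2
  rw [d3] at e3
  -- the value of the connection form on the product plot
  set F := A.form (fun ζ => B.act (s (ε.symm ζ).1) (γ (ε.symm ζ).2)) θ (ε (φ y, y)) with hF
  rw [e1, e3]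
  have hcomp : ∀ {j : ℕ} (L : Euc j →L[ℝ] Euc (m + n)) (v : Euc j),
      F.compContinuousLinearMap L ![v] = toOneForm (m + n) e F (L v) := by
    intro j L v
    rw [toOneForm_apply]
    refine congrArg F (funext fun i => ?_)
    fin_cases i
    rfl
  ext1 w
  have hw : w = ![w 0] := by funext i; fin_cases i; rfl
  rw [hw]
  generalize w 0 = v
  have e4 : ((Ad G ((γ y : ℝ → G) θ)⁻¹).compContinuousAlternatingMap
      ((A.form s θ (φ y)).compContinuousLinearMap (fderiv ℝ φ y))) ![v] =
      F.compContinuousLinearMap ((ε : Euc m × Euc n →L[ℝ] Euc (m + n)).comp (.inl ℝ _ _))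
        ![fderiv ℝ φ y v] := by
    rw [← e2]
    refine congrArg (fun u => Ad (e := e) G ((γ y : ℝ → G) θ)⁻¹ (A.form s θ (φ y) u))
      (funext fun i => ?_)
    fin_cases i
    rfl
  rw [ContinuousAlternatingMap.add_apply, e4, hcomp, hcomp, hcomp, ← map_add]
  congr 1
  simp only [ContinuousLinearMap.comp_apply, ContinuousLinearMap.inl_apply,
    ContinuousLinearMap.inr_apply, ContinuousLinearMap.prod_apply, ContinuousLinearMap.id_apply]
  rw [← map_add]
  simp

end Plots

/-! ### The holonomy of a Higgs field -/

section Holonomy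

variable {e d : ℕ} {G : Type*} [TopologicalSpace G] [ChartedSpace (Euc e) G] [Group G]
  [LieGroup (𝓡 e) ∞ G] {M Q : Type*} [TopologicalSpace M] [ChartedSpace (Euc d) M]
  {B : LoopBundle e d G M Q} (Φ : HiggsField B)

theorem HiggsField.contDiff_toFun (q : Q) : ContDiff ℝ ∞ (Φ.toFun q) := by
  have h := Φ.smooth (fun _ : Euc 0 => q) univ (LoopBundle.isPlotOn_const q)
  rw [univ_prod_univ, contDiffOn_univ] at h
  exact h.comp (contDiff_const (c := (0 : Euc 0)).prodMk contDiff_id)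

theorem HiggsField.isHolonomyPath_holPath (q : Q) : IsHolonomyPath (Φ.toFun q) (Φ.holPath q) :=
  Classical.epsilon_spec (exists_isHolonomyPath (Φ.contDiff_toFun q))

/-- Along a plot the holonomy paths depend smoothly on the point. -/
theorem HiggsField.contMDiffAt_holPath {n : ℕ} {V : Set (Euc n)} {p : Euc n → Q}
    (hp : B.IsPlotOn V p) (z : Euc n × ℝ) (hz : z ∈ V ×ˢ (univ : Set ℝ)) :
    ContMDiffAt 𝓘(ℝ, Euc n × ℝ) (𝓡 e) ∞ (fun z : Euc n × ℝ => Φ.holPath (p z.1) z.2) z :=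
  (contMDiffOn_of_isHolonomyPath hp.isOpen (Φ.smooth p V hp)
    (g := fun y => Φ.holPath (p y)) fun y _ => Φ.isHolonomyPath_holPath (p y)).contMDiffAt
      ((hp.isOpen.prod isOpen_univ).mem_nhds hz)

theorem HiggsField.holPath_zero (q : Q) : Φ.holPath q 0 = 1 := (Φ.isHolonomyPath_holPath q).2.1

/-- Equivariance of the holonomy paths: `g_q γ` solves the equation for `q γ`, by the twisted
equivariance of the Higgs field. -/
theorem HiggsField.holPath_act (q : Q) (γ : LoopGroup e G) :
    Φ.holPath (B.act q γ) = fun θ => Φ.holPath q θ * (γ : ℝ → G) θ := by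
  refine (Φ.isHolonomyPath_holPath (B.act q γ)).unique ⟨?_, ?_, fun θ => ?_⟩
  · exact (Φ.isHolonomyPath_holPath q).1.mul γ.2.1
  · change Φ.holPath q 0 * (γ : ℝ → G) 0 = 1
    rw [Φ.holPath_zero, γ.2.2.2, one_mul]
  · have h1 := mc_mul (e := e) ((Φ.isHolonomyPath_holPath q).1 θ) (γ.2.1 θ)
    rw [Φ.twisted, logDeriv_eq_mc, logDeriv_eq_mc, ← (Φ.isHolonomyPath_holPath q).2.2 θ]
    exact congrArg (fun L : ℝ →L[ℝ] Euc e => L 1) h1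

theorem HiggsField.holPath_act_two_pi (q : Q) (γ : LoopGroup e G) :
    Φ.holPath (B.act q γ) (2 * Real.pi) = Φ.holPath q (2 * Real.pi) := by
  have h : (γ : ℝ → G) (2 * Real.pi) = 1 := by
    have := γ.2.2.1 0
    rwa [zero_add, γ.2.2.2] at this
  rw [Φ.holPath_act]
  exact (congrArg (_ * ·) h).trans (mul_one _)

theorem HiggsField.hol_proj (q : Q) : Φ.hol (B.proj q) = Φ.holPath q (2 * Real.pi) := by
  obtain ⟨γ, hγ⟩ := B.transitive (B.sec (B.proj q) (B.proj q)) q (B.proj_sec _ _ (B.mem_base _))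
  rw [HiggsField.hol, ← Φ.holPath_act_two_pi _ γ, hγ]

/-- Near `x`, the holonomy is `m ↦ g_{s(m)}(2π)` for a local section `s`. -/
theorem HiggsField.contMDiff_hol [IsManifold (𝓡 d) ∞ M] : ContMDiff (𝓡 d) (𝓡 e) ∞ Φ.hol := by
  intro x
  have hmem := B.mem_secDomain x
  have h1 : ContMDiffAt 𝓘(ℝ, Euc d) (𝓡 e) ∞
      (fun y => Φ.holPath (B.secPlot x x y) (2 * Real.pi)) (extChartAt (𝓡 d) x x) :=
    ContMDiffAt.slice_left (g := fun z : Euc d × ℝ => Φ.holPath (B.secPlot x x z.1) z.2)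
      (Φ.contMDiffAt_holPath (B.isPlotOn_secPlot x x) (extChartAt (𝓡 d) x x, 2 * Real.pi)
      ⟨hmem, mem_univ _⟩)
  refine (h1.comp x (contMDiffAt_extChartAt (I := 𝓡 d) (n := ∞))).congr_of_eventuallyEq ?_
  filter_upwards [extChartAt_source_mem_nhds (I := 𝓡 d) x, (B.isOpen_base x).mem_nhds
    (B.mem_base x)] with m hm hb
  have h2 : B.secPlot x x (extChartAt (𝓡 d) x m) = B.sec x m := by
    rw [LoopBundle.secPlot, (extChartAt (𝓡 d) x).left_inv hm]
  rw [Function.comp_apply, h2, ← Φ.hol_proj, B.proj_sec _ _ hb]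

end Holonomy

/-! ### The lifted connection forms -/

section LiftedConn

variable {e d : ℕ} {G : Type*} [TopologicalSpace G] [ChartedSpace (Euc e) G] [Group G]
  [LieGroup (𝓡 e) ∞ G] {M Q : Type*} [TopologicalSpace M] [ChartedSpace (Euc d) M]
  {B : LoopBundle e d G M Q} (A : LoopConnection B) (Φ : HiggsField B)

theorem liftedConn_eq_gaugeFamily {n : ℕ} (p : Euc n → Q) :
    liftedConn A Φ p = gaugeFamily (A.form p) fun z => Φ.holPath (p z.1) z.2 := rfl

theorem contDiffOn_liftedConn {n : ℕ} {V : Set (Euc n)} {p : Euc n → Q} (hp : B.IsPlotOn V p) :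
    ContDiffOn ℝ ∞ (fun z : Euc n × ℝ => liftedConn A Φ p z.2 z.1) (V ×ˢ univ) :=
  contDiffOn_gaugeFamily hp.isOpen (A.smooth p V hp) (Φ.contMDiffAt_holPath hp)

/-- The lifted connection forms are basic: for `p = s(φ) γ` the holonomy paths of `p` are those of
`s(φ)` times `γ`, so that both `A` and `g⁻¹ dg` change by `Ad(γ⁻¹)` and the addition of `γ⁻¹ dγ`. -/
theorem liftedConn_gauge {m n : ℕ} {p : Euc n → Q} {s : Euc m → Q}
    {U : Set (Euc m)} {V : Set (Euc n)} {φ : Euc n → Euc m} {γ : Euc n → LoopGroup e G}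
    (hs : B.IsPlotOn U s) (hV : IsOpen V) (hφ : ContDiffOn ℝ ∞ φ V) (hm : MapsTo φ V U)
    (hγ : SmoothLoopsOn n V γ) (hp : ∀ y ∈ V, p y = B.act (s (φ y)) (γ y)) (θ : ℝ) {y : Euc n}
    (hy : y ∈ V) :
    liftedConn A Φ p θ y =
      (liftedConn A Φ s θ (φ y)).compContinuousLinearMap (fderiv ℝ φ y) := by
  have hs1 : ContMDiffAt 𝓘(ℝ, Euc m) (𝓡 e) ∞ (fun u => Φ.holPath (s u) θ) (φ y) :=
    ContMDiffAt.slice_left (g := fun z : Euc m × ℝ => Φ.holPath (s z.1) z.2)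
      (Φ.contMDiffAt_holPath hs (φ y, θ) ⟨hm hy, mem_univ _⟩)
  have hφy : ContDiffAt ℝ ∞ φ y := (hφ y hy).contDiffAt (hV.mem_nhds hy)
  have hγ1 : ContMDiffAt 𝓘(ℝ, Euc n) (𝓡 e) ∞ (fun z => (γ z : ℝ → G) θ) y :=
    ContMDiffAt.slice_left (g := fun z : Euc n × ℝ => (γ z.1 : ℝ → G) z.2)
      ((smoothLoopsOn_iff.1 hγ).contMDiffAt ((hV.prod isOpen_univ).mem_nhds ⟨hy, mem_univ _⟩))
  have h1 : mc e (fun z => Φ.holPath (p z) θ) y =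
      (Ad G ((γ y : ℝ → G) θ)⁻¹).comp ((mc e (fun u => Φ.holPath (s u) θ) (φ y)).comp
        (fderiv ℝ φ y)) + mc e (fun z => (γ z : ℝ → G) θ) y := by
    have h2 : (fun z => Φ.holPath (p z) θ) =ᶠ[𝓝 y]
        fun z => Φ.holPath (s (φ z)) θ * (γ z : ℝ → G) θ := by
      filter_upwards [hV.mem_nhds hy] with z hz
      rw [hp z hz, Φ.holPath_act]
    refine (mc_congr h2).trans ?_
    have h3 := mc_mul (e := e) (h := fun z => Φ.holPath (s (φ z)) θ)
      (k := fun z => (γ z : ℝ → G) θ) (ContMDiffAt.comp (g := fun u => Φ.holPath (s u) θ) y hs1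
        hφy.contMDiffAt) hγ1
    have h4 : mc e (fun z => Φ.holPath (s (φ z)) θ) y = _ :=
      mc_comp (e := e) (h := fun u => Φ.holPath (s u) θ) (u := φ) hs1
        (hφy.differentiableAt (by simp))
    refine h3.trans ?_
    rw [h4]
  ext1 w
  have hw : w = ![w 0] := by funext i; fin_cases i; rfl
  rw [hw]
  generalize w 0 = v
  have e1 : liftedConn A Φ p θ y ![v] = Ad G (Φ.holPath (p y) θ) (A.form p θ y ![v] -
    mc e (fun z => Φ.holPath (p z) θ) y v) := rfl
  have e2 : (liftedConn A Φ s θ (φ y)).compContinuousLinearMap (fderiv ℝ φ y) ![v] =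
      Ad G (Φ.holPath (s (φ y)) θ) ((A.form s θ (φ y)).compContinuousLinearMap (fderiv ℝ φ y) ![v] -
      mc e (fun u => Φ.holPath (s u) θ) (φ y) (fderiv ℝ φ y v)) := rfl
  have e3 : A.form p θ y ![v] = Ad G ((γ y : ℝ → G) θ)⁻¹
      ((A.form s θ (φ y)).compContinuousLinearMap (fderiv ℝ φ y) ![v]) +
      mc e (fun z => (γ z : ℝ → G) θ) y v := by
    rw [A.form_gauge hs hV hφ hm hγ hp θ hy]
    rfl
  have e4 : mc e (fun z => Φ.holPath (p z) θ) y v = Ad G ((γ y : ℝ → G) θ)⁻¹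
      (mc e (fun u => Φ.holPath (s u) θ) (φ y) (fderiv ℝ φ y v)) +
      mc e (fun z => (γ z : ℝ → G) θ) y v := by
    rw [h1]
    rfl
  have e5 : Φ.holPath (p y) θ = Φ.holPath (s (φ y)) θ * (γ y : ℝ → G) θ := by
    rw [hp y hy, Φ.holPath_act]
  -- the terms `γ⁻¹ dγ` of `A` and `g⁻¹ dg` cancel
  rw [e1, e2, e3, e4, add_sub_add_right_eq_sub, ← map_sub, e5, Ad_mul,
    ContinuousLinearMap.comp_apply, Ad_Ad_inv]

theorem LoopConnection.form_two_pi {n : ℕ} {V : Set (Euc n)} {p : Euc n → Q} (hp : B.IsPlotOn V p)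
    {y : Euc n} (hy : y ∈ V) : A.form p (2 * Real.pi) y = 0 := by
  rw [← A.based p V hp y hy, ← A.periodic p V hp 0 y hy, zero_add]

theorem LoopConnection.curvature_eq_scaledCurv {n : ℕ} (p : Euc n → Q) (θ : ℝ) (y : Euc n) :
    A.curvature p θ y = scaledCurv (A.form p) 1 θ y := by
  simp [LoopConnection.curvature, scaledCurv]

/-- In terms of the lifted connection forms, the string form is the integral of
`-k f(∂_θ a, F, …, F)`: these forms are gauge transforms, with `∂_θ a = -Ad(g) ∇Φ` and curvature
`Ad(g) F`, and `f` is `Ad`-invariant. -/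
theorem stringFormTotal_eq {k : ℕ} (f : InvPoly e G (k + 1)) {n : ℕ} {V : Set (Euc n)}
    {p : Euc n → Q} (hp : B.IsPlotOn V p) {y : Euc n} (hy : y ∈ V) :
    stringFormTotal f A Φ p y = -(k + 1 : ℝ) • ∫ θ in (0 : ℝ)..(2 * Real.pi),
      f.oneTwo (deriv (fun t => liftedConn A Φ p t y) θ)
        (scaledCurv (liftedConn A Φ p) 1 θ y) := by
  have hg := Φ.contMDiffAt_holPath hp
  -- the defining equation of the holonomy paths
  have hξ : ∀ z ∈ V ×ˢ (univ : Set ℝ), mc e (fun z : Euc n × ℝ => Φ.holPath (p z.1) z.2) z (0, 1) =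
      Φ.toFun (p z.1) z.2 := by
    rintro ⟨y, θ⟩ hz
    have h1 := mc_comp (e := e) (h := fun z : Euc n × ℝ => Φ.holPath (p z.1) z.2)
      (u := fun t : ℝ => (y, t)) (y := θ) (hg (y, θ) hz) (by fun_prop)
    rw [(hasFDerivAt_prodMk_right y θ).fderiv] at h1
    have h2 := (Φ.isHolonomyPath_holPath (p y)).2.2 θ
    rw [logDeriv_eq_mc] at h2
    rw [← h2]
    exact (congrArg (fun L : ℝ →L[ℝ] Euc e => L 1) h1).symm
  have h1 : ∀ θ, f.oneTwo (deriv (fun t => liftedConn A Φ p t y) θ)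
        (scaledCurv (liftedConn A Φ p) 1 θ y) =
      -f.oneTwo (covDeriv A Φ p θ y) (A.curvature p θ y) := by
    intro θ
    have h2 := deriv_gaugeFamily hp.isOpen (A.smooth p V hp) hg
      (ξ := fun z => Φ.toFun (p z.1) z.2) hξ hy θ
    have h3 := scaledCurv_gaugeFamily hp.isOpen (A.smooth p V hp) hg hy θ
    rw [← liftedConn_eq_gaugeFamily] at h2 h3
    rw [h2, h3, f.oneTwo_neg_left, f.oneTwo_Ad, A.curvature_eq_scaledCurv]
    rfl
  simp only [h1, intervalIntegral.integral_neg, stringFormTotal, smul_neg, neg_smul, neg_neg]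

end LiftedConn

/-! ### Descent to the base -/

section Descent

variable {e d : ℕ} {G : Type*} [TopologicalSpace G] [ChartedSpace (Euc e) G] [Group G]
  [LieGroup (𝓡 e) ∞ G] {M Q : Type*} [TopologicalSpace M] [ChartedSpace (Euc d) M]
  {B : LoopBundle e d G M Q} {k : ℕ}

/-- A form on the total space, given on plots, is basic if its pullbacks along the plots `p` and `s`
with `p = s(φ) γ` are related by `φ`. -/
def LoopBundle.IsBasic (B : LoopBundle e d G M Q)
    (η : ∀ {n : ℕ}, (Euc n → Q) → Euc n → Euc n [⋀^Fin k]→L[ℝ] ℝ) : Prop :=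
  ∀ {m n : ℕ} (p : Euc n → Q) (s : Euc m → Q) (U : Set (Euc m)) (V V' : Set (Euc n))
    (φ : Euc n → Euc m) (γ : Euc n → LoopGroup e G), B.IsPlotOn U s → B.IsPlotOn V' p → V ⊆ V' →
    IsOpen V → ContDiffOn ℝ ∞ φ V → MapsTo φ V U → SmoothLoopsOn n V γ →
    (∀ y ∈ V, p y = B.act (s (φ y)) (γ y)) →
    ∀ y ∈ V, η p y = (η s (φ y)).compContinuousLinearMap (fderiv ℝ φ y)

variable [IsManifold (𝓡 d) ∞ M] {η : ∀ {n : ℕ}, (Euc n → Q) → Euc n → Euc n [⋀^Fin k]→L[ℝ] ℝ}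

/-- Near `y₀` a plot `p` is `s(φ) γ` with `s` a local section at `π(p(y₀))` read in a chart, and `φ`
the projection of `p` in this chart. -/
theorem LoopBundle.IsBasic.isDescent (hη : B.IsBasic η) : B.IsDescent η (B.descend η) := by
  intro n p V hp y₀ hy₀
  set x := B.proj (p y₀) with hx
  set s := B.secPlot x x with hs
  set O : Set M := (extChartAt (𝓡 d) x).source ∩ B.base x with hO
  have hOo : IsOpen O := (isOpen_extChartAt_source x).inter (B.isOpen_base x)
  set V' := V ∩ (fun y => B.proj (p y)) ⁻¹' O with hV'
  have hV'o : IsOpen V' := hp.smooth_proj.continuousOn.isOpen_inter_preimage hp.isOpen hOo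
  have hy₀' : y₀ ∈ V' := ⟨hy₀, mem_extChartAt_source x, B.mem_base x⟩
  have hφ : ContMDiffOn (𝓡 n) (𝓡 d) ∞ (fun y => extChartAt (𝓡 d) x (B.proj (p y))) V' :=
    (contMDiffOn_extChartAt (I := 𝓡 d) (n := ∞) (x := x)).comp
      (hp.smooth_proj.mono inter_subset_left) fun y hy => by
        have := hy.2.1
        rwa [extChartAt_source] at this
  have h := hη p s (B.secDomain x x) V' V (fun y => extChartAt (𝓡 d) x (B.proj (p y)))
    (fun y => B.translation (B.sec x (B.proj (p y))) (p y)) (B.isPlotOn_secPlot x x) hp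
    inter_subset_left hV'o hφ.contDiffOn (fun y hy => ⟨(extChartAt (𝓡 d) x).map_source hy.2.1, by
      rw [mem_preimage, (extChartAt (𝓡 d) x).left_inv hy.2.1]
      exact hy.2.2⟩)
    (ContMDiffOn.mono (hp.smoothLoopsOn_translation x)
      (prod_mono (fun y hy => ⟨hy.1, hy.2.2⟩) le_rfl))
    (fun y hy => by
      rw [hs, LoopBundle.secPlot, (extChartAt (𝓡 d) x).left_inv hy.2.1]
      exact (LoopBundle.act_translation (B.proj_sec _ _ hy.2.2)).symm) y₀ hy₀'
  have hd : fderiv ℝ (fun y => extChartAt (𝓡 d) x (B.proj (p y))) y₀ =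
      (mfderiv (𝓡 d) 𝓘(ℝ, Euc d) (extChartAt (𝓡 d) x) x : Euc d →L[ℝ] Euc d).comp
        (mfderiv (𝓡 n) (𝓡 d) (fun z => B.proj (p z)) y₀ : Euc n →L[ℝ] Euc d) := by
    have h1 := mfderiv_comp (I := 𝓡 n) (I' := 𝓡 d) (I'' := 𝓘(ℝ, Euc d)) y₀
      (g := extChartAt (𝓡 d) x) (f := fun z => B.proj (p z))
      ((contMDiffAt_extChartAt (I := 𝓡 d) (n := ∞) (x := x)).mdifferentiableAt (by simp))
      ((hp.smooth_proj.contMDiffAt (hp.isOpen.mem_nhds hy₀)).mdifferentiableAt (by simp))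
    rw [← mfderiv_eq_fderiv]
    exact h1
  rw [h, hd]
  rfl

/-- The form on the base, read in any chart, is the pullback along any local section. -/
theorem LoopBundle.IsBasic.inChart_descend (hη : B.IsBasic η) {x x' : M} {y : Euc d}
    (hy : y ∈ B.secDomain x x') : (B.descend η).inChart x' y = η (B.secPlot x x') y := by
  have h := hη.isDescent (B.secPlot x x') _ (B.isPlotOn_secPlot x x') y hy
  have h1 : (fun z => B.proj (B.secPlot x x' z)) =ᶠ[𝓝 y] (extChartAt (𝓡 d) x').symm := by
    filter_upwards [(B.isOpen_secDomain x x').mem_nhds hy] with z hz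
      using LoopBundle.proj_secPlot hz
  have h2 : (mfderiv (𝓡 d) (𝓡 d) (fun z => B.proj (B.secPlot x x' z)) y : Euc d →L[ℝ] Euc d) =
      mfderiv 𝓘(ℝ, Euc d) (𝓡 d) (extChartAt (𝓡 d) x').symm y := h1.mfderiv_eq
  have h3 : (B.descend η (B.proj (B.secPlot x x' y)) : Euc d [⋀^Fin k]→L[ℝ] ℝ) =
      B.descend η ((extChartAt (𝓡 d) x').symm y) := by
    rw [LoopBundle.proj_secPlot hy]
  refine Eq.trans ?_ h.symm
  exact congrArg₂ (fun (τ : Euc d [⋀^Fin k]→L[ℝ] ℝ) (L : Euc d →L[ℝ] Euc d) =>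
    τ.compContinuousLinearMap L) h3.symm h2.symm

theorem LoopBundle.IsBasic.isSmooth_descend (hη : B.IsBasic η)
    (hs : ∀ {n : ℕ} (p : Euc n → Q) (V : Set (Euc n)), B.IsPlotOn V p → ContDiffOn ℝ ∞ (η p) V) :
    (B.descend η).IsSmooth := by
  intro x' y hy
  set x := (extChartAt (𝓡 d) x').symm y with hx
  have hy' : y ∈ B.secDomain x x' := ⟨hy, B.mem_base x⟩
  have hnhds := (B.isOpen_secDomain x x').mem_nhds hy'
  refine ContDiffAt.contDiffWithinAt ?_
  refine ((hs _ _ (B.isPlotOn_secPlot x x') y hy').contDiffAt hnhds).congr_of_eventuallyEq ?_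
  filter_upwards [hnhds] with z hz using hη.inChart_descend hz

end Descent

/-! ### String forms and canonical forms on plots -/

section Total

variable {e d : ℕ} {G : Type*} [TopologicalSpace G] [ChartedSpace (Euc e) G] [Group G]
  [LieGroup (𝓡 e) ∞ G] {M Q : Type*} [TopologicalSpace M] [ChartedSpace (Euc d) M]
  {B : LoopBundle e d G M Q} (A : LoopConnection B) (Φ : HiggsField B)

theorem contDiffOn_oneTwo_liftedConn {k : ℕ} (f : InvPoly e G (k + 1)) {n : ℕ} {V : Set (Euc n)}
    {p : Euc n → Q} (hp : B.IsPlotOn V p) :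
    ContDiffOn ℝ ∞ (fun z : Euc n × ℝ => f.oneTwo (deriv (fun t => liftedConn A Φ p t z.1) z.2)
      (scaledCurv (liftedConn A Φ p) 1 z.2 z.1)) (V ×ˢ univ) :=
  contDiffOn_oneTwo f (contDiffOn_deriv_family hp.isOpen (contDiffOn_liftedConn A Φ hp))
    (contDiffOn_scaledCurv hp.isOpen (contDiffOn_liftedConn A Φ hp) 1)

theorem contDiffOn_stringFormTotal {k : ℕ} (f : InvPoly e G (k + 1)) {n : ℕ} {V : Set (Euc n)}
    {p : Euc n → Q} (hp : B.IsPlotOn V p) : ContDiffOn ℝ ∞ (stringFormTotal f A Φ p) V :=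
  ((contDiffOn_integral hp.isOpen (contDiffOn_oneTwo_liftedConn A Φ f hp) 0
    (2 * Real.pi)).const_smul (-(k + 1 : ℝ))).congr fun _ hy => stringFormTotal_eq A Φ f hp hy

theorem contDiffOn_canonicalFormTotal {k : ℕ} (f : InvPoly e G (k + 1)) {n : ℕ} {V : Set (Euc n)}
    {p : Euc n → Q} (hp : B.IsPlotOn V p) : ContDiffOn ℝ ∞ (canonicalFormTotal f A Φ p) V := by
  cases k with
  | zero => exact contDiffOn_const
  | succ l =>
    exact contDiffOn_canonicalOfFamily f hp.isOpen (contDiffOn_liftedConn A Φ hp) (2 * Real.pi)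

theorem isBasic_stringFormTotal {k : ℕ} (f : InvPoly e G (k + 1)) :
    B.IsBasic (stringFormTotal f A Φ) := by
  intro m n p s U V V' φ γ hs hp hVV hV hφ hm hγ h y hy
  beta_reduce
  rw [stringFormTotal_eq A Φ f hp (hVV hy), stringFormTotal_eq A Φ f hs (hm hy),
    integral_oneTwo_pullback f hs.isOpen hV (contDiffOn_liftedConn A Φ hs) hφ hm
      (fun θ y hy => liftedConn_gauge A Φ hs hV hφ hm hγ h θ hy) (2 * Real.pi) hy]
  rfl

theorem isBasic_canonicalFormTotal {k : ℕ} (f : InvPoly e G (k + 1)) :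
    B.IsBasic (canonicalFormTotal f A Φ) := by
  intro m n p s U V V' φ γ hs hp hVV hV hφ hm hγ h y hy
  cases k with
  | zero => rfl
  | succ l =>
    exact canonicalOfFamily_pullback f hs.isOpen hV (contDiffOn_liftedConn A Φ hs) hφ hm
      (fun θ y hy => liftedConn_gauge A Φ hs hV hφ hm hγ h θ hy) (2 * Real.pi) hy

/-- The transgression formula on plots: the lifted connection forms interpolate between `0` and the
flat form `-dh h⁻¹`, where `h` is the endpoint of the holonomy path. -/
theorem stringFormTotal_eq_transgression_add {k : ℕ} (f : InvPoly e G (k + 1)) {n : ℕ}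
    {V : Set (Euc n)} {p : Euc n → Q} (hp : B.IsPlotOn V p) {y : Euc n} (hy : y ∈ V) :
    stringFormTotal f A Φ p y =
      ((-1 / 2 : ℝ) ^ k * ((k + 1).factorial * k.factorial : ℝ) / ((2 * k + 1).factorial : ℝ)) •
        f.oneTwo (oneForm (mcPullback G (fun z => Φ.holPath (p z) (2 * Real.pi)) y))
          (formBracket G (oneForm (mcPullback G (fun z => Φ.holPath (p z) (2 * Real.pi)) y))
            (oneForm (mcPullback G (fun z => Φ.holPath (p z) (2 * Real.pi)) y))) +
      extDeriv (canonicalFormTotal f A Φ p) y := by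
  have hc := continuous_slice_of_contDiffOn (contDiffOn_oneTwo_liftedConn A Φ f hp) hy
  have hg := Φ.contMDiffAt_holPath hp
  ext w
  let ev := ContinuousAlternatingMap.apply ℝ (Euc n) ℝ w
  have h1 : (∫ θ in (0 : ℝ)..(2 * Real.pi), f.oneTwo (deriv (fun t => liftedConn A Φ p t y) θ)
        (scaledCurv (liftedConn A Φ p) 1 θ y)) w =
      ∫ θ in (0 : ℝ)..(2 * Real.pi), f.oneTwo (deriv (fun t => liftedConn A Φ p t y) θ)
        (scaledCurv (liftedConn A Φ p) 1 θ y) w :=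
    (ev.intervalIntegral_comp_comm (hc.intervalIntegrable 0 (2 * Real.pi))).symm
  rw [stringFormTotal_eq A Φ f hp hy, ContinuousAlternatingMap.smul_apply, h1,
    ContinuousAlternatingMap.add_apply, ContinuousAlternatingMap.smul_apply, smul_eq_mul,
    smul_eq_mul]
  simp only [liftedConn_eq_gaugeFamily]
  cases k with
  | zero =>
    have h2 : extDeriv (canonicalFormTotal f A Φ p) y w = 0 := by
      have := extDeriv_fun_smul (x := y) (0 : ℝ) fun _ : Euc n => (0 : Euc n [⋀^Fin (2 * 0)]→L[ℝ] ℝ)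
      simp only [zero_smul] at this
      exact congrArg (· w) this
    rw [f.integral_oneTwo_gaugeFamily_zero hp.isOpen (A.smooth p V hp) hg
      (A.based p V hp) (fun y hy => A.form_two_pi hp hy) (fun y _ => Φ.holPath_zero (p y)) hy, h2]
    simp
  | succ l =>
    have h3 := f.integral_oneTwo_gaugeFamily hp.isOpen (A.smooth p V hp) hg
      (A.based p V hp) (fun y hy => A.form_two_pi hp hy) (fun y _ => Φ.holPath_zero (p y)) hy w
    have h4 : extDeriv (canonicalFormTotal f A Φ p) y w = extDeriv (canonicalOfFamily f
      (gaugeFamily (A.form p) fun z => Φ.holPath (p z.1) z.2) (2 * Real.pi)) y w := rfl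
    rw [h4]
    push_cast at h3 ⊢
    linear_combination -h3

end Total

/-! ### The forms on the base -/

section Base

variable {e d d' : ℕ} {G : Type*} [TopologicalSpace G] [ChartedSpace (Euc e) G] [Group G]
  [LieGroup (𝓡 e) ∞ G] {M Q : Type*} [TopologicalSpace M] [ChartedSpace (Euc d) M]
  {B : LoopBundle e d G M Q} (A : LoopConnection B) (Φ : HiggsField B)
  {k : ℕ} (f : InvPoly e G (k + 1))

variable {N : Type*} [TopologicalSpace N] [ChartedSpace (Euc d') N]

/-- The connection, the Higgs field and hence the holonomy paths of `g^* Q` are by definition those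
of `Q`. -/
theorem canonicalFormTotal_pullback {g : N → M} (hg : ContMDiff (𝓡 d') (𝓡 d) ∞ g) {n : ℕ}
    (p : Euc n → B.PullbackSpace g) (y : Euc n) :
    canonicalFormTotal f (A.pullback hg) (Φ.pullback hg) p y =
      canonicalFormTotal f A Φ (fun y => (p y).1.2) y := by
  cases k <;> rfl

variable [IsManifold (𝓡 d) ∞ M]

/-- The pullback of the Maurer-Cartan form under the holonomy, in terms of a local section. -/
theorem maurerCartan_comp_mfderiv_hol (x : M) :
    ((maurerCartan G (Φ.hol x) : Euc e →L[ℝ] LieAlg e G).comp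
      (mfderiv (𝓡 d) (𝓡 e) Φ.hol x : Euc d →L[ℝ] Euc e)) =
    (mcPullback G (fun y => Φ.holPath (B.secPlot x x y) (2 * Real.pi)) (extChartAt (𝓡 d) x x)).comp
      (mfderiv (𝓡 d) 𝓘(ℝ, Euc d) (extChartAt (𝓡 d) x) x : Euc d →L[ℝ] Euc d) := by
  set h : Euc d → G := fun y => Φ.holPath (B.secPlot x x y) (2 * Real.pi) with hh
  have hmem := B.mem_secDomain x
  have h1 : ContMDiffAt 𝓘(ℝ, Euc d) (𝓡 e) ∞ h (extChartAt (𝓡 d) x x) :=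
    ContMDiffAt.slice_left (g := fun z : Euc d × ℝ => Φ.holPath (B.secPlot x x z.1) z.2)
      (Φ.contMDiffAt_holPath (B.isPlotOn_secPlot x x) (extChartAt (𝓡 d) x x, 2 * Real.pi)
      ⟨hmem, mem_univ _⟩)
  have h2 : Φ.hol =ᶠ[𝓝 x] h ∘ extChartAt (𝓡 d) x := by
    filter_upwards [extChartAt_source_mem_nhds (I := 𝓡 d) x, (B.isOpen_base x).mem_nhds
      (B.mem_base x)] with m hm hb
    have h3 : B.secPlot x x (extChartAt (𝓡 d) x m) = B.sec x m := by
      rw [LoopBundle.secPlot, (extChartAt (𝓡 d) x).left_inv hm]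
    rw [Function.comp_apply, hh]
    simp only
    rw [h3, ← Φ.hol_proj, B.proj_sec _ _ hb]
  have h3 : (mfderiv (𝓡 d) (𝓡 e) Φ.hol x : Euc d →L[ℝ] Euc e) =
      (mfderiv (𝓡 d) (𝓡 e) h (extChartAt (𝓡 d) x x) : Euc d →L[ℝ] Euc e).comp
        (mfderiv (𝓡 d) 𝓘(ℝ, Euc d) (extChartAt (𝓡 d) x) x : Euc d →L[ℝ] Euc d) :=
    (h2.mfderiv_eq).trans (mfderiv_comp (I := 𝓡 d) (I' := 𝓘(ℝ, Euc d)) (I'' := 𝓡 e) x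
      (g := h) (f := extChartAt (𝓡 d) x) (h1.mdifferentiableAt (by simp))
      ((contMDiffAt_extChartAt (I := 𝓡 d) (n := ∞) (x := x)).mdifferentiableAt (by simp)))
  have h4 : Φ.hol x = h (extChartAt (𝓡 d) x x) := h2.self_of_nhds
  have h5 : (maurerCartan G (Φ.hol x) : Euc e →L[ℝ] LieAlg e G) =
      maurerCartan G (h (extChartAt (𝓡 d) x x)) := by rw [h4]
  rw [h3, h5]
  rfl

/-- The identity on plots `stringFormTotal_eq_transgression_add`, read along a local section. -/
theorem stringForm_eq :
    stringForm f A Φ = (transgression f).pullback Φ.hol + (canonicalForm f A Φ).extDer := by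
  funext x
  have hmem := B.mem_secDomain x
  set D : Euc d →L[ℝ] Euc d := mfderiv (𝓡 d) 𝓘(ℝ, Euc d) (extChartAt (𝓡 d) x) x with hD
  have h1 : stringForm f A Φ x = (stringFormTotal f A Φ (B.secPlot x x)
      (extChartAt (𝓡 d) x x)).compContinuousLinearMap D := rfl
  have h2 : extDeriv ((canonicalForm f A Φ).inChart x) (extChartAt (𝓡 d) x x) =
      extDeriv (canonicalFormTotal f A Φ (B.secPlot x x)) (extChartAt (𝓡 d) x x) := by
    refine Filter.EventuallyEq.extDeriv_eq ?_
    filter_upwards [(B.isOpen_secDomain x x).mem_nhds hmem] with z hz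
      using LoopBundle.IsBasic.inChart_descend (isBasic_canonicalFormTotal A Φ f) hz
  have h3 : (canonicalForm f A Φ).extDer x = (extDeriv (canonicalFormTotal f A Φ (B.secPlot x x))
      (extChartAt (𝓡 d) x x)).compContinuousLinearMap D := by
    rw [← h2]
    rfl
  have h4 : oneForm ((maurerCartan G (Φ.hol x) : Euc e →L[ℝ] LieAlg e G).comp
      (mfderiv (𝓡 d) (𝓡 e) Φ.hol x : Euc d →L[ℝ] Euc e)) =
      (oneForm (mcPullback G (fun y => Φ.holPath (B.secPlot x x y) (2 * Real.pi))
        (extChartAt (𝓡 d) x x))).compContinuousLinearMap D := by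
    rw [maurerCartan_comp_mfderiv_hol]
    rfl
  have h5 : (transgression f).pullback Φ.hol x =
      ((-1 / 2 : ℝ) ^ k * ((k + 1).factorial * k.factorial : ℝ) / ((2 * k + 1).factorial : ℝ)) •
        (f.oneTwo (oneForm (maurerCartan G (Φ.hol x) : Euc e →L[ℝ] LieAlg e G))
          (formBracket G (oneForm (maurerCartan G (Φ.hol x) : Euc e →L[ℝ] LieAlg e G))
            (oneForm (maurerCartan G (Φ.hol x) : Euc e →L[ℝ] LieAlg e G)))).compContinuousLinearMap
              (mfderiv (𝓡 d) (𝓡 e) Φ.hol x : Euc d →L[ℝ] Euc e) := rfl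
  have h6 : (oneForm (maurerCartan G (Φ.hol x) : Euc e →L[ℝ] LieAlg e G)).compContinuousLinearMap
      (mfderiv (𝓡 d) (𝓡 e) Φ.hol x : Euc d →L[ℝ] Euc e) = _ := h4
  have h7 : ((transgression f).pullback Φ.hol + (canonicalForm f A Φ).extDer :
      DForm d M (2 * k + 1)) x =
      (transgression f).pullback Φ.hol x + (canonicalForm f A Φ).extDer x := rfl
  set η : Euc d [⋀^Fin 1]→L[ℝ] LieAlg e G :=
    oneForm (mcPullback G (fun y => Φ.holPath (B.secPlot x x y) (2 * Real.pi))
      (extChartAt (𝓡 d) x x)) with hη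
  have h8 : (stringFormTotal f A Φ (B.secPlot x x)
      (extChartAt (𝓡 d) x x)).compContinuousLinearMap D =
      ((-1 / 2 : ℝ) ^ k * ((k + 1).factorial * k.factorial : ℝ) / ((2 * k + 1).factorial : ℝ)) •
        f.oneTwo (η.compContinuousLinearMap D) (formBracket (e := e) G (η.compContinuousLinearMap D)
          (η.compContinuousLinearMap D)) +
      (extDeriv (canonicalFormTotal f A Φ (B.secPlot x x))
        (extChartAt (𝓡 d) x x)).compContinuousLinearMap D := by
    rw [stringFormTotal_eq_transgression_add A Φ f (B.isPlotOn_secPlot x x) hmem,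
      formBracket_compContinuousLinearMap, f.oneTwo_compContinuousLinearMap]
    rfl
  rw [h7, h1, h3, h5, ← f.oneTwo_compContinuousLinearMap, ← formBracket_compContinuousLinearMap,
    h6]
  exact h8

variable [IsManifold (𝓡 d') ∞ N]

/-- A local section of `g^* Q` is mapped to a plot of `Q` over `g`; evaluate the descent of the
canonical form along this plot. -/
theorem canonicalForm_pullback {g : N → M} (hg : ContMDiff (𝓡 d') (𝓡 d) ∞ g) :
    canonicalForm f (A.pullback hg) (Φ.pullback hg) = (canonicalForm f A Φ).pullback g := by
  funext x
  set p := (B.pullback hg).secPlot x x with hp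
  set y₀ := extChartAt (𝓡 d') x x with hy₀
  have hmem : y₀ ∈ (B.pullback hg).secDomain x x := (B.pullback hg).mem_secDomain x
  have hplot := (B.pullback hg).isPlotOn_secPlot x x
  set D : Euc d' →L[ℝ] Euc d' := mfderiv (𝓡 d') 𝓘(ℝ, Euc d') (extChartAt (𝓡 d') x) x with hD
  have h1 : canonicalForm f (A.pullback hg) (Φ.pullback hg) x =
      (canonicalFormTotal f (A.pullback hg) (Φ.pullback hg) p y₀).compContinuousLinearMap D := rfl
  have h2 := LoopBundle.IsBasic.isDescent (isBasic_canonicalFormTotal A Φ f) (fun y => (p y).1.2) _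
    hplot.of_pullback y₀ hmem
  have hpx : B.proj (p y₀).1.2 = g x := by
    have h3 : (p y₀).1.1 = (extChartAt (𝓡 d') x).symm y₀ := LoopBundle.proj_secPlot hmem
    rw [← (p y₀).2, h3, hy₀, extChartAt_to_inv]
  have h3 : (mfderiv (𝓡 d') (𝓡 d) g x : Euc d' →L[ℝ] Euc d) =
      (mfderiv (𝓡 d') (𝓡 d) (fun z => B.proj (p z).1.2) y₀ : Euc d' →L[ℝ] Euc d).comp D := by
    have h4 : g =ᶠ[𝓝 x] (fun z => B.proj (p z).1.2) ∘ extChartAt (𝓡 d') x := by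
      filter_upwards [extChartAt_source_mem_nhds (I := 𝓡 d') x,
        ((B.pullback hg).isOpen_base x).mem_nhds ((B.pullback hg).mem_base x)] with m hm hb
      have h5 : (p (extChartAt (𝓡 d') x m)).1.1 =
          (extChartAt (𝓡 d') x).symm (extChartAt (𝓡 d') x m) :=
        LoopBundle.proj_secPlot (B := B.pullback hg) ⟨(extChartAt (𝓡 d') x).map_source hm, by
          rw [mem_preimage, (extChartAt (𝓡 d') x).left_inv hm]
          exact hb⟩
      rw [Function.comp_apply, ← (p _).2, h5, (extChartAt (𝓡 d') x).left_inv hm]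
    exact (h4.mfderiv_eq).trans (mfderiv_comp (I := 𝓡 d') (I' := 𝓘(ℝ, Euc d')) (I'' := 𝓡 d) x
      (g := fun z => B.proj (p z).1.2) (f := extChartAt (𝓡 d') x)
      ((hplot.of_pullback.smooth_proj.contMDiffAt
        (hplot.isOpen.mem_nhds hmem)).mdifferentiableAt (by simp))
      ((contMDiffAt_extChartAt (I := 𝓡 d') (n := ∞) (x := x)).mdifferentiableAt (by simp)))
  have h4 : (canonicalForm f A Φ).pullback g x =
    (canonicalForm f A Φ (g x) : Euc d [⋀^Fin (2 * k)]→L[ℝ] ℝ).compContinuousLinearMap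
      (mfderiv (𝓡 d') (𝓡 d) g x : Euc d' →L[ℝ] Euc d) := rfl
  have h5 : (canonicalForm f A Φ (g x) : Euc d [⋀^Fin (2 * k)]→L[ℝ] ℝ) =
      canonicalForm f A Φ (B.proj (p y₀).1.2) := by rw [hpx]
  have h6 : canonicalFormTotal f A Φ (fun y => (p y).1.2) y₀ =
    (canonicalForm f A Φ (B.proj (p y₀).1.2) :
      Euc d [⋀^Fin (2 * k)]→L[ℝ] ℝ).compContinuousLinearMap
      (mfderiv (𝓡 d') (𝓡 d) (fun z => B.proj (p z).1.2) y₀ : Euc d' →L[ℝ] Euc d) := h2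
  rw [h1, h4, canonicalFormTotal_pullback, h6, h5, h3]
  rfl

end Base

end OmegaG

end

theorem mainTheorem12 {e d : ℕ} {G M Q : Type*}
    [TopologicalSpace G] [T2Space G] [ChartedSpace (Euc e) G] [Group G] [LieGroup (𝓡 e) ∞ G]
    [TopologicalSpace M] [T2Space M] [ParacompactSpace M] [ChartedSpace (Euc d) M]
    [IsManifold (𝓡 d) ∞ M]
    (B : LoopBundle e d G M Q) (A : LoopConnection B) (Φ : HiggsField B)
    {k : ℕ} (f : InvPoly e G (k + 1)) :
    -- the holonomy paths exist and are unique, and induce a smooth map `hol_Φ : M → G`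
    (∀ q, IsHolonomyPath (Φ.toFun q) (Φ.holPath q) ∧
      ∀ h, IsHolonomyPath (Φ.toFun q) h → h = Φ.holPath q) ∧
    (∀ q, Φ.hol (B.proj q) = Φ.holPath q (2 * Real.pi)) ∧
    ContMDiff (𝓡 d) (𝓡 e) ∞ Φ.hol ∧
    -- the string form and the canonical form descend to smooth forms on `M`
    B.IsDescent (stringFormTotal f A Φ) (stringForm f A Φ) ∧
    (stringForm f A Φ).IsSmooth ∧
    B.IsDescent (canonicalFormTotal f A Φ) (canonicalForm f A Φ) ∧
    (canonicalForm f A Φ).IsSmooth ∧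
    -- `s_f(A, Φ) = hol_Φ^* τ_f + dχ`
    stringForm f A Φ = (transgression f).pullback Φ.hol + (canonicalForm f A Φ).extDer ∧
    -- the canonical form is natural under pullback
    (∀ {d' : ℕ} {N : Type*} [TopologicalSpace N] [T2Space N] [ParacompactSpace N]
      [ChartedSpace (Euc d') N] [IsManifold (𝓡 d') ∞ N] (g : N → M)
      (hg : ContMDiff (𝓡 d') (𝓡 d) ∞ g),
      canonicalForm f (A.pullback hg) (Φ.pullback hg) = (canonicalForm f A Φ).pullback g) := by
  exact ⟨fun q => ⟨Φ.isHolonomyPath_holPath q,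
      fun h hh => hh.unique (Φ.isHolonomyPath_holPath q)⟩,
    fun q => Φ.hol_proj q, Φ.contMDiff_hol,
    LoopBundle.IsBasic.isDescent (isBasic_stringFormTotal A Φ f),
    LoopBundle.IsBasic.isSmooth_descend (isBasic_stringFormTotal A Φ f)
      fun p V hp => contDiffOn_stringFormTotal A Φ f hp,
    LoopBundle.IsBasic.isDescent (isBasic_canonicalFormTotal A Φ f),
    LoopBundle.IsBasic.isSmooth_descend (isBasic_canonicalFormTotal A Φ f)
      fun p V hp => contDiffOn_canonicalFormTotal A Φ f hp,
    stringForm_eq A Φ f,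
    fun g hg => canonicalForm_pullback A Φ f hg⟩
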